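/- **Proposition 3.1 (Basic estimates).** Let $l>0$, $\Lambda=-3/l^2$, $M>0$ and $a>-\frac98$, and put $s=\min(\sqrt{9+8a},2)$. There are an $\epsilon>0$ and a constant $B_{M,l,a}$, both depending only on $M,l,a$, such that the estimate $(\ast)$ below holds for every development of every $\epsilon$-perturbed Schwarzschild-AdS data set, in particular for the maximal development. *Equations.* A spherically symmetric configuration consists of positive functions $r,\Omega$ and a function $\phi$ on a set $\mathcal Q$ of points $(u,v)$, the metric being $-\Omega^2\,du\,dv+r^2d\sigma_{S^2}$. Write $$\nu=r_u,\quad \lambda=r_v,\quad \zeta=r\phi_u,\quad \kappa=-\frac{\Omega^2}{4r_u},\quad \varpi=\frac r2\Big(1+\frac{4r_ur_v}{\Omega^2}\Big)+\frac{r^3}{2l^2},\quad 1-\mu=1-\frac{2\varpi}r+\frac{r^2}{l^2}.$$ The Einstein–Klein–Gordon equations are $$\partial_u\Big(\frac{r_u}{\Omega^2}\Big)=-4\pi r\frac{\phi_u^2}{\Omega^2},\qquad \partial_v\Big(\frac{r_v}{\Omega^2}\Big)=-4\pi r\frac{\phi_v^2}{\Omega^2},\qquad r_{uv}=-\frac{\Omega^2}{4r}-\frac{r_ur_v}{r}+\frac{2\pi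 r a\,\Omega^2\phi^2}{l^2}+\frac14 r\Omega^2\Lambda,$$ $$(\log\Omega)_{uv}=\frac{\Omega^2}{4r^2}+\frac{r_ur_v}{r^2}-4\pi\phi_u\phi_v,\qquad \phi_{uv}=-\frac{r_u}{r}\phi_v-\frac{r_v}{r}\phi_u-\frac{\Omega^2a}{2l^2}\phi .$$ *Data.* Let $u_0<u_1<u_0+\pi l$ and $v_0\in\mathbb R$, let $N(v_0)=(u_0,u_1]$, and let $\bar r$ solve $\bar r_u=-\frac12(1+\bar r^2/l^2)$ with $\bar r\to\infty$ at $u_0$. An $\epsilon$-perturbed Schwarzschild-AdS data set is given by a $C^2$ function $\bar\phi:N(v_0)\to\mathbb R$ with $$\bar r^{\frac32+\frac s2}\Big(|\bar\phi|+\Big|\bar r\frac{\bar\phi_u}{\bar r_u}\Big|\Big)+\Big|\bar r^{\frac72}\frac{\partial_u(\bar\phi_u/\bar r_u)}{\bar r_u}\Big|\le\epsilon\quad\text{on }N(v_0),$$ such that $\bar\Phi=\bar r^2\big[\bar r\,\partial_u(\bar\phi_u/\bar r_u)+4\bar\phi_u-\frac{2a\bar r_u}{\bar r}\bar\phi\big]$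 is integrable, $\Pi(u)=\int_{u_0}^u\bar\Phi\,d\bar u<\epsilon$ for all $u\in N(v_0)$, and $\int_{N(v_0)}\big(\bar\Phi^2\frac{\bar r^2}{-\bar r_u}+\Pi^2(-\bar r_u)\big)du<\epsilon^2$. *Developments.* A development of these data is a configuration on a relatively open subset $\mathcal Q$ of $\{u_0<u\le u_1,\ v\ge v_0\}$ containing $N(v_0)\times\{v_0\}$, with $r,\Omega,\phi$ of class $C^1$ (one-sided at boundary points belonging to $\mathcal Q$) satisfying the equations, and with $r=\bar r$, $\phi=\bar\phi$ on $v=v_0$. If $u_{\mathcal I}(v)$ denotes the infimum of $u$ on the line $v=\text{const}$ in $\mathcal Q$, then with $(u,v)$ the set $\mathcal Q$ contains all $(u,v')$, $v_0\le v'\le v$, and all $(u',v)$, $u_{\mathcal I}(v)<u'\le u$; where it is defined, $u_{\mathcal I}$ is continuous and strictly increasing; and at every point of null infinity $\mathcal I=\{(u_{\mathcal I}(v),v)\}$ one has, in the limit from $\mathcal Q$, $r\to\infty$, $\varpi\to M$, $\kappa\to\frac12$ and $r^{3/2}\phi\to0$. *Exterior region and norm.* Let $\mathcal R=\{\lambda>0,\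 \nu<0\}\subset\mathcal Q$, let $N(u)$ be the outgoing line $u=\text{const}$ in $\mathcal Q$, let $u_{\mathcal H}$ be the supremum of all $u>u_0$ such that $N(u)\subset\mathcal R$ and $r\to\infty$ along $N(u)$, and let $\mathcal R_{\mathcal H}=\mathcal R\cap\{u_0<u<u_{\mathcal H}\}$. Put $$\|\psi\|^2_{H^1_{AdS}(u,v)}=\int_{u_{\mathcal I}(v)}^u r^2\Big[\frac{r^2}{-r_u}(\partial_u\psi)^2-r_u\psi^2\Big](\bar u,v)\,d\bar u+\int_{v_0}^v r^2\Big[\frac{1-\mu}{r_v}(\partial_v\psi)^2+r_v\psi^2\Big](u,\bar v)\,d\bar v .$$ *Conclusion.* For all $(u,v)\in\mathcal R_{\mathcal H}$, $$|\varpi-M|^{\frac12}+|2\kappa-1|^{\frac12}+|r^{\frac32}\phi|+\Big|r^{\frac32}\frac\zeta\nu\Big|+\|\phi\|_{H^1_{AdS}(u,v)}\le B_{M,l,a}\Big[\|\phi\|_{H^1_{AdS}(u_{\mathcal H},v_0)}+\sup_{u_0<u'<u_{\mathcal H}}\Big|r^{\frac32}\frac\zeta\nu\Big|(u',v_0)\Big].\tag{$\ast$}$$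 -/

import Mathlib

open Set Filter Topology MeasureTheory

noncomputable section

namespace EKG

/-! ### Spherically symmetric field configurations in double null coordinates -/

/-- A spherically symmetric configuration `(Q, r, Ω, φ)` in double null coordinates `(u, v)`: the
metric is `-Ω² du dv + r² dσ_{S²}`, and only the values of `r`, `Ω`, `φ` on the quotient
`dom = Q ⊆ ℝ²` matter. -/
structure Config where
  dom : Set (ℝ × ℝ)
  r : ℝ → ℝ → ℝ
  Om : ℝ → ℝ → ℝ
  phi : ℝ → ℝ → ℝ

namespace Config

variable (S : Config)

/-- The part of the ingoing line `v = const` that lies in `Q`. -/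
def ingoing (v : ℝ) : Set ℝ := {u | (u, v) ∈ S.dom}

/-- The part `N(u)` of the outgoing line `u = const` that lies in `Q`. -/
def outgoing (u : ℝ) : Set ℝ := {v | (u, v) ∈ S.dom}

/-- The partial derivative `∂_u f`, one-sided at boundary points that belong to `Q`. -/
def du (f : ℝ → ℝ → ℝ) (u v : ℝ) : ℝ := derivWithin (fun x => f x v) (S.ingoing v) u

/-- The partial derivative `∂_v f`, one-sided at boundary points that belong to `Q`. -/
def dv (f : ℝ → ℝ → ℝ) (u v : ℝ) : ℝ := derivWithin (fun y => f u y) (S.outgoing u) v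

/-- `ν = r_u`. -/
def nu (u v : ℝ) : ℝ := S.du S.r u v

/-- `λ = r_v`. -/
def lam (u v : ℝ) : ℝ := S.dv S.r u v

/-- `ζ = r φ_u`. -/
def zeta (u v : ℝ) : ℝ := S.r u v * S.du S.phi u v

/-- `κ = - Ω² / (4 r_u)`. -/
def kappa (u v : ℝ) : ℝ := -(S.Om u v) ^ 2 / (4 * S.nu u v)

/-- The renormalized Hawking mass `ϖ = (r/2) (1 + 4 r_u r_v / Ω²) + r³ / (2 l²)`. -/
def varpi (l u v : ℝ) : ℝ :=
  S.r u v / 2 * (1 + 4 * S.nu u v * S.lam u v / (S.Om u v) ^ 2) + (S.r u v) ^ 3 / (2 * l ^ 2)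

/-- `1 - μ = 1 - 2 ϖ / r + r² / l²`. -/
def oneSubMu (l u v : ℝ) : ℝ := 1 - 2 * S.varpi l u v / S.r u v + (S.r u v) ^ 2 / l ^ 2

/-- The coordinate `u_I(v)` of the point where the line `v = const` meets null infinity, that is,
of the past end point of that line in `Q`. -/
def uI (v : ℝ) : ℝ := sInf (S.ingoing v)

/-- `f` is continuously differentiable on `Q`. -/
structure IsC1 (f : ℝ → ℝ → ℝ) : Prop where
  cont : ContinuousOn (fun p : ℝ × ℝ => f p.1 p.2) S.dom
  diff_u : ∀ u v, (u, v) ∈ S.dom →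
    DifferentiableWithinAt ℝ (fun x => f x v) (S.ingoing v) u
  diff_v : ∀ u v, (u, v) ∈ S.dom →
    DifferentiableWithinAt ℝ (fun y => f u y) (S.outgoing u) v
  cont_du : ContinuousOn (fun p : ℝ × ℝ => S.du f p.1 p.2) S.dom
  cont_dv : ContinuousOn (fun p : ℝ × ℝ => S.dv f p.1 p.2) S.dom

/-- On `Q` both mixed second derivatives of `f` exist and are equal to `g`. -/
def HasMixedDeriv (f g : ℝ → ℝ → ℝ) : Prop :=
  ∀ u v, (u, v) ∈ S.dom →
    HasDerivWithinAt (fun y => S.du f u y) (g u v) (S.outgoing u) v ∧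
    HasDerivWithinAt (fun x => S.dv f x v) (g u v) (S.ingoing v) u

/-- The spherically symmetric Einstein-Klein-Gordon system with `Λ = -3 / l²` and Klein-Gordon
mass parameter `a`, for positive `r`, `Ω` and `C¹` functions `r`, `Ω`, `φ`: the two Raychaudhuri
equations and the wave equations for `r`, `log Ω` and `φ`. No second derivatives are asked for
except those that occur in the equations. -/
structure SolvesEKG (l a : ℝ) : Prop where
  r_pos : ∀ u v, (u, v) ∈ S.dom → 0 < S.r u v
  Om_pos : ∀ u v, (u, v) ∈ S.dom → 0 < S.Om u v
  r_C1 : S.IsC1 S.r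
  Om_C1 : S.IsC1 S.Om
  phi_C1 : S.IsC1 S.phi
  raychaudhuri_u : ∀ u v, (u, v) ∈ S.dom →
    HasDerivWithinAt (fun x => S.du S.r x v / (S.Om x v) ^ 2)
      (-4 * Real.pi * S.r u v * (S.du S.phi u v) ^ 2 / (S.Om u v) ^ 2) (S.ingoing v) u
  raychaudhuri_v : ∀ u v, (u, v) ∈ S.dom →
    HasDerivWithinAt (fun y => S.dv S.r u y / (S.Om u y) ^ 2)
      (-4 * Real.pi * S.r u v * (S.dv S.phi u v) ^ 2 / (S.Om u v) ^ 2) (S.outgoing u) v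
  wave_r : S.HasMixedDeriv S.r fun u v =>
    -(S.Om u v) ^ 2 / (4 * S.r u v) - S.du S.r u v * S.dv S.r u v / S.r u v
      + 4 * Real.pi * S.r u v * (a * (S.Om u v) ^ 2 * (S.phi u v) ^ 2 / (2 * l ^ 2))
      + 1 / 4 * S.r u v * (S.Om u v) ^ 2 * (-3 / l ^ 2)
  wave_log_Om : S.HasMixedDeriv (fun u v => Real.log (S.Om u v)) fun u v =>
    (S.Om u v) ^ 2 / (4 * (S.r u v) ^ 2) + S.du S.r u v * S.dv S.r u v / (S.r u v) ^ 2
      - 4 * Real.pi * S.du S.phi u v * S.dv S.phi u v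
  wave_phi : S.HasMixedDeriv S.phi fun u v =>
    -(S.du S.r u v / S.r u v) * S.dv S.phi u v - S.dv S.r u v / S.r u v * S.du S.phi u v
      - (S.Om u v) ^ 2 * a / (2 * l ^ 2) * S.phi u v

end Config

/-! ### Perturbed Schwarzschild-AdS data on the ray `N(v₀) = (u₀, u₁]` -/

/-- The area radius on the initial ray: the solution of `r̄_u / (1 + r̄² / l²) = -1/2` that tends
to infinity at `u₀`, namely `r̄(u) = l cot ((u - u₀) / (2 l))`. -/
def rBar (l u₀ u : ℝ) : ℝ := l * Real.cot ((u - u₀) / (2 * l))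

/-- The derivative `r̄_u = -(1 + r̄² / l²) / 2`. -/
def rBarU (l u₀ u : ℝ) : ℝ := -(1 + (rBar l u₀ u) ^ 2 / l ^ 2) / 2

/-- The decay exponent `s = min (√(9 + 8 a), 2)`. -/
def decayExp (a : ℝ) : ℝ := min (Real.sqrt (9 + 8 * a)) 2

/-- `φ̄_u` on the initial ray. -/
def phiBarU (u₀ u₁ : ℝ) (phiBar : ℝ → ℝ) (u : ℝ) : ℝ := derivWithin phiBar (Ioc u₀ u₁) u

/-- `∂_u (φ̄_u / r̄_u)` on the initial ray. -/
def phiBarUU (l u₀ u₁ : ℝ) (phiBar : ℝ → ℝ) (u : ℝ) : ℝ :=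
  derivWithin (fun x => phiBarU u₀ u₁ phiBar x / rBarU l u₀ x) (Ioc u₀ u₁) u

/-- `Φ̄ = r̄² [ r̄ ∂_u (φ̄_u / r̄_u) + 4 φ̄_u - (2 a r̄_u / r̄) φ̄ ]`: up to lower order terms,
`r̄²` times the radial part of the Klein-Gordon operator applied to `φ̄`. -/
def PhiBar (l a u₀ u₁ : ℝ) (phiBar : ℝ → ℝ) (u : ℝ) : ℝ :=
  (rBar l u₀ u) ^ 2 * (rBar l u₀ u * phiBarUU l u₀ u₁ phiBar u
    + 4 * phiBarU u₀ u₁ phiBar u - 2 * a * rBarU l u₀ u / rBar l u₀ u * phiBar u)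

/-- `Π(u) = ∫_{u₀}^u Φ̄`. -/
def PiBar (l a u₀ u₁ : ℝ) (phiBar : ℝ → ℝ) (u : ℝ) : ℝ :=
  ∫ x in u₀..u, PhiBar l a u₀ u₁ phiBar x

/-- `φ̄` is the free function of an `ε`-perturbed Schwarzschild-AdS data set on
`N(v₀) = (u₀, u₁]`. The remaining data `ϖ`, `r_v`, `Ω` on `N(v₀)` are determined by `r̄` and `φ̄`
through the constraint `∂_u (r_u / Ω²) = -4π r φ_u² / Ω²` and the limits `ϖ → M`, `κ → 1/2` at
`u₀`; these enter the definition of a development below. -/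
structure IsPerturbedData (l a u₀ u₁ ε : ℝ) (phiBar : ℝ → ℝ) : Prop where
  lt : u₀ < u₁
  /-- This is the condition `r̄ > 0` on `N(v₀)`. -/
  lt_center : u₁ < u₀ + Real.pi * l
  smooth : ContDiffOn ℝ 2 phiBar (Ioc u₀ u₁)
  pointwise : ∀ u ∈ Ioc u₀ u₁,
    (rBar l u₀ u) ^ (3 / 2 + decayExp a / 2 : ℝ) *
        (|phiBar u| + |rBar l u₀ u * (phiBarU u₀ u₁ phiBar u / rBarU l u₀ u)|)
      + |(rBar l u₀ u) ^ (7 / 2 : ℝ) * (phiBarUU l u₀ u₁ phiBar u / rBarU l u₀ u)| ≤ ε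
  integrable : IntegrableOn (PhiBar l a u₀ u₁ phiBar) (Ioc u₀ u₁)
  primitive : ∀ u ∈ Ioc u₀ u₁, PiBar l a u₀ u₁ phiBar u < ε
  energy : ∫⁻ u in Ioc u₀ u₁, ENNReal.ofReal
      ((PhiBar l a u₀ u₁ phiBar u) ^ 2 * ((rBar l u₀ u) ^ 2 / (-rBarU l u₀ u))
        + (PiBar l a u₀ u₁ phiBar u) ^ 2 * (-rBarU l u₀ u)) < ENNReal.ofReal (ε ^ 2)

/-! ### Developments -/

/-- `S` is a development of the data `φ̄` on `N(v₀) = (u₀, u₁]`, asymptotically AdS with mass `M`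
and Dirichlet (reflecting) conditions at null infinity, in the double null coordinates normalized
by `-r_u / (1 + r² / l²) = 1/2` on `v = v₀` and `κ = 1/2` at null infinity. The maximal
development is one of them; no maximality is asked for. -/
structure IsDevelopment (l a M u₀ u₁ v₀ : ℝ) (phiBar : ℝ → ℝ) (S : Config) : Prop where
  /-- `Q` lies in `{u₀ < u ≤ u₁, v ≥ v₀}`, where it is relatively open. -/
  dom_subset : S.dom ⊆ Ioc u₀ u₁ ×ˢ Ici v₀
  dom_open : ∃ O : Set (ℝ × ℝ), IsOpen O ∧ S.dom = O ∩ (Iic u₁ ×ˢ Ici v₀)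
  /-- Every past directed null line in `Q` ends either on `N(v₀)` or at null infinity. -/
  data_mem : ∀ u ∈ Ioc u₀ u₁, (u, v₀) ∈ S.dom
  past_outgoing : ∀ u v, (u, v) ∈ S.dom → ∀ v' ∈ Icc v₀ v, (u, v') ∈ S.dom
  past_ingoing : ∀ u v, (u, v) ∈ S.dom → ∀ u' ∈ Ioc (S.uI v) u, (u', v) ∈ S.dom
  /-- Null infinity `{(u_I(v), v)}` is a timelike curve. -/
  uI_strictMono : StrictMonoOn S.uI {v | (S.ingoing v).Nonempty}
  uI_cont : ContinuousOn S.uI {v | (S.ingoing v).Nonempty}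
  /-- The Einstein-Klein-Gordon equations hold in `Q`, -/
  solves : S.SolvesEKG l a
  /-- with the prescribed data on `N(v₀)`, -/
  r_data : ∀ u ∈ Ioc u₀ u₁, S.r u v₀ = rBar l u₀ u
  phi_data : ∀ u ∈ Ioc u₀ u₁, S.phi u v₀ = phiBar u
  /-- and the boundary conditions `r = ∞`, `ϖ = M`, `κ = 1/2`, `r^{3/2} φ = 0` at infinity. -/
  r_infty : ∀ v, (S.ingoing v).Nonempty →
    Tendsto (fun p : ℝ × ℝ => S.r p.1 p.2) (𝓝[S.dom] (S.uI v, v)) atTop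
  varpi_infty : ∀ v, (S.ingoing v).Nonempty →
    Tendsto (fun p : ℝ × ℝ => S.varpi l p.1 p.2) (𝓝[S.dom] (S.uI v, v)) (𝓝 M)
  kappa_infty : ∀ v, (S.ingoing v).Nonempty →
    Tendsto (fun p : ℝ × ℝ => S.kappa p.1 p.2) (𝓝[S.dom] (S.uI v, v)) (𝓝 (1 / 2))
  phi_infty : ∀ v, (S.ingoing v).Nonempty →
    Tendsto (fun p : ℝ × ℝ => (S.r p.1 p.2) ^ (3 / 2 : ℝ) * S.phi p.1 p.2)
      (𝓝[S.dom] (S.uI v, v)) (𝓝 0)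

namespace Config

variable (S : Config)

/-- The regular region `R = {λ > 0, ν < 0}`. -/
def regular : Set (ℝ × ℝ) := {p | p ∈ S.dom ∧ 0 < S.lam p.1 p.2 ∧ S.nu p.1 p.2 < 0}

/-- `N(u)` lies in the regular region, and `r → ∞` along it. -/
def ReachesInfinity (u : ℝ) : Prop :=
  (∀ v ∈ S.outgoing u, (u, v) ∈ S.regular) ∧
    ∀ K : ℝ, ∃ v₁ ∈ S.outgoing u, ∀ v ∈ S.outgoing u, v₁ ≤ v → K ≤ S.r u v

/-- `u_H`, the supremum of all `u > u₀` for which `N(u)` is regular with `r → ∞` along it. -/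
def uH (u₀ : ℝ) : ℝ := sSup {u | u₀ < u ∧ S.ReachesInfinity u}

/-- `R_H = R ∩ {u₀ < u < u_H}`. -/
def exterior (u₀ : ℝ) : Set (ℝ × ℝ) := {p | p ∈ S.regular ∧ u₀ < p.1 ∧ p.1 < S.uH u₀}

/-- The norm `‖ψ‖_{H¹_AdS(u,v)}`, with values in `[0, ∞]`: the square root of
`∫_{u_I(v)}^u r² [r²/(-r_u) ψ_u² - r_u ψ²] (ū, v) dū + ∫_{v₀}^v r² [(1-μ)/r_v ψ_v² + r_v ψ²] (u, v̄) dv̄`.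
-/
def H1AdS (l v₀ : ℝ) (psi : ℝ → ℝ → ℝ) (u v : ℝ) : ENNReal :=
  ((∫⁻ x in Ioo (S.uI v) u, ENNReal.ofReal
      ((S.r x v) ^ 2 * ((S.r x v) ^ 2 / (-S.nu x v) * (S.du psi x v) ^ 2
        - S.nu x v * (psi x v) ^ 2)))
    + ∫⁻ y in Ioo v₀ v, ENNReal.ofReal
      ((S.r u y) ^ 2 * (S.oneSubMu l u y / S.lam u y * (S.dv psi u y) ^ 2
        + S.lam u y * (psi u y) ^ 2))) ^ (1 / 2 : ℝ)

/-- `|r^{3/2} ζ / ν|`. -/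
def zetaWeighted (u v : ℝ) : ℝ := |(S.r u v) ^ (3 / 2 : ℝ) * (S.zeta u v / S.nu u v)|

end Config

end EKG

end

namespace EKG

/-! The mass `ϖ` is not monotone when the Klein–Gordon mass term has the wrong sign (`a < 0`). A
boundary term of a Hardy inequality repairs this: `massTilde` is `ϖ + (3π/l²) b(r) (r³ + l² r - 2ϖ
l²) φ²`, where `c³ + l² c = 2Ml²` and `b` turns the bracket into `r³ - c³` when `ϖ = M`. Its
derivative in a null direction, times the derivative of `r`, is a quadratic form in `φ'` and `r'φ`.
For `ϖ` near `M` and small `φ` the form is positive definite when `9 < 2(4a + 9)`, which is the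
bound `a > -9/8` (`massTilde_coercive`).

Since `ν < 0 < λ` in the exterior, the modified mass decreases in `u` and increases in `v`. It
equals `M` at null infinity, and on `v = v₀` it differs from `M` by at most a constant times the
square `D²` of the data norm. Hence it stays in `[M - E D², M]` (`mt_le`, `mt_ge`), and its
variation along null lines controls the energy fluxes, with a weight `1 - μ` on `φ_u²` that
degenerates at the horizon.

The degeneration is removed by the red-shift. Along `N(u)` the quantity `ζ/ν` obeys a damped
equation whose source `φ_v` is absorbed by the flux, so `r³(ζ/ν)²` is bounded by `D²` and the
supremum `P` of `r³φ²` (`redshift`). Integrating `φ_u` in from infinity bounds `r³φ²` by the flux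
and an arbitrarily small multiple of the `ζ/ν` bound (`field_of_zeta`). So the supremum can be
absorbed, and `φ`, `ζ/ν`, `ϖ`, `κ` and the norm follow (`exists_estimates`).

All this assumes that `ϖ`, `κ`, `r³φ²` are within `δ` of `M`, `1/2`, `0` in the causal past. For
small `ε` the estimates improve `δ` to `δ/2`, and a continuity argument closes the bootstrap
(`pastBounds_of_improve`). The constants in the estimates do not involve `ε`, so they can then be
used again with `D` equal to the right-hand side of the claim. -/

theorem rpow_three_halves_mul_sq {r : ℝ} (hr : 0 ≤ r) (x : ℝ) :
    (r ^ (3 / 2 : ℝ) * x) ^ 2 = r ^ 3 * x ^ 2 := by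
  rw [mul_pow, ← Real.rpow_natCast (r ^ (3 / 2 : ℝ)) 2, ← Real.rpow_mul hr]
  norm_num

/-! ### Calculus on half-open intervals -/

/-- Derivatives of a configuration are taken within a whole null line `s` of `Q`, hence the larger
set. The interval is open on the left because that end is null infinity, which is not in `Q`. -/
theorem antitoneOn_of_hasDerivWithinAt {a b : ℝ} {s : Set ℝ} (hs : Ioc a b ⊆ s) {F F' : ℝ → ℝ}
    (hF : ∀ x ∈ Ioc a b, HasDerivWithinAt F (F' x) s x) (hF' : ∀ x ∈ Ioc a b, F' x ≤ 0) :
    AntitoneOn F (Ioc a b) := by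
  refine antitoneOn_of_hasDerivWithinAt_nonpos (f' := F') (convex_Ioc a b)
    (fun x hx => ((hF x hx).mono hs).continuousWithinAt) ?_ ?_
  · intro x hx
    exact (hF x (interior_subset hx)).mono (interior_subset.trans hs)
  · intro x hx
    exact hF' x (interior_subset hx)

/-- A function with nonpositive derivative on `(a, b]` stays below its limit at `a`. -/
theorem le_of_hasDerivWithinAt_nonpos {a b L : ℝ} (hab : a < b) {s : Set ℝ} (hs : Ioc a b ⊆ s)
    {F F' : ℝ → ℝ} (hF : ∀ x ∈ Ioc a b, HasDerivWithinAt F (F' x) s x)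
    (hF' : ∀ x ∈ Ioc a b, F' x ≤ 0) (hL : Tendsto F (𝓝[>] a) (𝓝 L)) : F b ≤ L := by
  have hanti := antitoneOn_of_hasDerivWithinAt hs hF hF'
  refine ge_of_tendsto hL ?_
  filter_upwards [Ioc_mem_nhdsGT hab] with x hx
  exact hanti hx ⟨hab, le_rfl⟩ hx.2

theorem monotoneOn_Icc_of_hasDerivWithinAt {a b : ℝ} {s : Set ℝ} (hs : Icc a b ⊆ s)
    {F F' : ℝ → ℝ} (hF : ∀ x ∈ Icc a b, HasDerivWithinAt F (F' x) s x)
    (hF' : ∀ x ∈ Icc a b, 0 ≤ F' x) : MonotoneOn F (Icc a b) := by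
  refine monotoneOn_of_hasDerivWithinAt_nonneg (f' := F') (convex_Icc a b)
    (fun x hx => ((hF x hx).mono hs).continuousWithinAt) ?_ ?_
  · intro x hx
    exact (hF x (interior_subset hx)).mono (interior_subset.trans hs)
  · intro x hx
    exact hF' x (interior_subset hx)

/-- A nonnegative function dominated by the derivative of `F` on `[a, b]` has integral at most
`F b - F a`. -/
theorem lintegral_Ioc_le_of_le_deriv {a b : ℝ} (hab : a ≤ b) {s : Set ℝ} (hs : Icc a b ⊆ s)
    {f F F' : ℝ → ℝ} (hF : ∀ x ∈ Icc a b, HasDerivWithinAt F (F' x) s x)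
    (hf : ContinuousOn f (Icc a b)) (hf0 : ∀ x ∈ Icc a b, 0 ≤ f x)
    (hfF : ∀ x ∈ Icc a b, f x ≤ F' x) :
    ∫⁻ x in Ioc a b, ENNReal.ofReal (f x) ≤ ENNReal.ofReal (F b - F a) := by
  have hint : IntegrableOn f (Icc a b) := hf.integrableOn_Icc
  have h1 : ∫ y in a..b, f y ≤ F b - F a := by
    refine intervalIntegral.integral_le_sub_of_hasDeriv_right_of_le (g' := F') hab
      (fun x hx => ((hF x hx).mono hs).continuousWithinAt) ?_ hint ?_
    · intro x hx
      have hx' := Ioo_subset_Icc_self hx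
      have : HasDerivAt F (F' x) x :=
        ((hF x hx').mono hs).hasDerivAt (Icc_mem_nhds hx.1 hx.2)
      exact this.hasDerivWithinAt
    · intro x hx
      exact hfF x (Ioo_subset_Icc_self hx)
  rw [← ofReal_integral_eq_lintegral_ofReal (hint.mono_set Ioc_subset_Icc_self)]
  · rw [← intervalIntegral.integral_of_le hab]
    exact ENNReal.ofReal_le_ofReal h1
  · refine (ae_restrict_iff' measurableSet_Ioc).2 (Eventually.of_forall fun x hx => ?_)
    exact hf0 x (Ioc_subset_Icc_self hx)

/-- The same on `(a, b]`, with a lower bound for `F` in place of its value at `a`. -/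
theorem lintegral_Ioo_le_of_le_deriv {a b L : ℝ} {s : Set ℝ} (hs : Ioc a b ⊆ s)
    {f F F' : ℝ → ℝ} (hF : ∀ x ∈ Ioc a b, HasDerivWithinAt F (F' x) s x)
    (hf : ContinuousOn f (Ioc a b)) (hf0 : ∀ x ∈ Ioc a b, 0 ≤ f x)
    (hfF : ∀ x ∈ Ioc a b, f x ≤ F' x) (hL : ∀ x ∈ Ioc a b, L ≤ F x) :
    ∫⁻ x in Ioo a b, ENNReal.ofReal (f x) ≤ ENNReal.ofReal (F b - L) := by
  rcases le_or_gt b a with hba | hab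
  · simp [Ioo_eq_empty (not_lt.2 hba)]
  -- Integrability of `f` near `a` is not known beforehand, so `(a, b]` is exhausted by compact
  -- intervals and monotone convergence is used.
  obtain ⟨t, htanti, ht, htlim⟩ := exists_seq_strictAnti_tendsto' hab
  have hunion : (⋃ n, Ioc (t n) b) = Ioc a b := by
    ext x
    simp only [mem_iUnion, mem_Ioc]
    constructor
    · rintro ⟨n, h1, h2⟩
      exact ⟨(ht n).1.trans h1, h2⟩
    · rintro ⟨h1, h2⟩
      obtain ⟨n, hn⟩ := (htlim.eventually_lt_const h1).exists
      exact ⟨n, hn, h2⟩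
  have hdir : Directed (· ⊆ ·) fun n => Ioc (t n) b := by
    exact Monotone.directed_le fun i j hij => Ioc_subset_Ioc_left (htanti.antitone hij)
  calc ∫⁻ x in Ioo a b, ENNReal.ofReal (f x)
      ≤ ∫⁻ x in ⋃ n, Ioc (t n) b, ENNReal.ofReal (f x) := by
        rw [hunion]; exact lintegral_mono_set Ioo_subset_Ioc_self
    _ = ⨆ n, ∫⁻ x in Ioc (t n) b, ENNReal.ofReal (f x) := by
        rw [setLIntegral_iUnion_of_directed _ hdir]
    _ ≤ ENNReal.ofReal (F b - L) := by
        refine iSup_le fun n => ?_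
        have hsub : Icc (t n) b ⊆ Ioc a b := fun x hx => ⟨(ht n).1.trans_le hx.1, hx.2⟩
        refine (lintegral_Ioc_le_of_le_deriv (ht n).2.le (hsub.trans hs)
          (fun x hx => hF x (hsub hx)) (hf.mono hsub) (fun x hx => hf0 x (hsub hx))
          (fun x hx => hfF x (hsub hx))).trans ?_
        exact ENNReal.ofReal_le_ofReal
          (sub_le_sub_left (hL _ (hsub ⟨le_rfl, (ht n).2.le⟩)) _)

/-- The increment of `F` over `(a, b]` is controlled by an integral bound for its derivative. -/
theorem sub_le_of_deriv_le_lintegral {a b L K C : ℝ} (hab : a < b) (hC : 0 ≤ C) (hK : 0 ≤ K)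
    {s : Set ℝ} (hs : Ioc a b ⊆ s)
    {f F F' : ℝ → ℝ} (hF : ∀ x ∈ Ioc a b, HasDerivWithinAt F (F' x) s x)
    (hf : ContinuousOn f (Ioc a b)) (hf0 : ∀ x ∈ Ioc a b, 0 ≤ f x)
    (hfF : ∀ x ∈ Ioc a b, F' x ≤ C * f x) (hL : Tendsto F (𝓝[>] a) (𝓝 L))
    (hint : ∫⁻ x in Ioo a b, ENNReal.ofReal (f x) ≤ ENNReal.ofReal K) :
    F b - L ≤ C * K := by
  have hlim : Tendsto (fun x => F b - F x) (𝓝[>] a) (𝓝 (F b - L)) := tendsto_const_nhds.sub hL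
  refine le_of_tendsto hlim ?_
  filter_upwards [Ioo_mem_nhdsGT hab] with t ht
  have hsub : Icc t b ⊆ Ioc a b := fun x hx => ⟨ht.1.trans_le hx.1, hx.2⟩
  have hi : IntegrableOn f (Icc t b) := (hf.mono hsub).integrableOn_Icc
  have h1 : F b - F t ≤ ∫ y in t..b, C * f y := by
    refine intervalIntegral.sub_le_integral_of_hasDeriv_right_of_le (g' := F') ht.2.le
      (fun x hx => ((hF x (hsub hx)).mono (hsub.trans hs)).continuousWithinAt) ?_
      (hi.const_mul C) ?_
    · intro x hx
      have hx' := Ioo_subset_Icc_self hx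
      exact (((hF x (hsub hx')).mono (hsub.trans hs)).hasDerivAt
        (Icc_mem_nhds hx.1 hx.2)).hasDerivWithinAt
    · intro x hx
      exact hfF x (hsub (Ioo_subset_Icc_self hx))
  refine h1.trans ?_
  rw [intervalIntegral.integral_const_mul]
  refine mul_le_mul_of_nonneg_left ?_ hC
  rw [intervalIntegral.integral_of_le ht.2.le, integral_Ioc_eq_integral_Ioo]
  have hsub2 : Ioo t b ⊆ Ioo a b := Ioo_subset_Ioo_left ht.1.le
  have h2 : ENNReal.ofReal (∫ x in Ioo t b, f x) ≤ ENNReal.ofReal K := by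
    rw [ofReal_integral_eq_lintegral_ofReal (hi.mono_set Ioo_subset_Icc_self)]
    · exact (lintegral_mono_set hsub2).trans hint
    · refine (ae_restrict_iff' measurableSet_Ioo).2 (Eventually.of_forall fun x hx => ?_)
      exact hf0 x (hsub (Ioo_subset_Icc_self hx))
  exact (ENNReal.ofReal_le_ofReal_iff hK).1 h2

/-- A barrier argument: if `Q' < 0` wherever `Q > K`, then `Q ≤ max (Q a) K` on `[a, b]`. -/
theorem le_max_of_deriv_neg_of_lt {a b K : ℝ} (hab : a ≤ b) {s : Set ℝ} (hs : Icc a b ⊆ s)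
    {Q Q' : ℝ → ℝ} (hQ : ∀ x ∈ Icc a b, HasDerivWithinAt Q (Q' x) s x)
    (hQ' : ∀ x ∈ Icc a b, K < Q x → Q' x < 0) : Q b ≤ max (Q a) K := by
  -- Comparison with a constant strictly above the maximum: where `Q` touches it, `Q > K` strictly,
  -- so the derivative is negative there.
  refine le_of_forall_gt_imp_ge_of_dense fun B hB => ?_
  have hcont : ContinuousOn Q (Icc a b) :=
    fun x hx => ((hQ x hx).mono hs).continuousWithinAt
  refine image_le_of_deriv_right_lt_deriv_boundary (f := Q) (f' := Q') (B := fun _ => B)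
    (B' := fun _ => 0) hcont ?_ ((le_max_left _ _).trans hB.le)
    (fun x => hasDerivAt_const x B) ?_ (right_mem_Icc.2 hab)
  · intro x hx
    refine ((hQ x (Ico_subset_Icc_self hx)).mono hs).mono_of_mem_nhdsWithin ?_
    exact Icc_mem_nhdsGE_of_mem hx
  · intro x hx hxB
    refine hQ' x (Ico_subset_Icc_self hx) ?_
    rw [hxB]
    exact (le_max_right _ _).trans_lt hB

/-! ### The modified mass -/

/-- The weight by which `r³ + l² r - 2 M l²` becomes `r³ - c³` when `c³ + l² c = 2 M l²`. -/
noncomputable def hardyWeight (l c r : ℝ) : ℝ :=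
  (r ^ 2 + r * c + c ^ 2) / (r ^ 2 + r * c + c ^ 2 + l ^ 2)

/-- The derivative of `hardyWeight`. -/
noncomputable def hardyWeightDeriv (l c r : ℝ) : ℝ :=
  l ^ 2 * (2 * r + c) / (r ^ 2 + r * c + c ^ 2 + l ^ 2) ^ 2

/-- The Hawking mass with the boundary term of a Hardy inequality added to it. -/
noncomputable def massTilde (l c r w p : ℝ) : ℝ :=
  w + 3 * Real.pi / l ^ 2 * (hardyWeight l c r * (r ^ 3 + l ^ 2 * r - 2 * w * l ^ 2) * p ^ 2)

/-- The derivative of `massTilde` along a curve. -/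
noncomputable def massTildeDeriv (l c r w p r' w' p' : ℝ) : ℝ :=
  w' + 3 * Real.pi / l ^ 2 *
    ((hardyWeightDeriv l c r * r' * (r ^ 3 + l ^ 2 * r - 2 * w * l ^ 2)
      + hardyWeight l c r * (3 * r ^ 2 * r' + l ^ 2 * r' - 2 * w' * l ^ 2)) * p ^ 2
      + hardyWeight l c r * (r ^ 3 + l ^ 2 * r - 2 * w * l ^ 2) * (2 * p * p'))

theorem hardyWeight_nonneg {l c r : ℝ} (hc : 0 < c) (hr : 0 < r) : 0 ≤ hardyWeight l c r := by
  unfold hardyWeight; positivity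

theorem hardyWeight_le_one {l c r : ℝ} (hc : 0 < c) (hr : 0 < r) : hardyWeight l c r ≤ 1 := by
  unfold hardyWeight
  rw [div_le_one (by positivity)]
  nlinarith [sq_nonneg l]

theorem hasDerivAt_hardyWeight {l c r : ℝ} (hc : 0 < c) (hr : 0 < r) :
    HasDerivAt (hardyWeight l c) (hardyWeightDeriv l c r) r := by
  have hN : r ^ 2 + r * c + c ^ 2 + l ^ 2 ≠ 0 := by positivity
  have h1 : HasDerivAt (fun r : ℝ => r ^ 2 + r * c + c ^ 2) (2 * r + c) r := by
    have := (((hasDerivAt_id r).pow 2).add ((hasDerivAt_id r).mul_const c)).add_const (c ^ 2)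
    refine this.congr_deriv ?_
    simp
  have h2 := h1.div (h1.add_const (l ^ 2)) hN
  refine h2.congr_deriv ?_
  unfold hardyWeightDeriv
  congr 1
  ring

theorem hasDerivWithinAt_massTilde {l c x : ℝ} {s : Set ℝ} {r w p : ℝ → ℝ} {r' w' p' : ℝ}
    (hc : 0 < c) (hr0 : 0 < r x) (hr : HasDerivWithinAt r r' s x)
    (hw : HasDerivWithinAt w w' s x) (hp : HasDerivWithinAt p p' s x) :
    HasDerivWithinAt (fun t => massTilde l c (r t) (w t) (p t))
      (massTildeDeriv l c (r x) (w x) (p x) r' w' p') s x := by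
  have hb := (hasDerivAt_hardyWeight (l := l) hc hr0).comp_hasDerivWithinAt x hr
  have hh := ((hr.pow 3).add (hr.const_mul (l ^ 2))).sub ((hw.const_mul 2).mul_const (l ^ 2))
  have := hw.add ((((hb.mul hh).mul (hp.pow 2))).const_mul (3 * Real.pi / l ^ 2))
  refine this.congr_deriv ?_
  unfold massTildeDeriv
  simp only [Function.comp_apply, Pi.mul_apply, Pi.add_apply, Pi.sub_apply, Pi.pow_apply]
  push_cast
  ring

/-- In the coercivity estimate this derivative appears only multiplied by `ϖ - M`; its `1/r` decay
makes that error negligible against `r²`. -/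
theorem hardyWeightDeriv_bound {l c r : ℝ} (hc : 0 < c) (hr : 0 < r) :
    0 ≤ hardyWeightDeriv l c r ∧ hardyWeightDeriv l c r * r ≤ 2 := by
  unfold hardyWeightDeriv
  refine ⟨by positivity, ?_⟩
  rw [div_mul_eq_mul_div, div_le_iff₀ (by positivity)]
  have h1 : (2 * r + c) * r ≤ 2 * (r ^ 2 + r * c + c ^ 2 + l ^ 2) := by
    nlinarith [mul_pos hc hr, sq_nonneg c, sq_nonneg l]
  have h2 : l ^ 2 ≤ r ^ 2 + r * c + c ^ 2 + l ^ 2 := by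
    nlinarith [mul_pos hc hr, sq_nonneg c, sq_nonneg r]
  calc l ^ 2 * (2 * r + c) * r = l ^ 2 * ((2 * r + c) * r) := by ring
    _ ≤ (r ^ 2 + r * c + c ^ 2 + l ^ 2) * (2 * (r ^ 2 + r * c + c ^ 2 + l ^ 2)) := by
        apply mul_le_mul h2 h1 <;> positivity
    _ = _ := by ring

theorem quadratic_form_nonneg {A B C x y : ℝ} (hA : 0 < A) (h : B ^ 2 ≤ A * C) :
    0 ≤ A * x ^ 2 + 2 * B * (x * y) + C * y ^ 2 := by
  have h1 : 0 ≤ A * (A * x ^ 2 + 2 * B * (x * y) + C * y ^ 2) := by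
    have : A * (A * x ^ 2 + 2 * B * (x * y) + C * y ^ 2)
        = (A * x + B * y) ^ 2 + (A * C - B ^ 2) * y ^ 2 := by ring
    rw [this]
    have := mul_nonneg (sub_nonneg.2 h) (sq_nonneg y)
    positivity
  exact nonneg_of_mul_nonneg_right h1 hA

/-- The quadratic form that controls the growth of the modified mass is positive. -/
theorem hardy_form_nonneg {l a M r₀ δ e η c r w p b d h x y : ℝ}
    (hc : 0 < c)
    (hr₀ : 0 < r₀) (he : 0 < e) (he1 : e ≤ 1 / 6) (he2 : e * (20 * |a| + 40) ≤ 8 * a + 9)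
    (hδ1 : 12 * l ^ 2 * δ ≤ e * r₀ ^ 3) (hδ2 : 6 * Real.pi * δ ≤ e * r₀ ^ 3)
    (hη : η ≤ e) (hηl : η * l ^ 2 ≤ e) (hr : r₀ ≤ r)
    (hw : |w - M| ≤ δ) (hp : r ^ 3 * p ^ 2 ≤ δ) (hhpos : 0 < h)
    (hb0 : 0 ≤ b) (hb1 : b ≤ 1) (hd0 : 0 ≤ d) (hd1 : d * r ≤ 2)
    (id1 : b * h = r ^ 3 - c ^ 3 - 2 * l ^ 2 * (w - M) * b) :
    0 ≤ ((2 * (1 - 6 * Real.pi * b * p ^ 2) - η) * (r * h)) * x ^ 2 + 2 * (3 * b * h) * (x * y)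
      + ((4 * a * (1 - 6 * Real.pi * b * p ^ 2) + 9) * r ^ 2 - 6 * l ^ 2 * (w - M) * d
        - η * l ^ 2 * r ^ 2) * y ^ 2 := by
  have hpi := Real.pi_pos
  have hrpos : 0 < r := hr₀.trans_le hr
  have hr3 : r₀ ^ 3 ≤ r ^ 3 := by gcongr
  have hr3pos : 0 < r ^ 3 := by positivity
  have hr₀3 : 0 < r₀ ^ 3 := by positivity
  have hδ0 : 0 ≤ δ := (abs_nonneg _).trans hw
  have hwabs := abs_le.1 hw
  -- The Hardy term contains `-2ϖ l²`, so differentiating it multiplies `ϖ'` by `θ`, which is close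
  -- to `1` for small fields.
  set θ : ℝ := 1 - 6 * Real.pi * b * p ^ 2 with hθ
  have hbp : 6 * Real.pi * b * p ^ 2 ≤ e := by
    have h1 : r₀ ^ 3 * p ^ 2 ≤ δ := (mul_le_mul_of_nonneg_right hr3 (sq_nonneg p)).trans hp
    have h2 : 6 * Real.pi * p ^ 2 * r₀ ^ 3 ≤ e * r₀ ^ 3 := by
      have := mul_le_mul_of_nonneg_left h1 (by positivity : 0 ≤ 6 * Real.pi)
      linarith
    have h3 : 6 * Real.pi * p ^ 2 ≤ e := le_of_mul_le_mul_right h2 hr₀3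
    have h4 : 0 ≤ 6 * Real.pi * p ^ 2 := by positivity
    have h5 := mul_le_mul_of_nonneg_right hb1 h4
    linarith
  have hθ1 : θ ≤ 1 := by
    have : 0 ≤ 6 * Real.pi * b * p ^ 2 := by positivity
    linarith
  have hθe : 1 - e ≤ θ := by linarith
  have hbh : b * h ≤ (1 + e) * r ^ 3 := by
    have h1 : -(2 * l ^ 2 * (w - M) * b) ≤ 2 * l ^ 2 * δ := by
      have h0 : -(w - M) * b ≤ δ := by
        have := mul_le_mul_of_nonneg_right (neg_le.1 hwabs.1) hb0
        have := mul_le_mul_of_nonneg_left hb1 hδ0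
        linarith
      have := mul_le_mul_of_nonneg_left h0 (by positivity : 0 ≤ 2 * l ^ 2)
      linarith
    have h2 : 0 < c ^ 3 := by positivity
    have h3 : 2 * l ^ 2 * δ ≤ e * r ^ 3 := by
      have := mul_nonneg (sq_nonneg l) hδ0
      have := mul_le_mul_of_nonneg_left hr3 he.le
      linarith
    rw [id1]; linarith
  have hwd : 6 * l ^ 2 * (w - M) * d ≤ e * r ^ 2 := by
    have h1 : (w - M) * (d * r) ≤ 2 * δ := by
      have h0 : 0 ≤ d * r := by positivity
      have := mul_le_mul_of_nonneg_right hwabs.2 h0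
      have := mul_le_mul_of_nonneg_left hd1 hδ0
      linarith
    have h2 : 6 * l ^ 2 * (w - M) * d * r ≤ e * r ^ 2 * r := by
      have := mul_le_mul_of_nonneg_left h1 (by positivity : 0 ≤ 6 * l ^ 2)
      have := mul_le_mul_of_nonneg_left hr3 he.le
      linarith
    exact le_of_mul_le_mul_right h2 hrpos
  set A : ℝ := (2 * θ - η) * (r * h) with hA
  set C : ℝ := (4 * a * θ + 9) * r ^ 2 - 6 * l ^ 2 * (w - M) * d - η * l ^ 2 * r ^ 2 with hC
  have hApos : 0 < A := by
    have : 0 < 2 * θ - η := by linarith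
    positivity
  have haθ : 4 * a - 4 * |a| * e ≤ 4 * a * θ := by
    rcases le_or_gt 0 a with h0 | h0
    · rw [abs_of_nonneg h0]; nlinarith
    · rw [abs_of_neg h0]; nlinarith
  have hCge : (4 * a + 9 - (4 * |a| + 2) * e) * r ^ 2 ≤ C := by
    have h1 : η * l ^ 2 * r ^ 2 ≤ e * r ^ 2 := by gcongr
    have h2 := mul_le_mul_of_nonneg_right haθ (sq_nonneg r)
    rw [hC]
    linarith
  -- At `e = 0` this is `9 ≤ 2(4a + 9)`, the Breitenlohner–Freedman bound. The terms linear in `e`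
  -- cost at most `e(20|a| + 40)`, which is where that hypothesis comes from.
  have hnum : 9 * (1 + e) ≤ (2 - 3 * e) * (4 * a + 9 - (4 * |a| + 2) * e) := by
    have h3 : a ≤ |a| := le_abs_self a
    have h4 : 0 ≤ |a| := abs_nonneg a
    have h5 := mul_le_mul_of_nonneg_right h3 he.le
    have h6 : 0 ≤ 3 * e ^ 2 * (4 * |a| + 2) := by positivity
    linarith
  have hK0 : 0 ≤ 4 * a + 9 - (4 * |a| + 2) * e := by
    have h5 : 0 ≤ |a| * e := by positivity
    linarith
  have hAC : (3 * b * h) ^ 2 ≤ A * C := by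
    have hAge : (2 - 3 * e) * (r * h) ≤ A := by
      rw [hA]
      have : 2 - 3 * e ≤ 2 * θ - η := by linarith
      have : 0 ≤ r * h := by positivity
      nlinarith
    -- Only one factor `b` is estimated by `1` and only one product `bh` by `r³`. The factor `h`
    -- that remains matches the one in `A`, so the inequality survives where `h` tends to `0` at the
    -- horizon.
    calc (3 * b * h) ^ 2 = 9 * b * (b * h) * h := by ring
      _ ≤ 9 * 1 * ((1 + e) * r ^ 3) * h := by gcongr
      _ = (9 * (1 + e)) * (r ^ 3 * h) := by ring
      _ ≤ ((2 - 3 * e) * (4 * a + 9 - (4 * |a| + 2) * e)) * (r ^ 3 * h) := by gcongr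
      _ = ((2 - 3 * e) * (r * h)) * ((4 * a + 9 - (4 * |a| + 2) * e) * r ^ 2) := by ring
      _ ≤ A * C := by
        have : 0 ≤ (4 * a + 9 - (4 * |a| + 2) * e) * r ^ 2 := by positivity
        exact mul_le_mul hAge hCge this hApos.le
  exact quadratic_form_nonneg hApos hAC

/-- Coercivity of the modified mass: this is where the Breitenlohner-Freedman bound
`a > -9/8` enters, as the hypothesis that bounds `e`. -/
theorem massTilde_coercive {l a M c r₀ δ e : ℝ} (hl : 0 < l) (hc : 0 < c)
    (hcM : c ^ 3 + l ^ 2 * c = 2 * M * l ^ 2) (hr₀ : 0 < r₀)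
    (he : 0 < e) (he1 : e ≤ 1 / 6) (he2 : e * (20 * |a| + 40) ≤ 8 * a + 9)
    (hδ1 : 12 * l ^ 2 * δ ≤ e * r₀ ^ 3) (hδ2 : 6 * Real.pi * δ ≤ e * r₀ ^ 3)
    {η : ℝ} (hη : η ≤ e) (hηl : η * l ^ 2 ≤ e)
    {r w p r' w' p' m : ℝ} (hr : r₀ ≤ r) (hm : m = 1 - 2 * w / r + r ^ 2 / l ^ 2) (hm0 : 0 < m)
    (hw : |w - M| ≤ δ) (hp : r ^ 3 * p ^ 2 ≤ δ)
    (hw' : w' * r' = 2 * Real.pi * r ^ 2 * m * p' ^ 2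
      + 4 * Real.pi * r ^ 2 * a / l ^ 2 * r' ^ 2 * p ^ 2) :
    Real.pi * η * (r ^ 2 * m * p' ^ 2 + r ^ 2 * r' ^ 2 * p ^ 2)
      ≤ massTildeDeriv l c r w p r' w' p' * r' := by
  have hpi := Real.pi_pos
  have hrpos : 0 < r := hr₀.trans_le hr
  obtain ⟨hb0, hb1⟩ : 0 ≤ hardyWeight l c r ∧ hardyWeight l c r ≤ 1 :=
    ⟨hardyWeight_nonneg hc hrpos, hardyWeight_le_one hc hrpos⟩
  obtain ⟨hd0, hd1⟩ := hardyWeightDeriv_bound (l := l) hc hrpos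
  set h : ℝ := r ^ 3 + l ^ 2 * r - 2 * w * l ^ 2 with hh
  have hhm : h = r * l ^ 2 * m := by
    rw [hm, hh]; field_simp; ring
  have hhpos : 0 < h := by rw [hhm]; positivity
  -- the two exact identities for the Hardy weight
  have id1 : hardyWeight l c r * h = r ^ 3 - c ^ 3 - 2 * l ^ 2 * (w - M) * hardyWeight l c r := by
    have hN : r ^ 2 + r * c + c ^ 2 + l ^ 2 ≠ 0 := by positivity
    have e1 : h = (r - c) * (r ^ 2 + r * c + c ^ 2 + l ^ 2) - 2 * l ^ 2 * (w - M) := by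
      rw [hh]; linear_combination hcM
    have e2 : hardyWeight l c r * (r ^ 2 + r * c + c ^ 2 + l ^ 2) = r ^ 2 + r * c + c ^ 2 := by
      unfold hardyWeight; field_simp
    rw [e1]
    linear_combination (r - c) * e2
  have id2 : hardyWeightDeriv l c r * h + hardyWeight l c r * (3 * r ^ 2 + l ^ 2)
      = 3 * r ^ 2 - 2 * l ^ 2 * (w - M) * hardyWeightDeriv l c r := by
    have hN : r ^ 2 + r * c + c ^ 2 + l ^ 2 ≠ 0 := by positivity
    have e1 : h = (r - c) * (r ^ 2 + r * c + c ^ 2 + l ^ 2) - 2 * l ^ 2 * (w - M) := by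
      rw [hh]; linear_combination hcM
    rw [e1]
    unfold hardyWeight hardyWeightDeriv
    field_simp
    ring
  have hform := hardy_form_nonneg (x := p') (y := r' * p) hc hr₀ he he1 he2 hδ1 hδ2 hη hηl hr hw hp
    hhpos hb0 hb1 hd0 hd1 id1
  generalize hbw : hardyWeight l c r = b at *
  generalize hdw : hardyWeightDeriv l c r = d at *
  set θ : ℝ := 1 - 6 * Real.pi * b * p ^ 2 with hθ
  -- The factor `r'` makes the expression a quadratic form in `p'` and `r' p`, so one inequality
  -- serves both null directions, whatever the sign of `r'`.
  have key : massTildeDeriv l c r w p r' w' p' * r'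
      - Real.pi * η * (r ^ 2 * m * p' ^ 2 + r ^ 2 * r' ^ 2 * p ^ 2)
      = Real.pi / l ^ 2 * (((2 * θ - η) * (r * h)) * p' ^ 2 + 2 * (3 * b * h) * (p' * (r' * p))
        + ((4 * a * θ + 9) * r ^ 2 - 6 * l ^ 2 * (w - M) * d - η * l ^ 2 * r ^ 2) * (r' * p) ^ 2) := by
    have hm2 : m = h / (r * l ^ 2) := by rw [hhm]; field_simp
    have hdef : massTildeDeriv l c r w p r' w' p' * r' = w' * r' * θ + 3 * Real.pi / l ^ 2 *
        ((d * h + b * (3 * r ^ 2 + l ^ 2)) * (r' * p) ^ 2 + 2 * (b * h) * (p' * (r' * p))) := by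
      unfold massTildeDeriv
      rw [hbw, hdw, ← hh, hθ]
      field_simp
      ring
    rw [hdef, hw', id2, hm2, hθ]
    field_simp
    ring
  have : 0 ≤ Real.pi / l ^ 2 *
      (((2 * θ - η) * (r * h)) * p' ^ 2 + 2 * (3 * b * h) * (p' * (r' * p))
        + ((4 * a * θ + 9) * r ^ 2 - 6 * l ^ 2 * (w - M) * d - η * l ^ 2 * r ^ 2) * (r' * p) ^ 2) 
        := by positivity
  linarith

namespace Config

variable {S : Config} {l a : ℝ}

/-! ### Consequences of the equations at a point -/

theorem IsC1.hasDerivWithinAt_u {f : ℝ → ℝ → ℝ} (hf : S.IsC1 f) {u v : ℝ} (h : (u, v) ∈ S.dom) :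
    HasDerivWithinAt (fun x => f x v) (S.du f u v) (S.ingoing v) u :=
  (hf.diff_u u v h).hasDerivWithinAt

theorem IsC1.hasDerivWithinAt_v {f : ℝ → ℝ → ℝ} (hf : S.IsC1 f) {u v : ℝ} (h : (u, v) ∈ S.dom) :
    HasDerivWithinAt (fun y => f u y) (S.dv f u v) (S.outgoing u) v :=
  (hf.diff_v u v h).hasDerivWithinAt

theorem oneSubMu_eq (hS : S.SolvesEKG l a) {u v : ℝ} (h : (u, v) ∈ S.dom) :
    S.oneSubMu l u v = -4 * S.nu u v * S.lam u v / (S.Om u v) ^ 2 := by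
  have hr := hS.r_pos u v h
  unfold oneSubMu varpi
  field_simp
  ring

/-- The product `ν λ / Ω²` is grouped as `(ν / Ω²) λ`: Raychaudhuri's equation differentiates the
first factor and the wave equation for `r` the second, so no other second derivative is needed. In
the `v` direction the roles of `ν` and `λ` are exchanged. -/
theorem hasDerivWithinAt_varpi_u (hS : S.SolvesEKG l a) {u v : ℝ} (h : (u, v) ∈ S.dom) :
    HasDerivWithinAt (fun x => S.varpi l x v)
      (-8 * Real.pi * S.r u v ^ 2 * S.lam u v * S.du S.phi u v ^ 2 / S.Om u v ^ 2
        + 4 * Real.pi * S.r u v ^ 2 * a / l ^ 2 * S.nu u v * S.phi u v ^ 2) (S.ingoing v) u := by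
  have hr := hS.r_pos u v h
  have hO := hS.Om_pos u v h
  have d1 := hS.r_C1.hasDerivWithinAt_u h
  have d2 := hS.raychaudhuri_u u v h
  have d3 := (hS.wave_r u v h).2
  have := ((d1.div_const 2).mul ((((d2.const_mul 4).mul d3)).const_add 1)).add
    ((d1.pow 3).div_const (2 * l ^ 2))
  refine (this.congr_deriv ?_).congr_of_eventuallyEq ?_ ?_
  · simp only [nu, lam, Pi.mul_apply]
    push_cast
    field_simp
    ring
  · refine Eventually.of_forall fun x => ?_
    simp only [varpi, nu, lam, Pi.add_apply, Pi.mul_apply, Pi.pow_apply]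
    ring
  · simp only [varpi, nu, lam, Pi.add_apply, Pi.mul_apply, Pi.pow_apply]
    ring

theorem hasDerivWithinAt_varpi_v (hS : S.SolvesEKG l a) {u v : ℝ} (h : (u, v) ∈ S.dom) :
    HasDerivWithinAt (fun y => S.varpi l u y)
      (-8 * Real.pi * S.r u v ^ 2 * S.nu u v * S.dv S.phi u v ^ 2 / S.Om u v ^ 2
        + 4 * Real.pi * S.r u v ^ 2 * a / l ^ 2 * S.lam u v * S.phi u v ^ 2) (S.outgoing u) v := by
  have hr := hS.r_pos u v h
  have hO := hS.Om_pos u v h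
  have d1 := hS.r_C1.hasDerivWithinAt_v h
  have d2 := hS.raychaudhuri_v u v h
  have d3 := (hS.wave_r u v h).1
  have := ((d1.div_const 2).mul ((((d2.const_mul 4).mul d3)).const_add 1)).add
    ((d1.pow 3).div_const (2 * l ^ 2))
  refine (this.congr_deriv ?_).congr_of_eventuallyEq ?_ ?_
  · simp only [nu, lam, Pi.mul_apply]
    push_cast
    field_simp
    ring
  · refine Eventually.of_forall fun x => ?_
    simp only [varpi, nu, lam, Pi.add_apply, Pi.mul_apply, Pi.pow_apply]
    ring
  · simp only [varpi, nu, lam, Pi.add_apply, Pi.mul_apply, Pi.pow_apply]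
    ring

theorem Om_sq_eq {u v : ℝ} (hν : S.nu u v < 0) :
    S.Om u v ^ 2 = -4 * S.nu u v * S.kappa u v := by
  have := hν.ne
  unfold kappa
  field_simp

/-- `ν_v`, in terms of `κ`, `ϖ` and `φ`. -/
theorem hasDerivWithinAt_nu_v (hS : S.SolvesEKG l a) {u v : ℝ} (h : (u, v) ∈ S.dom)
    (hν : S.nu u v < 0) :
    HasDerivWithinAt (fun y => S.nu u y)
      (S.nu u v * S.kappa u v * (2 * S.varpi l u v / S.r u v ^ 2 + 2 * S.r u v / l ^ 2
        - 8 * Real.pi * S.r u v * a * S.phi u v ^ 2 / l ^ 2)) (S.outgoing u) v := by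
  have hr := hS.r_pos u v h
  have hO := hS.Om_pos u v h
  refine ((hS.wave_r u v h).1).congr_deriv ?_
  have hν' := hν.ne
  simp only [varpi, kappa]
  change _ / _ - S.nu u v * S.lam u v / _ + _ + _ = _
  field_simp
  ring

/-- The transport equation for `ζ / ν` (the red-shift equation). -/
theorem hasDerivWithinAt_zeta_div_nu (hS : S.SolvesEKG l a) {u v : ℝ} (h : (u, v) ∈ S.dom)
    (hν : S.nu u v < 0) :
    HasDerivWithinAt (fun y => S.zeta u y / S.nu u y)
      (-(S.kappa u v * (2 * S.varpi l u v / S.r u v ^ 2 + 2 * S.r u v / l ^ 2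
          - 8 * Real.pi * S.r u v * a * S.phi u v ^ 2 / l ^ 2)) * (S.zeta u v / S.nu u v)
        - S.dv S.phi u v + 2 * S.kappa u v * S.r u v * a / l ^ 2 * S.phi u v)
      (S.outgoing u) v := by
  have hr := hS.r_pos u v h
  have hν' := hν.ne
  have d1 := (hS.r_C1.hasDerivWithinAt_v h).mul (hS.wave_phi u v h).1
  have d2 := d1.div (hasDerivWithinAt_nu_v hS h hν) hν'
  refine d2.congr_deriv ?_
  simp only [Pi.mul_apply, Om_sq_eq hν]
  change (((S.lam u v * S.du S.phi u v + S.r u v * (-(S.nu u v / S.r u v) * S.dv S.phi u v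
    - S.lam u v / S.r u v * S.du S.phi u v - _)) * _ - _)) / _ = _
  unfold zeta
  generalize 2 * S.varpi l u v / S.r u v ^ 2 + 2 * S.r u v / l ^ 2
          - 8 * Real.pi * S.r u v * a * S.phi u v ^ 2 / l ^ 2 = ρ at *
  field_simp
  ring

/-- The equation for `1 / κ = - 4 ν / Ω²`. -/
theorem hasDerivWithinAt_nu_div_Om (hS : S.SolvesEKG l a) {u v : ℝ} (h : (u, v) ∈ S.dom) :
    HasDerivWithinAt (fun x => S.nu x v / S.Om x v ^ 2)
      (-4 * Real.pi * S.r u v * S.du S.phi u v ^ 2 / S.Om u v ^ 2) (S.ingoing v) u :=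
  hS.raychaudhuri_u u v h

/-- After multiplication by `ν`, respectively `λ`, the two mass equations take the common form that
`massTilde_coercive` requires. -/
theorem varpi_u_mul_nu (hS : S.SolvesEKG l a) {u v : ℝ} (h : (u, v) ∈ S.dom) :
    (-8 * Real.pi * S.r u v ^ 2 * S.lam u v * S.du S.phi u v ^ 2 / S.Om u v ^ 2
        + 4 * Real.pi * S.r u v ^ 2 * a / l ^ 2 * S.nu u v * S.phi u v ^ 2) * S.nu u v
      = 2 * Real.pi * S.r u v ^ 2 * S.oneSubMu l u v * S.du S.phi u v ^ 2
      + 4 * Real.pi * S.r u v ^ 2 * a / l ^ 2 * S.nu u v ^ 2 * S.phi u v ^ 2 := by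
  rw [oneSubMu_eq hS h]
  ring

theorem varpi_v_mul_lam (hS : S.SolvesEKG l a) {u v : ℝ} (h : (u, v) ∈ S.dom) :
    (-8 * Real.pi * S.r u v ^ 2 * S.nu u v * S.dv S.phi u v ^ 2 / S.Om u v ^ 2
        + 4 * Real.pi * S.r u v ^ 2 * a / l ^ 2 * S.lam u v * S.phi u v ^ 2) * S.lam u v
      = 2 * Real.pi * S.r u v ^ 2 * S.oneSubMu l u v * S.dv S.phi u v ^ 2
      + 4 * Real.pi * S.r u v ^ 2 * a / l ^ 2 * S.lam u v ^ 2 * S.phi u v ^ 2 := by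
  rw [oneSubMu_eq hS h]
  ring

theorem lam_eq (hS : S.SolvesEKG l a) {u v : ℝ} (h : (u, v) ∈ S.dom) (hν : S.nu u v < 0) :
    S.lam u v = S.kappa u v * S.oneSubMu l u v := by
  have hO := hS.Om_pos u v h
  have := hν.ne
  rw [oneSubMu_eq hS h, kappa]
  field_simp

theorem kappa_pos (hS : S.SolvesEKG l a) {u v : ℝ} (h : (u, v) ∈ S.dom) (hν : S.nu u v < 0) :
    0 < S.kappa u v := by
  have hO := hS.Om_pos u v h
  unfold kappa
  apply div_pos_of_neg_of_neg
  · have : 0 < S.Om u v ^ 2 := by positivity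
    linarith
  · linarith

theorem oneSubMu_pos (hS : S.SolvesEKG l a) {u v : ℝ} (h : (u, v) ∈ S.dom) (hν : S.nu u v < 0)
    (hlam : 0 < S.lam u v) : 0 < S.oneSubMu l u v := by
  have h1 := lam_eq hS h hν
  rw [h1] at hlam
  exact (pos_iff_pos_of_mul_pos hlam).1 (kappa_pos hS h hν)

theorem continuousOn_nu (hS : S.SolvesEKG l a) :
    ContinuousOn (fun p : ℝ × ℝ => S.nu p.1 p.2) S.dom := hS.r_C1.cont_du

theorem continuousOn_lam (hS : S.SolvesEKG l a) :
    ContinuousOn (fun p : ℝ × ℝ => S.lam p.1 p.2) S.dom := hS.r_C1.cont_dv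

theorem continuousOn_kappa (hS : S.SolvesEKG l a)
    (hν : ∀ u v, (u, v) ∈ S.dom → S.nu u v < 0) :
    ContinuousOn (fun p : ℝ × ℝ => S.kappa p.1 p.2) S.dom :=
  ((hS.Om_C1.cont.pow 2).neg).div (hS.r_C1.cont_du.const_smul (4 : ℝ)) fun p hp =>
    mul_ne_zero four_ne_zero (hν p.1 p.2 hp).ne

theorem continuousOn_varpi (hS : S.SolvesEKG l a) :
    ContinuousOn (fun p : ℝ × ℝ => S.varpi l p.1 p.2) S.dom := by
  have hr := hS.r_C1.cont
  have hO := hS.Om_C1.cont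
  have hn := continuousOn_nu hS
  have hl := continuousOn_lam hS
  unfold varpi
  refine ((hr.div_const 2).mul (continuousOn_const.add
    (((hn.const_smul (4 : ℝ)).mul hl).div (hO.pow 2) fun p hp => ?_))).add
    ((hr.pow 3).div_const (2 * l ^ 2))
  exact pow_ne_zero 2 (hS.Om_pos p.1 p.2 hp).ne'

theorem continuousOn_oneSubMu (hS : S.SolvesEKG l a) :
    ContinuousOn (fun p : ℝ × ℝ => S.oneSubMu l p.1 p.2) S.dom := by
  have hr := hS.r_C1.cont
  unfold oneSubMu
  refine (continuousOn_const.sub (((continuousOn_varpi hS).const_smul (2 : ℝ)).div hr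
    fun p hp => (hS.r_pos p.1 p.2 hp).ne')).add ((hr.pow 2).div_const _)

end Config

namespace IsDevelopment

variable {S : Config} {l a M u₀ u₁ v₀ : ℝ} {phiBar : ℝ → ℝ}

/-! ### The causal structure of a development -/

theorem u_bounds (hS : IsDevelopment l a M u₀ u₁ v₀ phiBar S) {u v : ℝ} (h : (u, v) ∈ S.dom) :
    u₀ < u ∧ u ≤ u₁ ∧ v₀ ≤ v :=
  ⟨(hS.dom_subset h).1.1, (hS.dom_subset h).1.2, (hS.dom_subset h).2⟩

theorem bddBelow_ingoing (hS : IsDevelopment l a M u₀ u₁ v₀ phiBar S) (v : ℝ) :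
    BddBelow (S.ingoing v) :=
  ⟨u₀, fun _ hx => (hS.u_bounds hx).1.le⟩

/-- The infimum is not attained, because relative openness of `Q` leaves room to the left of each of
its points. -/
theorem uI_lt (hS : IsDevelopment l a M u₀ u₁ v₀ phiBar S) {u v : ℝ} (h : (u, v) ∈ S.dom) :
    S.uI v < u := by
  obtain ⟨O, hO, hdom⟩ := hS.dom_open
  have hmem : (u, v) ∈ O := (hdom ▸ h : (u, v) ∈ O ∩ _).1
  have hcont : Continuous fun x : ℝ => (x, v) := by fun_prop
  have hev : ∀ᶠ x in 𝓝[<] u, (x, v) ∈ O :=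
    (hcont.tendsto u).mono_left nhdsWithin_le_nhds (hO.mem_nhds hmem)
  obtain ⟨x, hxO, hxu⟩ := (hev.and self_mem_nhdsWithin).exists
  have hxd : (x, v) ∈ S.dom := by
    rw [hdom]
    exact ⟨hxO, (le_of_lt hxu).trans (hS.u_bounds h).2.1, (hS.u_bounds h).2.2⟩
  exact (csInf_le (hS.bddBelow_ingoing v) hxd).trans_lt hxu

theorem Ioc_subset_ingoing (hS : IsDevelopment l a M u₀ u₁ v₀ phiBar S) {u v : ℝ}
    (h : (u, v) ∈ S.dom) : Ioc (S.uI v) u ⊆ S.ingoing v :=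
  fun x hx => hS.past_ingoing u v h x hx

theorem Icc_subset_outgoing (hS : IsDevelopment l a M u₀ u₁ v₀ phiBar S) {u v : ℝ}
    (h : (u, v) ∈ S.dom) : Icc v₀ v ⊆ S.outgoing u :=
  fun x hx => hS.past_outgoing u v h x hx

theorem ingoing_initial (hS : IsDevelopment l a M u₀ u₁ v₀ phiBar S) :
    S.ingoing v₀ = Ioc u₀ u₁ := by
  ext x
  exact ⟨fun hx => ⟨(hS.u_bounds hx).1, (hS.u_bounds hx).2.1⟩, fun hx => hS.data_mem x hx⟩

theorem uI_initial (hS : IsDevelopment l a M u₀ u₁ v₀ phiBar S) (hu : u₀ < u₁) :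
    S.uI v₀ = u₀ := by
  rw [Config.uI, hS.ingoing_initial, csInf_Ioc hu]

theorem tendsto_line (hS : IsDevelopment l a M u₀ u₁ v₀ phiBar S) {u v : ℝ}
    (h : (u, v) ∈ S.dom) :
    Tendsto (fun x : ℝ => (x, v)) (𝓝[>] S.uI v) (𝓝[S.dom] (S.uI v, v)) := by
  refine tendsto_nhdsWithin_iff.2 ⟨?_, ?_⟩
  · have hcont : Continuous fun x : ℝ => (x, v) := by fun_prop
    exact (hcont.tendsto _).mono_left nhdsWithin_le_nhds
  · filter_upwards [Ioc_mem_nhdsGT (hS.uI_lt h)] with x hx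
    exact hS.Ioc_subset_ingoing h hx

/-- The limit `κ → 1/2` forces `ν < 0` near null infinity, and Raychaudhuri's equation makes `ν /
Ω²` nonincreasing in `u`, so the sign persists. -/
theorem nu_neg (hS : IsDevelopment l a M u₀ u₁ v₀ phiBar S) {u v : ℝ} (h : (u, v) ∈ S.dom) :
    S.nu u v < 0 := by
  have hk := (hS.kappa_infty v ⟨u, h⟩).comp (hS.tendsto_line h)
  have hev : ∀ᶠ x in 𝓝[>] S.uI v, 0 < S.kappa x v :=
    hk.eventually_const_lt (by norm_num)
  obtain ⟨x, hxk, hx⟩ := (hev.and (Ioc_mem_nhdsGT (hS.uI_lt h))).exists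
  have hxd := hS.Ioc_subset_ingoing h hx
  have hνx : S.nu x v < 0 := by
    have hO := hS.solves.Om_pos x v hxd
    by_contra hneg
    have : S.kappa x v ≤ 0 :=
      div_nonpos_of_nonpos_of_nonneg (by nlinarith) (by linarith)
    linarith
  have hanti := antitoneOn_of_hasDerivWithinAt (hS.Ioc_subset_ingoing h)
    (fun y hy => Config.hasDerivWithinAt_nu_div_Om hS.solves (hS.Ioc_subset_ingoing h hy))
    (fun y hy => by
      have := hS.solves.r_pos y v (hS.Ioc_subset_ingoing h hy)
      have h2 : 0 ≤ 4 * Real.pi * S.r y v * S.du S.phi y v ^ 2 / S.Om y v ^ 2 := by positivity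
      have h3 : -4 * Real.pi * S.r y v * S.du S.phi y v ^ 2 / S.Om y v ^ 2
        = -(4 * Real.pi * S.r y v * S.du S.phi y v ^ 2 / S.Om y v ^ 2) := by ring
      linarith)
  have h1 := hanti hx ⟨hS.uI_lt h, le_rfl⟩ hx.2
  have hOx := hS.solves.Om_pos x v hxd
  have hOu := hS.solves.Om_pos u v h
  have h2 : S.nu x v / S.Om x v ^ 2 < 0 := div_neg_of_neg_of_pos hνx (by positivity)
  have h3 : S.nu u v / S.Om u v ^ 2 < 0 := h1.trans_lt h2
  by_contra hneg
  have : 0 ≤ S.nu u v / S.Om u v ^ 2 := div_nonneg (not_lt.1 hneg) (by positivity)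
  linarith

theorem r_antitone (hS : IsDevelopment l a M u₀ u₁ v₀ phiBar S) {u v x : ℝ}
    (h : (u, v) ∈ S.dom) (hx : (x, v) ∈ S.dom) (hxu : x ≤ u) : S.r u v ≤ S.r x v :=
  antitoneOn_of_hasDerivWithinAt (hS.Ioc_subset_ingoing h)
    (fun _ hy => hS.solves.r_C1.hasDerivWithinAt_u (hS.Ioc_subset_ingoing h hy))
    (fun _ hy => (hS.nu_neg (hS.Ioc_subset_ingoing h hy)).le)
    ⟨hS.uI_lt hx, hxu⟩ ⟨hS.uI_lt h, le_rfl⟩ hxu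

theorem lam_div_antitone (hS : IsDevelopment l a M u₀ u₁ v₀ phiBar S) {u v y : ℝ}
    (h : (u, v) ∈ S.dom) (hy : y ∈ Icc v₀ v) :
    S.lam u v / S.Om u v ^ 2 ≤ S.lam u y / S.Om u y ^ 2 := by
  have hmono := monotoneOn_Icc_of_hasDerivWithinAt (hS.Icc_subset_outgoing h)
    (F := fun y => -(S.dv S.r u y / S.Om u y ^ 2))
    (fun z hz => (hS.solves.raychaudhuri_v u z (hS.Icc_subset_outgoing h hz)).neg)
    (fun z hz => by
      have := hS.solves.r_pos u z (hS.Icc_subset_outgoing h hz)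
      have h2 : 0 ≤ 4 * Real.pi * S.r u z * S.dv S.phi u z ^ 2 / S.Om u z ^ 2 := by positivity
      have h3 : -(-4 * Real.pi * S.r u z * S.dv S.phi u z ^ 2 / S.Om u z ^ 2)
        = 4 * Real.pi * S.r u z * S.dv S.phi u z ^ 2 / S.Om u z ^ 2 := by ring
      linarith)
  have := hmono hy ⟨hy.1.trans hy.2, le_rfl⟩ hy.2
  simp only [neg_le_neg_iff] at this
  exact this

theorem lam_nonpos_of_le (hS : IsDevelopment l a M u₀ u₁ v₀ phiBar S) {u v y : ℝ}
    (h : (u, v) ∈ S.dom) (hy : y ∈ Icc v₀ v) (hl : S.lam u y ≤ 0) : S.lam u v ≤ 0 := by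
  have hO := hS.solves.Om_pos u v h
  have h1 := hS.lam_div_antitone h hy
  have h2 : S.lam u y / S.Om u y ^ 2 ≤ 0 := div_nonpos_of_nonpos_of_nonneg hl (by positivity)
  by_contra hneg
  have : 0 < S.lam u v / S.Om u v ^ 2 := div_pos (not_le.1 hneg) (by positivity)
  linarith

/-- If `λ` is not positive somewhere on `N(u)`, then `r` is bounded on `N(u)`. -/
theorem r_bounded_of_lam_nonpos (hS : IsDevelopment l a M u₀ u₁ v₀ phiBar S) {u v : ℝ}
    (h : (u, v) ∈ S.dom) (hl : S.lam u v ≤ 0) :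
    ∃ K : ℝ, ∀ y ∈ S.outgoing u, S.r u y < K := by
  have hcont : ContinuousOn (fun y => S.r u y) (Icc v₀ v) := fun y hy =>
    ((hS.solves.r_C1.hasDerivWithinAt_v
      (hS.Icc_subset_outgoing h hy)).continuousWithinAt).mono (hS.Icc_subset_outgoing h)
  obtain ⟨K, hK⟩ := (isCompact_Icc.image_of_continuousOn hcont).bddAbove
  refine ⟨K + 1, fun y hy => ?_⟩
  have hv0 : v ∈ Icc v₀ v := ⟨(hS.u_bounds h).2.2, le_rfl⟩
  rcases le_total y v with hyv | hyv
  · have := hK ⟨y, ⟨(hS.u_bounds hy).2.2, hyv⟩, rfl⟩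
    simp only at this
    linarith
  · have hsub : Icc v y ⊆ S.outgoing u := (Icc_subset_Icc_left hv0.1).trans
      (hS.Icc_subset_outgoing hy)
    have hmono := monotoneOn_Icc_of_hasDerivWithinAt hsub (F := fun y => -S.r u y)
      (fun z hz => (hS.solves.r_C1.hasDerivWithinAt_v (hsub hz)).neg)
      (fun z hz => by
        have : S.lam u z ≤ 0 := hS.lam_nonpos_of_le (hsub hz) ⟨hv0.1, hz.1⟩ hl
        exact neg_nonneg.2 this)
    have h1 := hmono ⟨le_rfl, hyv⟩ ⟨hyv, le_rfl⟩ hyv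
    have h2 := hK ⟨v, hv0, rfl⟩
    simp only at h1 h2
    linarith

theorem subset_nonempty_ingoing (hS : IsDevelopment l a M u₀ u₁ v₀ phiBar S) {w v₁ : ℝ}
    (h : (w, v₁) ∈ S.dom) : Icc v₀ v₁ ⊆ {v | (S.ingoing v).Nonempty} :=
  fun _ hy => ⟨w, hS.Icc_subset_outgoing h hy⟩

/-- Since `uI` is strictly increasing, the outgoing line that ends at a point of null infinity lies
in `Q` before that point. The boundary limits can therefore be read along it as well. -/
theorem tendsto_outgoing_line (hS : IsDevelopment l a M u₀ u₁ v₀ phiBar S) {w v₁ y : ℝ}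
    (h : (w, v₁) ∈ S.dom) (hy0 : v₀ < y) (hyv : y ≤ v₁) (hw : S.uI y ≤ w) :
    Tendsto (fun z : ℝ => (S.uI y, z)) (𝓝[<] y) (𝓝[S.dom] (S.uI y, y)) := by
  have hsub := hS.subset_nonempty_ingoing h
  refine tendsto_nhdsWithin_iff.2 ⟨?_, ?_⟩
  · have hcont : Continuous fun z : ℝ => (S.uI y, z) := by fun_prop
    exact (hcont.tendsto _).mono_left nhdsWithin_le_nhds
  · filter_upwards [Ico_mem_nhdsLT hy0] with z hz
    have hz1 : z ∈ Icc v₀ v₁ := ⟨hz.1, hz.2.le.trans hyv⟩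
    refine hS.past_ingoing w z (hS.Icc_subset_outgoing h hz1) _ ⟨?_, hw⟩
    exact hS.uI_strictMono (hsub hz1) (hsub ⟨hy0.le, hyv⟩) hz.2

/-- Lines `N(u)` that do not reach as far as `v = v₁` end at null infinity. -/
theorem exists_uI_eq (hS : IsDevelopment l a M u₀ u₁ v₀ phiBar S) {w v₁ u : ℝ}
    (h : (w, v₁) ∈ S.dom) (hu : u₀ < u) (huv : u ≤ S.uI v₁) :
    ∃ y, v₀ < y ∧ y ≤ v₁ ∧ S.uI y = u := by
  have hb := hS.u_bounds h
  have hu01 : u₀ < u₁ := hb.1.trans_le hb.2.1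
  obtain ⟨y, hy, hyu⟩ := intermediate_value_Icc hb.2.2
    (hS.uI_cont.mono (hS.subset_nonempty_ingoing h))
    (show u ∈ Icc (S.uI v₀) (S.uI v₁) from ⟨(hS.uI_initial hu01).le.trans hu.le, huv⟩)
  refine ⟨y, ?_, hy.2, hyu⟩
  rcases eq_or_lt_of_le hy.1 with h0 | h0
  · rw [← h0, hS.uI_initial hu01] at hyu
    exact absurd hyu hu.ne
  · exact h0

/-- Near null infinity `λ > 0`. -/
theorem eventually_lam_pos (hS : IsDevelopment l a M u₀ u₁ v₀ phiBar S) (hl : 0 < l) {v : ℝ}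
    (h : (S.ingoing v).Nonempty) :
    ∀ᶠ p : ℝ × ℝ in 𝓝[S.dom] (S.uI v, v), 0 < S.lam p.1 p.2 := by
  filter_upwards [(hS.varpi_infty v h).eventually_lt_const (lt_add_one M),
    (hS.r_infty v h).eventually_ge_atTop (2 * |M| + 2), self_mem_nhdsWithin] with p h1 h2 h3
  have hν := hS.nu_neg h3
  rw [Config.lam_eq hS.solves h3 hν]
  refine mul_pos (Config.kappa_pos hS.solves h3 hν) ?_
  have hr : 0 < S.r p.1 p.2 := hS.solves.r_pos _ _ h3
  unfold Config.oneSubMu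
  have h4 : 2 * S.varpi l p.1 p.2 / S.r p.1 p.2 < 1 := by
    rw [div_lt_one hr]
    linarith [le_abs_self M]
  have : 0 ≤ S.r p.1 p.2 ^ 2 / l ^ 2 := by positivity
  linarith

/-- The set whose supremum is `uH` has to be nonempty for `uH` to mean anything. Near `(u₀, v₀)` one
has `λ > 0`, and since `uI` increases continuously from `u₀`, lines with `u` close to `u₀` end at
null infinity before leaving that neighbourhood. -/
theorem exists_reachesInfinity (hS : IsDevelopment l a M u₀ u₁ v₀ phiBar S) (hl : 0 < l)
    (hu : u₀ < u₁) : ∃ u, u₀ < u ∧ S.ReachesInfinity u := by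
  have hI := hS.uI_initial hu
  have hd := hS.data_mem u₁ ⟨hu, le_rfl⟩
  have hpos := hS.eventually_lam_pos hl (v := v₀) ⟨u₁, hd⟩
  rw [hI, eventually_nhdsWithin_iff, Metric.eventually_nhds_iff] at hpos
  obtain ⟨d, hd0, hball⟩ := hpos
  obtain ⟨v₁, hv₁, hv01, hv₁d⟩ : ∃ v₁, (u₁, v₁) ∈ S.dom ∧ v₀ < v₁ ∧ v₁ < v₀ + d := by
    obtain ⟨O, hO, hdom⟩ := hS.dom_open
    have hmem : (u₁, v₀) ∈ O := (hdom ▸ hd : (u₁, v₀) ∈ O ∩ _).1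
    have hcont : Continuous fun y : ℝ => (u₁, y) := by fun_prop
    have hev : ∀ᶠ y in 𝓝[>] v₀, (u₁, y) ∈ O :=
      (hcont.tendsto v₀).mono_left nhdsWithin_le_nhds (hO.mem_nhds hmem)
    obtain ⟨y, hyO, hy⟩ := (hev.and (Ioo_mem_nhdsGT (lt_add_of_pos_right v₀ hd0))).exists
    exact ⟨y, by rw [hdom]; exact ⟨hyO, mem_Iic.2 le_rfl, hy.1.le⟩, hy.1, hy.2⟩
  have hsub := hS.subset_nonempty_ingoing hv₁
  have hIv : u₀ < S.uI v₁ := by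
    rw [← hI]
    exact hS.uI_strictMono (hsub ⟨le_rfl, hv01.le⟩) (hsub ⟨hv01.le, le_rfl⟩) hv01
  obtain ⟨u, hu0, huI⟩ := exists_between (lt_min hIv (lt_add_of_pos_right u₀ hd0))
  have huI1 := huI.trans_le (min_le_left _ _)
  have huI2 := huI.trans_le (min_le_right _ _)
  obtain ⟨y, hy0, hyv, rfl⟩ := hS.exists_uI_eq hv₁ hu0 huI1.le
  -- The line cannot continue to `v = y`, where it would contain a point at which the infimum `uI y`
  -- is attained.
  have hlt : ∀ z ∈ S.outgoing (S.uI y), z < y := by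
    intro z hz
    by_contra hneg
    exact lt_irrefl _ (hS.uI_lt (hS.past_outgoing _ _ hz y ⟨hy0.le, not_lt.1 hneg⟩))
  refine ⟨S.uI y, hu0, fun z hz => ⟨hz, ?_, hS.nu_neg hz⟩, fun K => ?_⟩
  · refine hball (y := (S.uI y, z)) ?_ hz
    have hz0 := (hS.u_bounds hz).2.2
    have hzy := hlt z hz
    rw [Prod.dist_eq, max_lt_iff, Real.dist_eq, Real.dist_eq, abs_lt, abs_lt]
    exact ⟨⟨by simp only; linarith, by simp only; linarith⟩,
      ⟨by simp only; linarith, by simp only; linarith⟩⟩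
  · have hline := hS.tendsto_outgoing_line hv₁ hy0 hyv (hS.uI_lt hv₁ |>.le.trans' huI1.le)
    have hlim := ((hS.r_infty y (hsub ⟨hy0.le, hyv⟩)).comp hline).eventually_ge_atTop K
    obtain ⟨z₀, hz₀, hz₀K⟩ := (mem_nhdsLT_iff_exists_Ioo_subset' hy0).1
      (hlim.and (tendsto_nhdsWithin_iff.1 hline).2)
    obtain ⟨z₁, hz₁, hz₁y⟩ := exists_between (mem_Iio.1 hz₀)
    exact ⟨z₁, (hz₀K ⟨hz₁, hz₁y⟩).2, fun z hz hzz => (hz₀K ⟨hz₁.trans_le hzz, hlt z hz⟩).1⟩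

/-- `λ > 0` to the past of the event horizon. -/
theorem lam_pos (hS : IsDevelopment l a M u₀ u₁ v₀ phiBar S) (hl : 0 < l) {u v : ℝ}
    (h : (u, v) ∈ S.dom) (hu : u < S.uH u₀) : 0 < S.lam u v := by
  by_contra hneg
  obtain ⟨K, hK⟩ := hS.r_bounded_of_lam_nonpos h (not_lt.1 hneg)
  have hu0 := (hS.u_bounds h).1
  have hu01 : u₀ < u₁ := hu0.trans_le (hS.u_bounds h).2.1
  -- By Raychaudhuri `r` is bounded by `K` on `N(u)`. This is contradicted by a line `N(w)` with `w
  -- > u` on which `r` exceeds `K` at some `v₁`.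
  obtain ⟨w, ⟨-, -, hw⟩, huw⟩ := exists_lt_of_lt_csSup (hS.exists_reachesInfinity hl hu01) hu
  obtain ⟨v₁, hv₁, hbig⟩ := hw K
  have hv₁K := hbig v₁ hv₁ le_rfl
  -- If `N(u)` reaches `v₁`, then `r(u, v₁) ≥ r(w, v₁)` because `ν < 0`. Otherwise `N(u)` ends at
  -- null infinity, where `r → ∞`.
  by_cases hmem : (u, v₁) ∈ S.dom
  · exact absurd (hK v₁ hmem) (not_lt.2 (hv₁K.trans (hS.r_antitone hv₁ hmem huw.le)))
  have hge : u ≤ S.uI v₁ := by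
    by_contra hlt
    exact hmem (hS.past_ingoing w v₁ hv₁ u ⟨not_le.1 hlt, huw.le⟩)
  obtain ⟨y, hy0, hyv, rfl⟩ := hS.exists_uI_eq hv₁ hu0 hge
  have hline := hS.tendsto_outgoing_line hv₁ hy0 hyv huw.le
  have hlim := (hS.r_infty y (hS.subset_nonempty_ingoing hv₁ ⟨hy0.le, hyv⟩)).comp hline
  obtain ⟨z, hz1, hz2⟩ := ((hlim.eventually_ge_atTop K).and
    (tendsto_nhdsWithin_iff.1 hline).2).exists
  exact absurd (hK z hz2) (not_lt.2 hz1)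

end IsDevelopment

/-! ### The constants -/

/-- Admissible constants for the bootstrap argument: `r₀` bounds `r` from below in the exterior,
`δ` is the bootstrap size and `η` the coercivity constant of the modified mass. -/
structure Admissible (M l a c r₀ δ e η : ℝ) : Prop where
  l_pos : 0 < l
  c_pos : 0 < c
  c_root : c ^ 3 + l ^ 2 * c = 2 * M * l ^ 2
  r₀_pos : 0 < r₀
  r₀_le : r₀ + r₀ ^ 3 / l ^ 2 ≤ M
  e_pos : 0 < e
  e_le : e ≤ 1 / 6
  e_bound : e * (20 * |a| + 40) ≤ 8 * a + 9
  δ_pos : 0 < δ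
  δ_mass : δ ≤ M / 2
  δ_half : δ ≤ 1 / 2
  δ_l : 12 * l ^ 2 * δ ≤ e * r₀ ^ 3
  δ_pi : 6 * Real.pi * δ ≤ e * r₀ ^ 3
  δ_a : 32 * Real.pi * |a| * δ ≤ r₀ ^ 3
  η_pos : 0 < η
  η_le : η ≤ e
  η_l : η * l ^ 2 ≤ e

/-- Order of choice: the horizon radius `c` of the Schwarzschild-AdS background, the lower bound
`r₀` for `r`, then `e` from the gap `8a + 9`, then `δ` small against `e r₀³`, and `η` proportional
to `e`. -/
theorem exists_admissible {M l a : ℝ} (hM : 0 < M) (hl : 0 < l) (ha : -(9 / 8) < a) :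
    ∃ c r₀ δ e η, Admissible M l a c r₀ δ e η := by
  have hpi := Real.pi_pos
  obtain ⟨c, hc, hroot⟩ : ∃ c, 0 < c ∧ c ^ 3 + l ^ 2 * c = 2 * M * l ^ 2 := by
    have hcont : ContinuousOn (fun c : ℝ => c ^ 3 + l ^ 2 * c) (Icc 0 (2 * M)) := by fun_prop
    obtain ⟨c, hc, hcr⟩ := intermediate_value_Icc (by linarith) hcont
      (show 2 * M * l ^ 2 ∈ Icc _ _ from ⟨by
        have : 0 ≤ 2 * M * l ^ 2 := by positivity
        simpa using this, by
        have : 0 < (2 * M) ^ 3 := by positivity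
        have : 0 < l ^ 2 * (2 * M) := by positivity
        linarith⟩)
    refine ⟨c, ?_, hcr⟩
    rcases eq_or_lt_of_le hc.1 with h0 | h0
    · rw [← h0] at hcr
      have : 0 < 2 * M * l ^ 2 := by positivity
      simp at hcr
      rcases hcr with h | h <;> linarith
    · exact h0
  have hr₀ : 0 < min (M / 2) l := lt_min (by linarith) hl
  have hr₀1 : min (M / 2) l ≤ M / 2 := min_le_left _ _
  have hr₀2 : min (M / 2) l ≤ l := min_le_right _ _
  generalize min (M / 2) l = r₀ at *
  have hr₀M : r₀ + r₀ ^ 3 / l ^ 2 ≤ M := by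
    have : r₀ ^ 3 / l ^ 2 ≤ r₀ := by
      rw [div_le_iff₀ (by positivity)]
      have : r₀ ^ 2 ≤ l ^ 2 := by gcongr
      nlinarith
    linarith
  have hd : 0 < 8 * a + 9 := by linarith
  have hk : 0 < 20 * |a| + 40 := by positivity
  have he : 0 < min (1 / 6) ((8 * a + 9) / (20 * |a| + 40)) := lt_min (by norm_num) (by positivity)
  have he1 := min_le_left (1 / 6) ((8 * a + 9) / (20 * |a| + 40))
  have he2 := min_le_right (1 / 6) ((8 * a + 9) / (20 * |a| + 40))
  generalize min (1 / 6) ((8 * a + 9) / (20 * |a| + 40)) = e at *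
  rw [le_div_iff₀ hk] at he2
  -- The sum of the three coefficients, so that `K δ ≤ e r₀³` gives all three smallness conditions.
  set K : ℝ := 12 * l ^ 2 + 6 * Real.pi + 32 * Real.pi * |a| with hK
  have hKpos : 0 < K := by positivity
  have her : 0 < e * r₀ ^ 3 := by positivity
  have hδ : 0 < min (min (M / 2) (1 / 2)) (e * r₀ ^ 3 / K) :=
    lt_min (lt_min (by linarith) (by norm_num)) (by positivity)
  have hδ1 : min (min (M / 2) (1 / 2)) (e * r₀ ^ 3 / K) ≤ M / 2 :=
    (min_le_left _ _).trans (min_le_left _ _)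
  have hδ2 : min (min (M / 2) (1 / 2)) (e * r₀ ^ 3 / K) ≤ 1 / 2 :=
    (min_le_left _ _).trans (min_le_right _ _)
  have hδ3 := min_le_right (min (M / 2) (1 / 2)) (e * r₀ ^ 3 / K)
  generalize min (min (M / 2) (1 / 2)) (e * r₀ ^ 3 / K) = δ at *
  rw [le_div_iff₀ hKpos] at hδ3
  have t1 : 0 ≤ 12 * l ^ 2 * δ := by positivity
  have t2 : 0 ≤ 6 * Real.pi * δ := by positivity
  have t3 : 0 ≤ 32 * Real.pi * |a| * δ := by positivity
  have t4 : K * δ = 12 * l ^ 2 * δ + 6 * Real.pi * δ + 32 * Real.pi * |a| * δ := by rw [hK]; ring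
  have t5 : e * r₀ ^ 3 ≤ r₀ ^ 3 := by
    have : 0 < r₀ ^ 3 := by positivity
    nlinarith
  refine ⟨c, r₀, δ, e, e / (1 + l ^ 2), ⟨hl, hc, hroot, hr₀, hr₀M, he, he1, he2, hδ, hδ1, hδ2,
    by linarith, by linarith, by linarith, by positivity, ?_, ?_⟩⟩
  · exact div_le_self he.le (by linarith [sq_nonneg l])
  · rw [div_mul_eq_mul_div, div_le_iff₀ (by positivity)]
    linarith

theorem Admissible.M_pos {M l a c r₀ δ e η : ℝ} (hA : Admissible M l a c r₀ δ e η) : 0 < M := by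
  linarith [hA.δ_pos, hA.δ_mass]

/-! ### Bootstrap assumptions and the data norm -/

/-- The bootstrap assumptions on the past of `(U, V)`. -/
structure PastBounds (S : Config) (l M δ U V : ℝ) : Prop where
  lam_pos : ∀ u v, (u, v) ∈ S.dom → u ≤ U → 0 < S.lam u v
  mass : ∀ u v, (u, v) ∈ S.dom → u ≤ U → v ≤ V → |S.varpi l u v - M| ≤ δ
  kappa : ∀ u v, (u, v) ∈ S.dom → u ≤ U → v ≤ V → |2 * S.kappa u v - 1| ≤ δ
  field : ∀ u v, (u, v) ∈ S.dom → u ≤ U → v ≤ V → S.r u v ^ 3 * S.phi u v ^ 2 ≤ δ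

/-- `D` bounds the norm of the data on the part of `N(v₀)` to the past of `u`. -/
structure DataBound (S : Config) (u₀ v₀ D u : ℝ) : Prop where
  integral : ∫⁻ x in Ioo u₀ u, ENNReal.ofReal
      ((S.r x v₀) ^ 2 * ((S.r x v₀) ^ 2 / (-S.nu x v₀) * (S.du S.phi x v₀) ^ 2
        - S.nu x v₀ * (S.phi x v₀) ^ 2)) ≤ ENNReal.ofReal (D ^ 2)
  zeta : ∀ x ∈ Ioc u₀ u, S.r x v₀ ^ 3 * (S.zeta x v₀ / S.nu x v₀) ^ 2 ≤ D ^ 2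

theorem DataBound.mono {S : Config} {u₀ v₀ D u u' : ℝ} (h : DataBound S u₀ v₀ D u)
    (hu : u' ≤ u) : DataBound S u₀ v₀ D u' :=
  ⟨(lintegral_mono_set (Ioo_subset_Ioo_right hu)).trans h.integral,
    fun x hx => h.zeta x ⟨hx.1, hx.2.trans hu⟩⟩

namespace Config

variable (S : Config)

/-- The modified mass as a function on `Q`. -/
noncomputable def mt (l c u v : ℝ) : ℝ := massTilde l c (S.r u v) (S.varpi l u v) (S.phi u v)

/-- `∂_u` of the modified mass. -/
noncomputable def mtU (l a c u v : ℝ) : ℝ :=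
  massTildeDeriv l c (S.r u v) (S.varpi l u v) (S.phi u v) (S.nu u v)
    (-8 * Real.pi * S.r u v ^ 2 * S.lam u v * S.du S.phi u v ^ 2 / S.Om u v ^ 2
        + 4 * Real.pi * S.r u v ^ 2 * a / l ^ 2 * S.nu u v * S.phi u v ^ 2) (S.du S.phi u v)

/-- `∂_v` of the modified mass. -/
noncomputable def mtV (l a c u v : ℝ) : ℝ :=
  massTildeDeriv l c (S.r u v) (S.varpi l u v) (S.phi u v) (S.lam u v)
    (-8 * Real.pi * S.r u v ^ 2 * S.nu u v * S.dv S.phi u v ^ 2 / S.Om u v ^ 2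
        + 4 * Real.pi * S.r u v ^ 2 * a / l ^ 2 * S.lam u v * S.phi u v ^ 2) (S.dv S.phi u v)

variable {S} {l a c : ℝ}

theorem hasDerivWithinAt_mt_u (hS : S.SolvesEKG l a) (hc : 0 < c) {u v : ℝ}
    (h : (u, v) ∈ S.dom) :
    HasDerivWithinAt (fun x => S.mt l c x v) (S.mtU l a c u v) (S.ingoing v) u :=
  hasDerivWithinAt_massTilde hc (hS.r_pos u v h) (hS.r_C1.hasDerivWithinAt_u h)
    (hasDerivWithinAt_varpi_u hS h) (hS.phi_C1.hasDerivWithinAt_u h)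

theorem hasDerivWithinAt_mt_v (hS : S.SolvesEKG l a) (hc : 0 < c) {u v : ℝ}
    (h : (u, v) ∈ S.dom) :
    HasDerivWithinAt (fun y => S.mt l c u y) (S.mtV l a c u v) (S.outgoing u) v :=
  hasDerivWithinAt_massTilde (r := fun y => S.r u y) (w := fun y => S.varpi l u y)
    (p := fun y => S.phi u y) hc (hS.r_pos u v h) (hS.r_C1.hasDerivWithinAt_v h)
    (hasDerivWithinAt_varpi_v hS h) (hS.phi_C1.hasDerivWithinAt_v h)

end Config

/-! ### Monotonicity of the modified mass and the energy estimate. -/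

namespace IsDevelopment

variable {S : Config} {l a M u₀ u₁ v₀ c r₀ δ e η U V : ℝ} {phiBar : ℝ → ℝ}

theorem varpi_pos (hA : Admissible M l a c r₀ δ e η)
    (hP : PastBounds S l M δ U V) {u v : ℝ} (h : (u, v) ∈ S.dom) (hu : u ≤ U) (hv : v ≤ V) :
    M / 2 ≤ S.varpi l u v := by
  have := abs_le.1 (hP.mass u v h hu hv)
  linarith [hA.δ_mass]

/-- From `1 - μ > 0` and `ϖ ≥ M/2` one gets `r + r³/l² > 2ϖ ≥ M ≥ r₀ + r₀³/l²`, and the left side is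
increasing in `r`. -/
theorem r_lower (hS : IsDevelopment l a M u₀ u₁ v₀ phiBar S) (hA : Admissible M l a c r₀ δ e η)
    (hP : PastBounds S l M δ U V) {u v : ℝ} (h : (u, v) ∈ S.dom) (hu : u ≤ U) (hv : v ≤ V) :
    r₀ ≤ S.r u v := by
  have hl := hA.l_pos
  have hr := hS.solves.r_pos u v h
  have hm := Config.oneSubMu_pos hS.solves h (hS.nu_neg h) (hP.lam_pos u v h hu)
  have hw := varpi_pos hA hP h hu hv
  by_contra hlt
  push Not at hlt
  unfold Config.oneSubMu at hm
  have h1 : S.r u v + S.r u v ^ 3 / l ^ 2 < r₀ + r₀ ^ 3 / l ^ 2 := by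
    have : S.r u v ^ 3 ≤ r₀ ^ 3 := by gcongr
    have : S.r u v ^ 3 / l ^ 2 ≤ r₀ ^ 3 / l ^ 2 := by gcongr
    linarith
  have h2 : (1 - 2 * S.varpi l u v / S.r u v + S.r u v ^ 2 / l ^ 2) * S.r u v
    = S.r u v + S.r u v ^ 3 / l ^ 2 - 2 * S.varpi l u v := by field_simp; ring
  have h3 := mul_pos hm hr
  linarith [hA.r₀_le]

theorem oneSubMu_le (hA : Admissible M l a c r₀ δ e η)
    (hS : IsDevelopment l a M u₀ u₁ v₀ phiBar S)
    (hP : PastBounds S l M δ U V) {u v : ℝ} (h : (u, v) ∈ S.dom) (hu : u ≤ U) (hv : v ≤ V) :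
    S.oneSubMu l u v ≤ 1 + S.r u v ^ 2 / l ^ 2 := by
  have hr := hS.solves.r_pos u v h
  have hw := varpi_pos hA hP h hu hv
  have hM := hA.M_pos
  have : 0 ≤ 2 * S.varpi l u v / S.r u v := div_nonneg (by linarith) hr.le
  unfold Config.oneSubMu
  linarith

/-- Coercivity divided by `λ > 0`. The density that results is exactly the outgoing integrand of the
`H¹_AdS` norm. -/
theorem mtV_ge (hS : IsDevelopment l a M u₀ u₁ v₀ phiBar S) (hA : Admissible M l a c r₀ δ e η)
    (hP : PastBounds S l M δ U V) {u v : ℝ} (h : (u, v) ∈ S.dom) (hu : u ≤ U) (hv : v ≤ V) :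
    Real.pi * η * (S.r u v ^ 2 * (S.oneSubMu l u v / S.lam u v * S.dv S.phi u v ^ 2
      + S.lam u v * S.phi u v ^ 2)) ≤ S.mtV l a c u v := by
  have hlam := hP.lam_pos u v h hu
  have hm := Config.oneSubMu_pos hS.solves h (hS.nu_neg h) hlam
  have := massTilde_coercive hA.l_pos hA.c_pos hA.c_root hA.r₀_pos hA.e_pos hA.e_le hA.e_bound
    hA.δ_l hA.δ_pi hA.η_le hA.η_l (hS.r_lower hA hP h hu hv) (m := S.oneSubMu l u v) rfl hm
    (hP.mass u v h hu hv) (hP.field u v h hu hv) (Config.varpi_v_mul_lam hS.solves h)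
  refine le_of_mul_le_mul_right (le_trans (le_of_eq ?_) this) hlam
  field_simp

/-- Division by `ν < 0` reverses the inequality. The density has `1 - μ` where the norm has `r²`, a
loss near the horizon that `integral_ingoing` makes up with the red-shift estimate. -/
theorem mtU_le (hS : IsDevelopment l a M u₀ u₁ v₀ phiBar S) (hA : Admissible M l a c r₀ δ e η)
    (hP : PastBounds S l M δ U V) {u v : ℝ} (h : (u, v) ∈ S.dom) (hu : u ≤ U) (hv : v ≤ V) :
    S.mtU l a c u v ≤ -(Real.pi * η * (S.r u v ^ 2 *
      (S.oneSubMu l u v / (-S.nu u v) * S.du S.phi u v ^ 2 - S.nu u v * S.phi u v ^ 2))) := by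
  have hlam := hP.lam_pos u v h hu
  have hν := hS.nu_neg h
  have hm := Config.oneSubMu_pos hS.solves h hν hlam
  have := massTilde_coercive hA.l_pos hA.c_pos hA.c_root hA.r₀_pos hA.e_pos hA.e_le hA.e_bound
    hA.δ_l hA.δ_pi hA.η_le hA.η_l (hS.r_lower hA hP h hu hv) (m := S.oneSubMu l u v) rfl hm
    (hP.mass u v h hu hv) (hP.field u v h hu hv) (Config.varpi_u_mul_nu hS.solves h)
  have hν' := hν.ne
  refine le_of_mul_le_mul_right ?_ (neg_pos.2 hν)
  have h2 : S.mtU l a c u v * -S.nu u v = -(S.mtU l a c u v * S.nu u v) := by ring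
  rw [h2, neg_mul, neg_le_neg_iff]
  refine le_trans (le_of_eq ?_) this
  field_simp
  ring

theorem mtV_nonneg (hS : IsDevelopment l a M u₀ u₁ v₀ phiBar S)
    (hA : Admissible M l a c r₀ δ e η)
    (hP : PastBounds S l M δ U V) {u v : ℝ} (h : (u, v) ∈ S.dom) (hu : u ≤ U) (hv : v ≤ V) :
    0 ≤ S.mtV l a c u v := by
  have hlam := hP.lam_pos u v h hu
  have hm := Config.oneSubMu_pos hS.solves h (hS.nu_neg h) hlam
  refine le_trans ?_ (hS.mtV_ge hA hP h hu hv)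
  have := hA.η_pos
  have := Real.pi_pos
  positivity

theorem mtU_nonpos (hS : IsDevelopment l a M u₀ u₁ v₀ phiBar S)
    (hA : Admissible M l a c r₀ δ e η)
    (hP : PastBounds S l M δ U V) {u v : ℝ} (h : (u, v) ∈ S.dom) (hu : u ≤ U) (hv : v ≤ V) :
    S.mtU l a c u v ≤ 0 := by
  have hlam := hP.lam_pos u v h hu
  have hν := hS.nu_neg h
  have hm := Config.oneSubMu_pos hS.solves h hν hlam
  refine (hS.mtU_le hA hP h hu hv).trans ?_
  have := hA.η_pos
  have := Real.pi_pos
  have hn : 0 < -S.nu u v := neg_pos.2 hν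
  rw [neg_nonpos, sub_eq_add_neg, ← neg_mul]
  positivity

theorem tendsto_field_sq (hS : IsDevelopment l a M u₀ u₁ v₀ phiBar S) {u v : ℝ}
    (h : (u, v) ∈ S.dom) :
    Tendsto (fun x => S.r x v ^ 3 * S.phi x v ^ 2) (𝓝[>] S.uI v) (𝓝 0) := by
  have h1 := (((hS.phi_infty v ⟨u, h⟩).comp (hS.tendsto_line h)).pow 2)
  rw [zero_pow two_ne_zero] at h1
  refine h1.congr' ?_
  filter_upwards [Ioc_mem_nhdsGT (hS.uI_lt h)] with x hx
  have hr := hS.solves.r_pos x v (hS.Ioc_subset_ingoing h hx)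
  exact rpow_three_halves_mul_sq hr.le _

/-- The Hardy term in the modified mass is nonnegative and controlled by `r³ φ²`. -/
theorem mt_sub_varpi (hS : IsDevelopment l a M u₀ u₁ v₀ phiBar S)
    (hA : Admissible M l a c r₀ δ e η)
    (hP : PastBounds S l M δ U V) {u v : ℝ} (h : (u, v) ∈ S.dom) (hu : u ≤ U) (hv : v ≤ V) :
    0 ≤ S.mt l c u v - S.varpi l u v ∧ S.mt l c u v - S.varpi l u v
      ≤ 3 * Real.pi / l ^ 2 * (1 + l ^ 2 / r₀ ^ 2) * (S.r u v ^ 3 * S.phi u v ^ 2) := by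
  have hl := hA.l_pos
  have hr₀ := hA.r₀_pos
  have hM := hA.M_pos
  have hpi := Real.pi_pos
  have hr := hS.solves.r_pos u v h
  have hrr := hS.r_lower hA hP h hu hv
  have hm := Config.oneSubMu_pos hS.solves h (hS.nu_neg h) (hP.lam_pos u v h hu)
  have hw := varpi_pos hA hP h hu hv
  have hb0 := hardyWeight_nonneg (l := l) hA.c_pos hr
  have hb1 := hardyWeight_le_one (l := l) hA.c_pos hr
  have hh : S.r u v ^ 3 + l ^ 2 * S.r u v - 2 * S.varpi l u v * l ^ 2
      = S.r u v * l ^ 2 * S.oneSubMu l u v := by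
    unfold Config.oneSubMu; field_simp; ring
  have hh0 : 0 ≤ S.r u v ^ 3 + l ^ 2 * S.r u v - 2 * S.varpi l u v * l ^ 2 := by
    rw [hh]; positivity
  have hh1 : S.r u v ^ 3 + l ^ 2 * S.r u v - 2 * S.varpi l u v * l ^ 2
      ≤ (1 + l ^ 2 / r₀ ^ 2) * S.r u v ^ 3 := by
    have h1 : l ^ 2 * S.r u v ≤ l ^ 2 / r₀ ^ 2 * S.r u v ^ 3 := by
      rw [div_mul_eq_mul_div, le_div_iff₀ (by positivity)]
      have : r₀ ^ 2 ≤ S.r u v ^ 2 := by gcongr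
      have := mul_le_mul_of_nonneg_left this (by positivity : 0 ≤ l ^ 2 * S.r u v)
      linarith
    have : 0 ≤ 2 * S.varpi l u v * l ^ 2 := by
      have : 0 ≤ S.varpi l u v := by linarith
      positivity
    linarith
  unfold Config.mt massTilde
  rw [add_sub_cancel_left]
  refine ⟨by positivity, ?_⟩
  rw [mul_assoc (3 * Real.pi / l ^ 2)]
  refine mul_le_mul_of_nonneg_left ?_ (by positivity)
  rw [← mul_assoc]
  refine mul_le_mul_of_nonneg_right ?_ (sq_nonneg _)
  calc _ ≤ 1 * (S.r u v ^ 3 + l ^ 2 * S.r u v - 2 * S.varpi l u v * l ^ 2) :=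
        mul_le_mul_of_nonneg_right hb1 hh0
    _ ≤ _ := by rw [one_mul]; exact hh1

/-- The Dirichlet condition `r^{3/2} φ → 0` removes the Hardy term in the limit, so the modified
mass has the same boundary value as `ϖ`. -/
theorem tendsto_mt (hS : IsDevelopment l a M u₀ u₁ v₀ phiBar S)
    (hA : Admissible M l a c r₀ δ e η)
    (hP : PastBounds S l M δ U V) {u v : ℝ} (h : (u, v) ∈ S.dom) (hu : u ≤ U) (hv : v ≤ V) :
    Tendsto (fun x => S.mt l c x v) (𝓝[>] S.uI v) (𝓝 M) := by
  have h1 := (hS.varpi_infty v ⟨u, h⟩).comp (hS.tendsto_line h)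
  have h2 : Tendsto (fun x => S.mt l c x v - S.varpi l x v) (𝓝[>] S.uI v) (𝓝 0) := by
    have h3 := (hS.tendsto_field_sq h).const_mul (3 * Real.pi / l ^ 2 * (1 + l ^ 2 / r₀ ^ 2))
    rw [mul_zero] at h3
    refine tendsto_of_tendsto_of_tendsto_of_le_of_le' tendsto_const_nhds h3 ?_ ?_
    · filter_upwards [Ioc_mem_nhdsGT (hS.uI_lt h)] with x hx
      exact (hS.mt_sub_varpi hA hP (hS.Ioc_subset_ingoing h hx) (hx.2.trans hu) hv).1
    · filter_upwards [Ioc_mem_nhdsGT (hS.uI_lt h)] with x hx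
      exact (hS.mt_sub_varpi hA hP (hS.Ioc_subset_ingoing h hx) (hx.2.trans hu) hv).2
  have h4 := h2.add h1
  rw [zero_add] at h4
  refine h4.congr fun x => ?_
  simp

theorem mt_le (hS : IsDevelopment l a M u₀ u₁ v₀ phiBar S)
    (hA : Admissible M l a c r₀ δ e η)
    (hP : PastBounds S l M δ U V) {u v : ℝ} (h : (u, v) ∈ S.dom) (hu : u ≤ U) (hv : v ≤ V) :
    S.mt l c u v ≤ M :=
  le_of_hasDerivWithinAt_nonpos (hS.uI_lt h) (hS.Ioc_subset_ingoing h)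
    (fun _ hx => Config.hasDerivWithinAt_mt_u hS.solves hA.c_pos (hS.Ioc_subset_ingoing h hx))
    (fun _ hx => hS.mtU_nonpos hA hP (hS.Ioc_subset_ingoing h hx) (hx.2.trans hu) hv)
    (hS.tendsto_mt hA hP h hu hv)

theorem mt_mono (hS : IsDevelopment l a M u₀ u₁ v₀ phiBar S)
    (hA : Admissible M l a c r₀ δ e η)
    (hP : PastBounds S l M δ U V) {u v : ℝ} (h : (u, v) ∈ S.dom) (hu : u ≤ U) (hv : v ≤ V)
    {y : ℝ} (hy : y ∈ Icc v₀ v) : S.mt l c u v₀ ≤ S.mt l c u y := by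
  have hsub := (Icc_subset_Icc_right hy.2).trans (hS.Icc_subset_outgoing h)
  exact monotoneOn_Icc_of_hasDerivWithinAt hsub
    (fun z hz => Config.hasDerivWithinAt_mt_v hS.solves hA.c_pos (hsub hz))
    (fun z hz => hS.mtV_nonneg hA hP (hsub hz) hu (hz.2.trans (hy.2.trans hv)))
    ⟨le_rfl, hy.1⟩ ⟨hy.1, le_rfl⟩ hy.1

theorem continuousOn_ingoing {f : ℝ × ℝ → ℝ} (hS : IsDevelopment l a M u₀ u₁ v₀ phiBar S)
    (hf : ContinuousOn f S.dom) {u v : ℝ} (h : (u, v) ∈ S.dom) :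
    ContinuousOn (fun x => f (x, v)) (Ioc (S.uI v) u) :=
  hf.comp (by fun_prop) fun _ hx => hS.Ioc_subset_ingoing h hx

theorem continuousOn_energy_u (hS : IsDevelopment l a M u₀ u₁ v₀ phiBar S) :
    ContinuousOn (fun p : ℝ × ℝ => (S.r p.1 p.2) ^ 2 * ((S.r p.1 p.2) ^ 2 / (-S.nu p.1 p.2) *
      (S.du S.phi p.1 p.2) ^ 2 - S.nu p.1 p.2 * (S.phi p.1 p.2) ^ 2)) S.dom := by
  have hr := hS.solves.r_C1.cont
  have hn := Config.continuousOn_nu hS.solves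
  refine (hr.pow 2).mul ((((hr.pow 2).div hn.neg fun p hp => ?_).mul
    (hS.solves.phi_C1.cont_du.pow 2)).sub (hn.mul (hS.solves.phi_C1.cont.pow 2)))
  exact neg_ne_zero.2 (hS.nu_neg hp).ne

/-- The energy constant. -/
noncomputable def energyConst (l a r₀ : ℝ) : ℝ :=
  2 * Real.pi * (1 / r₀ ^ 2 + 1 / l ^ 2) + 4 * Real.pi * |a| / l ^ 2

/-- The mass defect on the initial ray is controlled by the data norm. -/
theorem mass_data (hS : IsDevelopment l a M u₀ u₁ v₀ phiBar S)
    (hA : Admissible M l a c r₀ δ e η) (hP : PastBounds S l M δ U V) {D u : ℝ}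
    (hD : DataBound S u₀ v₀ D u) (h : (u, v₀) ∈ S.dom) (hu : u ≤ U) (hv : v₀ ≤ V) :
    M - S.mt l c u v₀ ≤ energyConst l a r₀ * D ^ 2 := by
  have hl := hA.l_pos
  have hr₀ := hA.r₀_pos
  have hpi := Real.pi_pos
  have hb := hS.u_bounds h
  have hI := hS.uI_initial (hb.1.trans_le hb.2.1)
  have hsub := hS.Ioc_subset_ingoing h
  have hsol := hS.solves
  -- On the initial ray `ϖ` itself suffices, since the modified mass is at least `ϖ` and only an
  -- upper bound for the mass defect is wanted.
  have key : -S.varpi l u v₀ - -M ≤ energyConst l a r₀ * D ^ 2 := by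
    refine sub_le_of_deriv_le_lintegral (a := S.uI v₀) (hS.uI_lt h)
      (by unfold energyConst; positivity) (sq_nonneg D) hsub
      (fun x hx => (Config.hasDerivWithinAt_varpi_u hsol (hsub hx)).neg)
      (hS.continuousOn_ingoing hS.continuousOn_energy_u h) ?_ ?_
      ((hS.varpi_infty v₀ ⟨u, h⟩).comp (hS.tendsto_line h)).neg (by rw [hI]; exact hD.integral)
    · intro x hx
      have hn : 0 < -S.nu x v₀ := neg_pos.2 (hS.nu_neg (hsub hx))
      simp only
      rw [sub_eq_add_neg, ← neg_mul]
      positivity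
    · intro x hx
      have hx' := hsub hx
      have hν := hS.nu_neg hx'
      have hn : 0 < -S.nu x v₀ := neg_pos.2 hν
      have hr := hsol.r_pos x v₀ hx'
      have hrr := hS.r_lower hA hP hx' (hx.2.trans hu) hv
      have hm := oneSubMu_le hA hS hP hx' (hx.2.trans hu) hv
      have hm2 : S.oneSubMu l x v₀ ≤ (1 / r₀ ^ 2 + 1 / l ^ 2) * S.r x v₀ ^ 2 := by
        have : 1 ≤ 1 / r₀ ^ 2 * S.r x v₀ ^ 2 := by
          rw [one_div_mul_eq_div, le_div_iff₀ (by positivity), one_mul]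
          gcongr
        have h2 : S.r x v₀ ^ 2 / l ^ 2 = 1 / l ^ 2 * S.r x v₀ ^ 2 := by ring
        linarith
      have hid : -(-8 * Real.pi * S.r x v₀ ^ 2 * S.lam x v₀ * S.du S.phi x v₀ ^ 2 / S.Om x v₀ ^ 2
          + 4 * Real.pi * S.r x v₀ ^ 2 * a / l ^ 2 * S.nu x v₀ * S.phi x v₀ ^ 2)
          = 2 * Real.pi * S.oneSubMu l x v₀
              * (S.r x v₀ ^ 2 * S.du S.phi x v₀ ^ 2 / (-S.nu x v₀))
            + 4 * Real.pi / l ^ 2 * a * (S.r x v₀ ^ 2 * (-S.nu x v₀) * S.phi x v₀ ^ 2) := by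
        rw [Config.oneSubMu_eq hsol hx']
        have := hν.ne
        field_simp
        ring
      rw [hid]
      have e1 : 2 * Real.pi * S.oneSubMu l x v₀
          * (S.r x v₀ ^ 2 * S.du S.phi x v₀ ^ 2 / (-S.nu x v₀))
          ≤ 2 * Real.pi * ((1 / r₀ ^ 2 + 1 / l ^ 2) * S.r x v₀ ^ 2)
          * (S.r x v₀ ^ 2 * S.du S.phi x v₀ ^ 2 / (-S.nu x v₀)) := by gcongr
      have e2 : 4 * Real.pi / l ^ 2 * a * (S.r x v₀ ^ 2 * (-S.nu x v₀) * S.phi x v₀ ^ 2)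
          ≤ 4 * Real.pi / l ^ 2 * |a| * (S.r x v₀ ^ 2 * (-S.nu x v₀) * S.phi x v₀ ^ 2) := by
        gcongr
        exact le_abs_self a
      have e3 : 0 ≤ 4 * Real.pi * |a| / l ^ 2
          * (S.r x v₀ ^ 2 * (S.r x v₀ ^ 2 / (-S.nu x v₀) * S.du S.phi x v₀ ^ 2)) := by positivity
      have e4 : 0 ≤ 2 * Real.pi * (1 / r₀ ^ 2 + 1 / l ^ 2)
          * (S.r x v₀ ^ 2 * (-S.nu x v₀ * S.phi x v₀ ^ 2)) := by positivity
      refine (add_le_add e1 e2).trans ?_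
      unfold energyConst
      refine le_of_sub_nonneg ((add_nonneg e3 e4).trans (le_of_eq ?_))
      ring
  have := (hS.mt_sub_varpi hA hP h hu hv).1
  linarith

/-- The energy estimate. -/
theorem mt_ge (hS : IsDevelopment l a M u₀ u₁ v₀ phiBar S)
    (hA : Admissible M l a c r₀ δ e η) (hP : PastBounds S l M δ U V) {D : ℝ}
    (hD : DataBound S u₀ v₀ D U) {u v : ℝ} (h : (u, v) ∈ S.dom) (hu : u ≤ U) (hv : v ≤ V) :
    M - energyConst l a r₀ * D ^ 2 ≤ S.mt l c u v := by
  have hv₀ := (hS.u_bounds h).2.2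
  have h0 := hS.Icc_subset_outgoing h ⟨le_rfl, hv₀⟩
  have h1 := hS.mass_data hA hP (hD.mono hu) h0 hu (hv₀.trans hv)
  have h2 := hS.mt_mono hA hP h hu hv ⟨hv₀, le_rfl⟩
  linarith

end IsDevelopment

/-! ### The red-shift estimate for `ζ/ν` and the pointwise estimate for `φ`. -/

/-- The weight of the red-shift estimate, comparable to `r³`. -/
noncomputable def redshiftWeight (l r : ℝ) : ℝ := (r ^ 2 + l ^ 2) ^ 2 / r

theorem hasDerivAt_redshiftWeight {l r : ℝ} (hr : 0 < r) :
    HasDerivAt (redshiftWeight l) ((r ^ 2 + l ^ 2) * (3 * r ^ 2 - l ^ 2) / r ^ 2) r := by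
  have h1 : HasDerivAt (fun r : ℝ => (r ^ 2 + l ^ 2) ^ 2) (2 * (r ^ 2 + l ^ 2) * (2 * r)) r := by
    have := (((hasDerivAt_id r).pow 2).add_const (l ^ 2)).pow 2
    refine this.congr_deriv ?_
    simp
  have h2 := h1.div (hasDerivAt_id r) hr.ne'
  refine h2.congr_deriv ?_
  simp only [id]
  field_simp
  ring

theorem cube_le_redshiftWeight {l r : ℝ} (hr : 0 < r) : r ^ 3 ≤ redshiftWeight l r := by
  unfold redshiftWeight
  rw [le_div_iff₀ hr]
  nlinarith [mul_nonneg (sq_nonneg r) (sq_nonneg l), sq_nonneg (l ^ 2)]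

theorem redshiftWeight_le {l r r₀ : ℝ} (hr₀ : 0 < r₀) (hr : r₀ ≤ r) :
    redshiftWeight l r ≤ (1 + l ^ 2 / r₀ ^ 2) ^ 2 * r ^ 3 := by
  have hr' : 0 < r := hr₀.trans_le hr
  unfold redshiftWeight
  rw [div_le_iff₀ hr']
  have h1 : r ^ 2 + l ^ 2 ≤ (1 + l ^ 2 / r₀ ^ 2) * r ^ 2 := by
    have : l ^ 2 ≤ l ^ 2 / r₀ ^ 2 * r ^ 2 := by
      rw [div_mul_eq_mul_div, le_div_iff₀ (by positivity)]
      gcongr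
    linarith
  calc (r ^ 2 + l ^ 2) ^ 2 ≤ ((1 + l ^ 2 / r₀ ^ 2) * r ^ 2) ^ 2 := by gcongr
    _ = _ := by ring

/-- The red-shift inequality at a point. -/
theorem redshift_pointwise {l a r k m w p q Z : ℝ} (hl : 0 < l) (hr : 0 < r) (hk : 0 < k)
    (hm : 0 < m) (hm1 : m ≤ 1 + r ^ 2 / l ^ 2) (hw : 0 ≤ w)
    (hp : 32 * Real.pi * |a| * p ^ 2 ≤ 1) :
    (r ^ 2 + l ^ 2) * (3 * r ^ 2 - l ^ 2) / r ^ 2 * (k * m) * Z ^ 2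
      + redshiftWeight l r * (2 * Z * (-(k * (2 * w / r ^ 2 + 2 * r / l ^ 2
        - 8 * Real.pi * r * a * p ^ 2 / l ^ 2)) * Z - q + 2 * k * r * a / l ^ 2 * p))
    ≤ k * r / l ^ 2 * (-(redshiftWeight l r * Z ^ 2) / 4 + 32 * a ^ 2 * (redshiftWeight l r * p ^ 2))
      + 8 * l ^ 2 * (redshiftWeight l r / r) * (q ^ 2 / k) := by
  have hW : 0 < redshiftWeight l r := by unfold redshiftWeight; positivity
  -- Balance of the coefficients of `(κ r / l²) W Z²`, where `W` is the weight: damping contributes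
  -- `-4`, growth of `W` at most `3`, the field term `1/2`, and the Young inequalities for `q` and
  -- `p` contribute `1/8` each. What is left is `-1/4`; the mass term `e5` has a good sign and is
  -- dropped.
  have e1 : (r ^ 2 + l ^ 2) * (3 * r ^ 2 - l ^ 2) / r ^ 2 * (k * m) * Z ^ 2
      ≤ 3 * (k * r / l ^ 2 * (redshiftWeight l r * Z ^ 2)) := by
    have h1 : (r ^ 2 + l ^ 2) * (3 * r ^ 2 - l ^ 2) / r ^ 2 ≤ 3 * (r ^ 2 + l ^ 2) := by
      rw [div_le_iff₀ (by positivity)]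
      have : 0 ≤ (r ^ 2 + l ^ 2) * l ^ 2 := by positivity
      linarith
    have h2 : 3 * (r ^ 2 + l ^ 2) * m ≤ 3 * (r / l ^ 2 * redshiftWeight l r) := by
      -- The weight is chosen for this identity, which matches the bound `m ≤ 1 + r²/l²` exactly.
      have h3 : r / l ^ 2 * redshiftWeight l r = (r ^ 2 + l ^ 2) * (1 + r ^ 2 / l ^ 2) := by
        unfold redshiftWeight; field_simp; ring
      rw [h3, mul_assoc]
      gcongr
    calc _ = (r ^ 2 + l ^ 2) * (3 * r ^ 2 - l ^ 2) / r ^ 2 * (m * (k * Z ^ 2)) := by ring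
      _ ≤ 3 * (r ^ 2 + l ^ 2) * (m * (k * Z ^ 2)) := by gcongr
      _ = 3 * (r ^ 2 + l ^ 2) * m * (k * Z ^ 2) := by ring
      _ ≤ 3 * (r / l ^ 2 * redshiftWeight l r) * (k * Z ^ 2) := by gcongr
      _ = _ := by ring
  have hX : 0 ≤ k * r / l ^ 2 * (redshiftWeight l r * Z ^ 2) := by positivity
  have e2 : 16 * Real.pi * a * p ^ 2 * (k * r / l ^ 2 * (redshiftWeight l r * Z ^ 2))
      ≤ 1 / 2 * (k * r / l ^ 2 * (redshiftWeight l r * Z ^ 2)) := by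
    refine mul_le_mul_of_nonneg_right ?_ hX
    have : a * (16 * Real.pi * p ^ 2) ≤ |a| * (16 * Real.pi * p ^ 2) := by
      have := Real.pi_pos
      gcongr
      exact le_abs_self a
    linarith
  have e3 : -(2 * Z * q) ≤ k * r / (8 * l ^ 2) * Z ^ 2 + 8 * l ^ 2 / r * (q ^ 2 / k) := by
    have h1 : 0 ≤ (k * r * Z + 8 * l ^ 2 * q) ^ 2 / (8 * l ^ 2 * k * r) := by positivity
    have h2 : (k * r * Z + 8 * l ^ 2 * q) ^ 2 / (8 * l ^ 2 * k * r)
        = k * r / (8 * l ^ 2) * Z ^ 2 + 8 * l ^ 2 / r * (q ^ 2 / k) + 2 * Z * q := by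
      field_simp; ring
    linarith
  have e4 : 4 * a * Z * p ≤ Z ^ 2 / 8 + 32 * a ^ 2 * p ^ 2 := by
    nlinarith [sq_nonneg (Z - 16 * a * p)]
  have e5 : 0 ≤ redshiftWeight l r * (4 * k * w / r ^ 2) * Z ^ 2 := by positivity
  have e3' := mul_le_mul_of_nonneg_left e3 hW.le
  have e4' := mul_le_mul_of_nonneg_left e4 (by positivity : 0 ≤ k * r / l ^ 2 * redshiftWeight l r)
  have i1 : redshiftWeight l r * (2 * Z * (-(k * (2 * w / r ^ 2 + 2 * r / l ^ 2
        - 8 * Real.pi * r * a * p ^ 2 / l ^ 2)) * Z - q + 2 * k * r * a / l ^ 2 * p))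
      = -(redshiftWeight l r * (4 * k * w / r ^ 2) * Z ^ 2)
        - 4 * (k * r / l ^ 2 * (redshiftWeight l r * Z ^ 2))
        + 16 * Real.pi * a * p ^ 2 * (k * r / l ^ 2 * (redshiftWeight l r * Z ^ 2))
        + redshiftWeight l r * (-(2 * Z * q))
        + k * r / l ^ 2 * redshiftWeight l r * (4 * a * Z * p) := by ring
  have i2 : redshiftWeight l r * (k * r / (8 * l ^ 2) * Z ^ 2 + 8 * l ^ 2 / r * (q ^ 2 / k))
      = 1 / 8 * (k * r / l ^ 2 * (redshiftWeight l r * Z ^ 2))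
        + 8 * l ^ 2 * (redshiftWeight l r / r) * (q ^ 2 / k) := by field_simp
  rw [i1]
  rw [i2] at e3'
  have i3 : k * r / l ^ 2 * (-(redshiftWeight l r * Z ^ 2) / 4
      + 32 * a ^ 2 * (redshiftWeight l r * p ^ 2))
      = -(1 / 4) * (k * r / l ^ 2 * (redshiftWeight l r * Z ^ 2))
        + k * r / l ^ 2 * redshiftWeight l r * (32 * a ^ 2 * p ^ 2) := by ring
  rw [i3]
  have i4 : k * r / l ^ 2 * redshiftWeight l r * (Z ^ 2 / 8 + 32 * a ^ 2 * p ^ 2)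
      = 1 / 8 * (k * r / l ^ 2 * (redshiftWeight l r * Z ^ 2))
        + k * r / l ^ 2 * redshiftWeight l r * (32 * a ^ 2 * p ^ 2) := by ring
  rw [i4] at e4'
  linarith

namespace IsDevelopment

variable {S : Config} {l a M u₀ u₁ v₀ c r₀ δ e η U V : ℝ} {phiBar : ℝ → ℝ}

/-- Comparison constant of the red-shift weight with `r³`. -/
noncomputable def weightConst (l r₀ : ℝ) : ℝ := (1 + l ^ 2 / r₀ ^ 2) ^ 2

/-- The multiple of the modified mass that absorbs `φ_v` in the red-shift estimate. -/
noncomputable def fluxConst (l r₀ η : ℝ) : ℝ := 8 * l ^ 2 * weightConst l r₀ / (Real.pi * η)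

theorem kappa_bounds (hA : Admissible M l a c r₀ δ e η)
    (hP : PastBounds S l M δ U V) {u v : ℝ} (h : (u, v) ∈ S.dom) (hu : u ≤ U) (hv : v ≤ V) :
    1 / 4 ≤ S.kappa u v ∧ S.kappa u v ≤ 1 := by
  have := abs_le.1 (hP.kappa u v h hu hv)
  have := hA.δ_half
  constructor <;> linarith

theorem field_small (hS : IsDevelopment l a M u₀ u₁ v₀ phiBar S)
    (hA : Admissible M l a c r₀ δ e η)
    (hP : PastBounds S l M δ U V) {u v : ℝ} (h : (u, v) ∈ S.dom) (hu : u ≤ U) (hv : v ≤ V) :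
    32 * Real.pi * |a| * S.phi u v ^ 2 ≤ 1 := by
  have hr₀ := hA.r₀_pos
  have hr := hS.r_lower hA hP h hu hv
  have h1 : r₀ ^ 3 * S.phi u v ^ 2 ≤ δ :=
    le_trans (by gcongr) (hP.field u v h hu hv)
  have h2 : 0 ≤ 32 * Real.pi * |a| := by have := Real.pi_pos; positivity
  have h3 := mul_le_mul_of_nonneg_left h1 h2
  have h4 := hA.δ_a
  have h5 : (32 * Real.pi * |a| * S.phi u v ^ 2) * r₀ ^ 3 ≤ 1 * r₀ ^ 3 := by linarith
  exact le_of_mul_le_mul_right h5 (by positivity)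

/-- The red-shift estimate for `ζ / ν` along `N(u)`. -/
theorem redshift (hS : IsDevelopment l a M u₀ u₁ v₀ phiBar S)
    (hA : Admissible M l a c r₀ δ e η) (hP : PastBounds S l M δ U V) {D : ℝ}
    (hD : DataBound S u₀ v₀ D U) {u v P : ℝ} (h : (u, v) ∈ S.dom) (hu : u ≤ U) (hv : v ≤ V)
    (hφ : ∀ y ∈ Icc v₀ v, S.r u y ^ 3 * S.phi u y ^ 2 ≤ P) :
    S.r u v ^ 3 * (S.zeta u v / S.nu u v) ^ 2
      ≤ (weightConst l r₀ + fluxConst l r₀ η * energyConst l a r₀) * D ^ 2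
        + 128 * a ^ 2 * weightConst l r₀ * P := by
  have hl := hA.l_pos
  have hr₀ := hA.r₀_pos
  have hη := hA.η_pos
  have hpi := Real.pi_pos
  have hsol := hS.solves
  have hv₀ := (hS.u_bounds h).2.2
  have hsub := hS.Icc_subset_outgoing h
  have hW0 : 0 ≤ weightConst l r₀ := by unfold weightConst; positivity
  have hK0 : 0 ≤ fluxConst l r₀ η := by unfold fluxConst; positivity
  have hE0 : 0 ≤ energyConst l a r₀ := by unfold energyConst; positivity
  have hP0 : 0 ≤ P := by
    have := hsol.r_pos u v₀ (hsub ⟨le_rfl, hv₀⟩)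
    exact le_trans (by positivity) (hφ v₀ ⟨le_rfl, hv₀⟩)
  set K := fluxConst l r₀ η with hK
  set m₀ := M - energyConst l a r₀ * D ^ 2 with hm₀
  -- Subtracting `K` times the modified mass absorbs the `φ_v` source. Above the threshold the
  -- damping beats the remaining source, so a barrier argument replaces Gronwall and the bound is
  -- uniform in `v`.
  have hmax := le_max_of_deriv_neg_of_lt (K := 128 * a ^ 2 * weightConst l r₀ * P - K * m₀)
    (Q := fun y => redshiftWeight l (S.r u y) * (S.zeta u y / S.nu u y) ^ 2 - K * S.mt l c u y)
    hv₀ hsub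
    (fun y hy => by
      have hd := hsub hy
      exact ((((hasDerivAt_redshiftWeight (l := l) (hsol.r_pos u y hd)).comp_hasDerivWithinAt y
        (hsol.r_C1.hasDerivWithinAt_v hd)).mul
        ((Config.hasDerivWithinAt_zeta_div_nu hsol hd (hS.nu_neg hd)).pow 2)).sub
        ((Config.hasDerivWithinAt_mt_v hsol hA.c_pos hd).const_mul K)))
    (fun y hy hlt => by
      have hd := hsub hy
      have hyV := hy.2.trans hv
      have hν := hS.nu_neg hd
      have hr := hsol.r_pos u y hd
      have hrr := hS.r_lower hA hP hd hu hyV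
      have hk := Config.kappa_pos hsol hd hν
      have hlam := hP.lam_pos u y hd hu
      have hm := Config.oneSubMu_pos hsol hd hν hlam
      have hM := hA.M_pos
      have hw := varpi_pos hA hP hd hu hyV
      have hpt := redshift_pointwise (q := S.dv S.phi u y) (Z := S.zeta u y / S.nu u y) hl hr hk hm
        (oneSubMu_le hA hS hP hd hu hyV) (by linarith : 0 ≤ S.varpi l u y)
        (hS.field_small hA hP hd hu hyV)
      have hmt := hS.mt_ge hA hP hD hd hu hyV
      have hW1 := redshiftWeight_le (l := l) hr₀ hrr
      change _ ≤ weightConst l r₀ * _ at hW1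
      -- the flux absorbs the `φ_v` term
      have hflux : 8 * l ^ 2 * (redshiftWeight l (S.r u y) / S.r u y)
          * (S.dv S.phi u y ^ 2 / S.kappa u y) ≤ K * S.mtV l a c u y := by
        have h1 := hS.mtV_ge hA hP hd hu hyV
        have h2 : redshiftWeight l (S.r u y) / S.r u y ≤ weightConst l r₀ * S.r u y ^ 2 := by
          rw [div_le_iff₀ hr]
          linarith
        have h3 : S.oneSubMu l u y / S.lam u y = 1 / S.kappa u y := by
          rw [Config.lam_eq hsol hd hν]; field_simp
        rw [h3] at h1
        have h4 : 8 * l ^ 2 * (weightConst l r₀ * S.r u y ^ 2)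
            * (S.dv S.phi u y ^ 2 / S.kappa u y)
            ≤ K * (Real.pi * η * (S.r u y ^ 2 * (1 / S.kappa u y * S.dv S.phi u y ^ 2
              + S.lam u y * S.phi u y ^ 2))) := by
          have h5 : K * (Real.pi * η * (S.r u y ^ 2 * (1 / S.kappa u y * S.dv S.phi u y ^ 2
              + S.lam u y * S.phi u y ^ 2)))
              = 8 * l ^ 2 * (weightConst l r₀ * S.r u y ^ 2)
            * (S.dv S.phi u y ^ 2 / S.kappa u y)
              + 8 * l ^ 2 * weightConst l r₀ * (S.r u y ^ 2 * (S.lam u y * S.phi u y ^ 2)) := by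
            rw [hK, fluxConst]; field_simp
          rw [h5]
          exact le_add_of_nonneg_right (by positivity)
        calc _ ≤ 8 * l ^ 2 * (weightConst l r₀ * S.r u y ^ 2)
            * (S.dv S.phi u y ^ 2 / S.kappa u y) := by gcongr
          _ ≤ _ := h4
          _ ≤ _ := by gcongr
      -- Here `128 = 4 · 32`: above this level `W Z² / 4` exceeds the source `32 a² W φ²`.
      have hbig : 128 * a ^ 2 * weightConst l r₀ * P
          < redshiftWeight l (S.r u y) * (S.zeta u y / S.nu u y) ^ 2 := by
        have := mul_le_mul_of_nonneg_left hmt hK0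
        linarith
      have hWp : redshiftWeight l (S.r u y) * S.phi u y ^ 2 ≤ weightConst l r₀ * P := by
        calc _ ≤ weightConst l r₀ * S.r u y ^ 3 * S.phi u y ^ 2 := by gcongr
          _ = weightConst l r₀ * (S.r u y ^ 3 * S.phi u y ^ 2) := by ring
          _ ≤ _ := by gcongr; exact hφ y hy
      have hneg : S.kappa u y * S.r u y / l ^ 2
          * (-(redshiftWeight l (S.r u y) * (S.zeta u y / S.nu u y) ^ 2) / 4
            + 32 * a ^ 2 * (redshiftWeight l (S.r u y) * S.phi u y ^ 2)) < 0 := by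
        refine mul_neg_of_pos_of_neg (by positivity) ?_
        have := mul_le_mul_of_nonneg_left hWp (by positivity : 0 ≤ 32 * a ^ 2)
        linarith
      rw [← Config.lam_eq hsol hd hν] at hpt
      refine lt_of_le_of_lt ?_ (add_neg_of_neg_of_nonpos hneg (sub_nonpos.2 hflux))
      rw [add_sub_assoc']
      refine sub_le_sub_right (le_trans (le_of_eq ?_) hpt) _
      simp only [Config.lam, Function.comp_apply, Pi.pow_apply]
      push_cast
      ring)
  have hmtv := hS.mt_le hA hP h hu hv
  have hd0 := hsub ⟨le_rfl, hv₀⟩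
  have hZ0 : redshiftWeight l (S.r u v₀) * (S.zeta u v₀ / S.nu u v₀) ^ 2
      ≤ weightConst l r₀ * D ^ 2 := by
    have hW1 := redshiftWeight_le (l := l) hr₀ (hS.r_lower hA hP hd0 hu (hv₀.trans hv))
    change _ ≤ weightConst l r₀ * _ at hW1
    calc _ ≤ weightConst l r₀ * S.r u v₀ ^ 3 * (S.zeta u v₀ / S.nu u v₀) ^ 2 := by gcongr
      _ = weightConst l r₀ * (S.r u v₀ ^ 3 * (S.zeta u v₀ / S.nu u v₀) ^ 2) := by ring
      _ ≤ _ := by gcongr; exact hD.zeta u ⟨(hS.u_bounds h).1, hu⟩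
  have hmt0 := hS.mt_ge hA hP hD hd0 hu (hv₀.trans hv)
  have hle : redshiftWeight l (S.r u v) * (S.zeta u v / S.nu u v) ^ 2 - K * S.mt l c u v
      ≤ weightConst l r₀ * D ^ 2 + 128 * a ^ 2 * weightConst l r₀ * P - K * m₀ := by
    refine hmax.trans (max_le ?_ ?_)
    · have := mul_le_mul_of_nonneg_left hmt0 hK0
      have : 0 ≤ 128 * a ^ 2 * weightConst l r₀ * P := by positivity
      linarith
    · have : 0 ≤ weightConst l r₀ * D ^ 2 := by positivity
      linarith
  have hfin : S.r u v ^ 3 * (S.zeta u v / S.nu u v) ^ 2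
      ≤ redshiftWeight l (S.r u v) * (S.zeta u v / S.nu u v) ^ 2 := by
    gcongr
    exact cube_le_redshiftWeight (hsol.r_pos u v h)
  have hKM := mul_le_mul_of_nonneg_left hmtv hK0
  have : K * M - K * m₀ = K * energyConst l a r₀ * D ^ 2 := by rw [hm₀]; ring
  linarith

theorem hasDerivWithinAt_r_inv_pow (hS : IsDevelopment l a M u₀ u₁ v₀ phiBar S) {u v : ℝ}
    (h : (u, v) ∈ S.dom) (n : ℕ) :
    HasDerivWithinAt (fun x => (S.r x v ^ n)⁻¹) (-(n * S.nu u v / S.r u v ^ (n + 1)))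
      (S.ingoing v) u := by
  have hr := hS.solves.r_pos u v h
  have := ((hS.solves.r_C1.hasDerivWithinAt_u h).pow n).inv (pow_ne_zero n hr.ne')
  refine this.congr_deriv ?_
  rcases n with _ | n
  · simp
  · simp only [Pi.pow_apply, Config.nu, Nat.add_sub_cancel]
    field_simp
    ring

theorem tendsto_r_inv_pow (hS : IsDevelopment l a M u₀ u₁ v₀ phiBar S) {u v : ℝ}
    (h : (u, v) ∈ S.dom) {n : ℕ} (hn : n ≠ 0) :
    Tendsto (fun x => (S.r x v ^ n)⁻¹) (𝓝[>] S.uI v) (𝓝 0) :=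
  tendsto_inv_atTop_zero.comp
    ((tendsto_pow_atTop hn).comp ((hS.r_infty v ⟨u, h⟩).comp (hS.tendsto_line h)))

/-- A bound for `ζ / ν` along the ingoing line gives one for `φ`. -/
theorem field_of_zeta (hS : IsDevelopment l a M u₀ u₁ v₀ phiBar S)
    (hA : Admissible M l a c r₀ δ e η) (hP : PastBounds S l M δ U V) {D : ℝ}
    (hD : DataBound S u₀ v₀ D U) {u v Z k : ℝ} (h : (u, v) ∈ S.dom) (hu : u ≤ U) (hv : v ≤ V)
    (hk : 0 < k)
    (hZ : ∀ x ∈ Ioc (S.uI v) u, S.r x v ^ 3 * (S.zeta x v / S.nu x v) ^ 2 ≤ Z) :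
    S.r u v ^ 3 * S.phi u v ^ 2
      ≤ k * energyConst l a r₀ / (Real.pi * η) * D ^ 2 + Z / (6 * k) := by
  have hη := hA.η_pos
  have hr₀ := hA.r₀_pos
  have hpi := Real.pi_pos
  have hsol := hS.solves
  have hr1 := hsol.r_pos u v h
  have hsub := hS.Ioc_subset_ingoing h
  -- The Young parameter is frozen at the radius of the endpoint, so that after multiplication by
  -- `r³` the bound is independent of `r`.
  set θ := k / S.r u v ^ 3 with hθ
  have hθ0 : 0 < θ := by positivity
  -- This combination is nonincreasing in `u`. Young's inequality splits `2 φ φ_u` into `θ r² φ²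
  -- (-ν)`, absorbed by the modified mass, and a term at most `Z (-ν) / (θ r⁷)`, the derivative of
  -- `Z / (6 θ r⁶)`.
  have hlim : Tendsto (fun x => S.phi x v ^ 2 + θ / (Real.pi * η) * S.mt l c x v
      - Z / (6 * θ) * (S.r x v ^ 6)⁻¹) (𝓝[>] S.uI v)
      (𝓝 (0 + θ / (Real.pi * η) * M - Z / (6 * θ) * 0)) := by
    refine (Tendsto.add ?_ ((hS.tendsto_mt hA hP h hu hv).const_mul _)).sub
      ((hS.tendsto_r_inv_pow h (by norm_num)).const_mul _)
    have h1 := (hS.tendsto_field_sq h).mul (hS.tendsto_r_inv_pow h (n := 3) (by norm_num))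
    rw [zero_mul] at h1
    refine h1.congr' ?_
    filter_upwards [Ioc_mem_nhdsGT (hS.uI_lt h)] with x hx
    have := hsol.r_pos x v (hsub hx)
    field_simp
  have hle := le_of_hasDerivWithinAt_nonpos (hS.uI_lt h) hsub
    (fun x hx => (((hsol.phi_C1.hasDerivWithinAt_u (hsub hx)).pow 2).add
      ((Config.hasDerivWithinAt_mt_u hsol hA.c_pos (hsub hx)).const_mul (θ / (Real.pi * η)))).sub
      ((hS.hasDerivWithinAt_r_inv_pow (hsub hx) 6).const_mul (Z / (6 * θ))))
    (fun x hx => by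
      have hd := hsub hx
      have hν := hS.nu_neg hd
      have hr := hsol.r_pos x v hd
      have hxU := hx.2.trans hu
      have hm := Config.oneSubMu_pos hsol hd hν (hP.lam_pos x v hd hxU)
      have hn : 0 < -S.nu x v := neg_pos.2 hν
      have h1 := hS.mtU_le hA hP hd hxU hv
      have h2 := mul_le_mul_of_nonneg_left h1 (by positivity : 0 ≤ θ / (Real.pi * η))
      have h3 : θ / (Real.pi * η) * -(Real.pi * η * (S.r x v ^ 2 *
          (S.oneSubMu l x v / (-S.nu x v) * S.du S.phi x v ^ 2 - S.nu x v * S.phi x v ^ 2)))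
          = -(θ * (S.r x v ^ 2 * (S.oneSubMu l x v / (-S.nu x v) * S.du S.phi x v ^ 2)))
            - θ * S.r x v ^ 2 * (-S.nu x v) * S.phi x v ^ 2 := by field_simp; ring
      have h4 : 0 ≤ θ * (S.r x v ^ 2 * (S.oneSubMu l x v / (-S.nu x v) * S.du S.phi x v ^ 2)) := by
        positivity
      set ζ := S.zeta x v / S.nu x v with hζ
      have h5 : S.du S.phi x v = ζ * S.nu x v / S.r x v := by
        rw [hζ, Config.zeta]; have := hν.ne; field_simp
      have h6 : 2 * S.phi x v * S.du S.phi x v ≤ (-S.nu x v) * (θ * S.r x v ^ 2 * S.phi x v ^ 2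
          + ζ ^ 2 / (θ * S.r x v ^ 4)) := by
        have h7 : 0 ≤ (-S.nu x v) * (θ * S.r x v ^ 3 * S.phi x v + ζ) ^ 2 / (θ * S.r x v ^ 4) := by
          positivity
        have h8 : (-S.nu x v) * (θ * S.r x v ^ 3 * S.phi x v + ζ) ^ 2 / (θ * S.r x v ^ 4)
            = (-S.nu x v) * (θ * S.r x v ^ 2 * S.phi x v ^ 2 + ζ ^ 2 / (θ * S.r x v ^ 4))
              - 2 * S.phi x v * S.du S.phi x v := by
          rw [h5]; field_simp; ring
        linarith
      have h9 : (-S.nu x v) * (ζ ^ 2 / (θ * S.r x v ^ 4))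
          ≤ (-S.nu x v) * (Z / (θ * S.r x v ^ 7)) := by
        refine mul_le_mul_of_nonneg_left ?_ hn.le
        rw [div_le_div_iff₀ (by positivity) (by positivity)]
        have := mul_le_mul_of_nonneg_left (hZ x hx) (by positivity : 0 ≤ θ * S.r x v ^ 4)
        rw [← hζ] at this
        linarith
      have h10 : Z / (6 * θ) * -((6 : ℕ) * S.nu x v / S.r x v ^ (6 + 1))
          = (-S.nu x v) * (Z / (θ * S.r x v ^ 7)) := by push_cast; field_simp
      simp only [h10]
      push_cast
      rw [h3] at h2
      ring_nf at h2 h6 h9 h4 ⊢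
      linarith)
    hlim
  have hmt := hS.mt_ge hA hP hD h hu hv
  simp only [Pi.sub_apply, Pi.add_apply, Pi.pow_apply] at hle
  have hmt' := mul_le_mul_of_nonneg_left hmt (by positivity : 0 ≤ θ / (Real.pi * η))
  have hphi : S.phi u v ^ 2 ≤ θ / (Real.pi * η) * (energyConst l a r₀ * D ^ 2)
      + Z / (6 * θ) * (S.r u v ^ 6)⁻¹ := by linarith
  have := mul_le_mul_of_nonneg_left hphi (by positivity : 0 ≤ S.r u v ^ 3)
  refine this.trans (le_of_eq ?_)
  rw [hθ]
  field_simp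

end IsDevelopment

/-! ### Estimates by the data norm under the bootstrap assumptions. -/

namespace IsDevelopment

variable {S : Config} {l a M u₀ u₁ v₀ c r₀ δ e η U V : ℝ} {phiBar : ℝ → ℝ}

/-- The constant in the estimate for `r³ φ²`. -/
noncomputable def fieldConst (l a r₀ η : ℝ) : ℝ :=
  2 * ((128 * a ^ 2 * weightConst l r₀ + 1) * energyConst l a r₀ / (Real.pi * η)
    + (weightConst l r₀ + fluxConst l r₀ η * energyConst l a r₀))

/-- The constant in the estimate for `r³ (ζ / ν)²`. -/
noncomputable def zetaConst (l a r₀ η : ℝ) : ℝ :=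
  (weightConst l r₀ + fluxConst l r₀ η * energyConst l a r₀)
    + 128 * a ^ 2 * weightConst l r₀ * fieldConst l a r₀ η

theorem const_nonneg (hA : Admissible M l a c r₀ δ e η) :
    0 ≤ weightConst l r₀ ∧ 0 ≤ fluxConst l r₀ η ∧ 0 ≤ energyConst l a r₀ := by
  have hl := hA.l_pos
  have hr₀ := hA.r₀_pos
  have hη := hA.η_pos
  have hpi := Real.pi_pos
  have hW : 0 ≤ weightConst l r₀ := by unfold weightConst; positivity
  refine ⟨hW, ?_, ?_⟩
  · unfold fluxConst; positivity
  · unfold energyConst; positivity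

theorem fieldConst_nonneg (hA : Admissible M l a c r₀ δ e η) : 0 ≤ fieldConst l a r₀ η := by
  obtain ⟨h1, h2, h3⟩ := const_nonneg hA
  have hη := hA.η_pos
  have hpi := Real.pi_pos
  unfold fieldConst; positivity

theorem zetaConst_nonneg (hA : Admissible M l a c r₀ δ e η) : 0 ≤ zetaConst l a r₀ η := by
  obtain ⟨h1, h2, h3⟩ := const_nonneg hA
  have h4 := fieldConst_nonneg hA
  unfold zetaConst; positivity

/-- The red-shift bound is inserted in `field_of_zeta` with `k` larger than `128 a²` times the
weight constant, so the a priori bound `P` returns with factor at most `1/6`. -/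
theorem field_improve (hS : IsDevelopment l a M u₀ u₁ v₀ phiBar S)
    (hA : Admissible M l a c r₀ δ e η) (hP : PastBounds S l M δ U V) {D : ℝ}
    (hD : DataBound S u₀ v₀ D U) {P : ℝ}
    (hφ : ∀ u v, (u, v) ∈ S.dom → u ≤ U → v ≤ V → S.r u v ^ 3 * S.phi u v ^ 2 ≤ P)
    {u v : ℝ} (h : (u, v) ∈ S.dom) (hu : u ≤ U) (hv : v ≤ V) :
    S.r u v ^ 3 * S.phi u v ^ 2 ≤ fieldConst l a r₀ η / 2 * D ^ 2 + P / 6 := by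
  obtain ⟨h1, h2, h3⟩ := const_nonneg hA
  have hk : 0 < 128 * a ^ 2 * weightConst l r₀ + 1 := by positivity
  have hP0 : 0 ≤ P := by
    have := hS.solves.r_pos u v h
    exact le_trans (by positivity) (hφ u v h hu hv)
  have hsub := hS.Ioc_subset_ingoing h
  have := hS.field_of_zeta hA hP hD h hu hv hk fun x hx =>
    hS.redshift hA hP hD (hsub hx) (hx.2.trans hu) hv fun y hy =>
      hφ x y (hS.Icc_subset_outgoing (hsub hx) hy) (hx.2.trans hu) (hy.2.trans hv)
  refine this.trans ?_
  have hk1 : 1 ≤ 128 * a ^ 2 * weightConst l r₀ + 1 := by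
    have : 0 ≤ 128 * a ^ 2 * weightConst l r₀ := by positivity
    linarith
  have hA0 : 0 ≤ (weightConst l r₀ + fluxConst l r₀ η * energyConst l a r₀) * D ^ 2 := by
    positivity
  have e1 : ((weightConst l r₀ + fluxConst l r₀ η * energyConst l a r₀) * D ^ 2
      + 128 * a ^ 2 * weightConst l r₀ * P) / (6 * (128 * a ^ 2 * weightConst l r₀ + 1))
      ≤ (weightConst l r₀ + fluxConst l r₀ η * energyConst l a r₀) * D ^ 2 + P / 6 := by
    rw [div_le_iff₀ (by positivity)]
    have := mul_le_mul_of_nonneg_left hk1 hA0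
    linarith
  unfold fieldConst
  refine (add_le_add_right e1 _).trans (le_of_eq ?_)
  ring

/-- `field_improve` is applied with `P` the supremum over the past region, which the bootstrap
assumption makes finite, and the supremum is absorbed. The bootstrap size `δ` does not enter the
result. -/
theorem field_bound (hS : IsDevelopment l a M u₀ u₁ v₀ phiBar S)
    (hA : Admissible M l a c r₀ δ e η) (hP : PastBounds S l M δ U V) {D : ℝ}
    (hD : DataBound S u₀ v₀ D U) {u v : ℝ} (h : (u, v) ∈ S.dom) (hu : u ≤ U) (hv : v ≤ V) :
    S.r u v ^ 3 * S.phi u v ^ 2 ≤ fieldConst l a r₀ η * D ^ 2 := by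
  set T : Set ℝ := (fun p : ℝ × ℝ => S.r p.1 p.2 ^ 3 * S.phi p.1 p.2 ^ 2) ''
    {p | p ∈ S.dom ∧ p.1 ≤ U ∧ p.2 ≤ V} with hT
  have hbdd : BddAbove T := by
    refine ⟨δ, ?_⟩
    rintro _ ⟨p, hp, rfl⟩
    exact hP.field p.1 p.2 hp.1 hp.2.1 hp.2.2
  have hmem : ∀ u v, (u, v) ∈ S.dom → u ≤ U → v ≤ V → S.r u v ^ 3 * S.phi u v ^ 2 ≤ sSup T :=
    fun u v h hu hv => le_csSup hbdd ⟨(u, v), ⟨h, hu, hv⟩, rfl⟩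
  have hsup : sSup T ≤ fieldConst l a r₀ η / 2 * D ^ 2 + sSup T / 6 := by
    refine csSup_le ⟨_, (u, v), ⟨h, hu, hv⟩, rfl⟩ ?_
    rintro _ ⟨p, hp, rfl⟩
    exact hS.field_improve hA hP hD hmem hp.1 hp.2.1 hp.2.2
  have h1 := hmem u v h hu hv
  have h2 : 0 ≤ fieldConst l a r₀ η * D ^ 2 := mul_nonneg (fieldConst_nonneg hA) (sq_nonneg D)
  linarith

theorem zeta_bound (hS : IsDevelopment l a M u₀ u₁ v₀ phiBar S)
    (hA : Admissible M l a c r₀ δ e η) (hP : PastBounds S l M δ U V) {D : ℝ}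
    (hD : DataBound S u₀ v₀ D U) {u v : ℝ} (h : (u, v) ∈ S.dom) (hu : u ≤ U) (hv : v ≤ V) :
    S.r u v ^ 3 * (S.zeta u v / S.nu u v) ^ 2 ≤ zetaConst l a r₀ η * D ^ 2 := by
  refine (hS.redshift hA hP hD h hu hv fun y hy =>
    hS.field_bound hA hP hD (hS.Icc_subset_outgoing h hy) hu (hy.2.trans hv)).trans (le_of_eq ?_)
  unfold zetaConst
  ring

/-- The constant in the estimate for `ϖ`. -/
noncomputable def massConst (l a r₀ η : ℝ) : ℝ :=
  energyConst l a r₀ + 3 * Real.pi / l ^ 2 * (1 + l ^ 2 / r₀ ^ 2) * fieldConst l a r₀ η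

theorem mass_bound (hS : IsDevelopment l a M u₀ u₁ v₀ phiBar S)
    (hA : Admissible M l a c r₀ δ e η) (hP : PastBounds S l M δ U V) {D : ℝ}
    (hD : DataBound S u₀ v₀ D U) {u v : ℝ} (h : (u, v) ∈ S.dom) (hu : u ≤ U) (hv : v ≤ V) :
    |S.varpi l u v - M| ≤ massConst l a r₀ η * D ^ 2 := by
  have hl := hA.l_pos
  have hr₀ := hA.r₀_pos
  have hpi := Real.pi_pos
  have h1 := hS.mt_sub_varpi hA hP h hu hv
  have h2 := hS.mt_le hA hP h hu hv
  have h3 := hS.mt_ge hA hP hD h hu hv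
  have h4 := mul_le_mul_of_nonneg_left (hS.field_bound hA hP hD h hu hv)
    (by positivity : 0 ≤ 3 * Real.pi / l ^ 2 * (1 + l ^ 2 / r₀ ^ 2))
  have h5 : 0 ≤ 3 * Real.pi / l ^ 2 * (1 + l ^ 2 / r₀ ^ 2) * (fieldConst l a r₀ η * D ^ 2) := by
    have := fieldConst_nonneg hA
    positivity
  have h6 : 0 ≤ energyConst l a r₀ * D ^ 2 := mul_nonneg (const_nonneg hA).2.2 (sq_nonneg D)
  have h7 : massConst l a r₀ η * D ^ 2 = energyConst l a r₀ * D ^ 2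
      + 3 * Real.pi / l ^ 2 * (1 + l ^ 2 / r₀ ^ 2) * (fieldConst l a r₀ η * D ^ 2) := by
    unfold massConst; ring
  rw [abs_le, h7]
  constructor <;> linarith

theorem kappa_inv_eq (hS : IsDevelopment l a M u₀ u₁ v₀ phiBar S) {u v : ℝ}
    (h : (u, v) ∈ S.dom) : (S.kappa u v)⁻¹ = -4 * (S.nu u v / S.Om u v ^ 2) := by
  have hO := hS.solves.Om_pos u v h
  have hν := (hS.nu_neg h).ne
  unfold Config.kappa
  field_simp

/-- `1/κ` is nondecreasing in `u` and starts from `2` at null infinity. Its derivative is `4π (-ν)/r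
· (ζ/ν)²/κ`, at most `16π Z (-ν)/r⁴` by `κ ≥ 1/4` and the bound `Z` for `r³ (ζ/ν)²`, and this
integrates to `16π Z / (3 r³)`. -/
theorem kappa_inv_bounds (hS : IsDevelopment l a M u₀ u₁ v₀ phiBar S)
    (hA : Admissible M l a c r₀ δ e η) (hP : PastBounds S l M δ U V) {D : ℝ}
    (hD : DataBound S u₀ v₀ D U) {u v : ℝ} (h : (u, v) ∈ S.dom) (hu : u ≤ U) (hv : v ≤ V) :
    2 ≤ (S.kappa u v)⁻¹ ∧ (S.kappa u v)⁻¹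
      ≤ 2 + 16 * Real.pi / 3 * (zetaConst l a r₀ η * D ^ 2) * (S.r u v ^ 3)⁻¹ := by
  have hpi := Real.pi_pos
  have hsol := hS.solves
  have hsub := hS.Ioc_subset_ingoing h
  have hlim : Tendsto (fun x => -4 * (S.nu x v / S.Om x v ^ 2)) (𝓝[>] S.uI v) (𝓝 2) := by
    have h1 := ((hS.kappa_infty v ⟨u, h⟩).comp (hS.tendsto_line h)).inv₀ (by norm_num)
    rw [show ((1 : ℝ) / 2)⁻¹ = 2 by norm_num] at h1
    refine h1.congr' ?_
    filter_upwards [Ioc_mem_nhdsGT (hS.uI_lt h)] with x hx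
    exact hS.kappa_inv_eq (hsub hx)
  have hder := fun x (hx : x ∈ Ioc (S.uI v) u) =>
    (Config.hasDerivWithinAt_nu_div_Om hsol (hsub hx)).const_mul (-4)
  rw [hS.kappa_inv_eq h]
  constructor
  · have := le_of_hasDerivWithinAt_nonpos (hS.uI_lt h) hsub (fun x hx => (hder x hx).neg)
      (fun x hx => by
        have hr := hsol.r_pos x v (hsub hx)
        have : 0 ≤ 16 * (Real.pi * S.r x v * S.du S.phi x v ^ 2 / S.Om x v ^ 2) := by positivity
        refine le_of_sub_nonneg (this.trans (le_of_eq ?_))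
        ring) hlim.neg
    simp only [Pi.neg_apply, neg_le_neg_iff] at this
    exact this
  · have := le_of_hasDerivWithinAt_nonpos (hS.uI_lt h) hsub
      (fun x hx => (hder x hx).sub ((hS.hasDerivWithinAt_r_inv_pow (hsub hx) 3).const_mul
        (16 * Real.pi / 3 * (zetaConst l a r₀ η * D ^ 2))))
      (fun x hx => by
        have hd := hsub hx
        have hr := hsol.r_pos x v hd
        have hν := hS.nu_neg hd
        have hn : 0 < -S.nu x v := neg_pos.2 hν
        have hk := (kappa_bounds hA hP hd (hx.2.trans hu) hv).1
        have hk0 : 0 < S.kappa x v := by linarith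
        have hZ := hS.zeta_bound hA hP hD hd (hx.2.trans hu) hv
        set ζ := S.zeta x v / S.nu x v with hζ
        have h5 : S.du S.phi x v = ζ * S.nu x v / S.r x v := by
          rw [hζ, Config.zeta]; have := hν.ne; field_simp
        rw [Config.Om_sq_eq hν, h5]
        generalize zetaConst l a r₀ η * D ^ 2 = Z at *
        have h6 : -4 * (-4 * Real.pi * S.r x v * (ζ * S.nu x v / S.r x v) ^ 2
            / (-4 * S.nu x v * S.kappa x v))
            = 4 * Real.pi * (-S.nu x v) / S.r x v * (ζ ^ 2 * (S.kappa x v)⁻¹) := by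
          have := hν.ne
          field_simp
        have h7 : (S.kappa x v)⁻¹ ≤ 4 := by
          rw [inv_le_comm₀ hk0 (by norm_num)]
          linarith
        have h8 : ζ ^ 2 ≤ Z / S.r x v ^ 3 := by
          rw [le_div_iff₀ (by positivity)]
          linarith
        have h9 : 4 * Real.pi * (-S.nu x v) / S.r x v * (ζ ^ 2 * (S.kappa x v)⁻¹)
            ≤ 4 * Real.pi * (-S.nu x v) / S.r x v * (Z / S.r x v ^ 3 * 4) := by
          gcongr
          exact (sq_nonneg ζ).trans h8
        rw [h6]
        refine (sub_le_sub_right h9 _).trans (le_of_eq ?_)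
        push_cast
        field_simp
        ring)
      (hlim.sub ((hS.tendsto_r_inv_pow h (by norm_num)).const_mul _))
    simp only [Pi.sub_apply, mul_zero, sub_zero] at this
    linarith

theorem kappa_bound (hS : IsDevelopment l a M u₀ u₁ v₀ phiBar S)
    (hA : Admissible M l a c r₀ δ e η) (hP : PastBounds S l M δ U V) {D : ℝ}
    (hD : DataBound S u₀ v₀ D U) {u v : ℝ} (h : (u, v) ∈ S.dom) (hu : u ≤ U) (hv : v ≤ V) :
    |2 * S.kappa u v - 1|
      ≤ 16 * Real.pi / 3 * zetaConst l a r₀ η * (r₀ ^ 3)⁻¹ * D ^ 2 := by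
  have hr₀ := hA.r₀_pos
  have hpi := Real.pi_pos
  have hr := hS.r_lower hA hP h hu hv
  obtain ⟨hk0, hk1⟩ := kappa_bounds hA hP h hu hv
  have hkpos : 0 < S.kappa u v := by linarith
  obtain ⟨h1, h2⟩ := hS.kappa_inv_bounds hA hP hD h hu hv
  have hz := zetaConst_nonneg hA
  have h3 : 16 * Real.pi / 3 * (zetaConst l a r₀ η * D ^ 2) * (S.r u v ^ 3)⁻¹
      ≤ 16 * Real.pi / 3 * (zetaConst l a r₀ η * D ^ 2) * (r₀ ^ 3)⁻¹ := by gcongr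
  have h4 : 2 * S.kappa u v - 1 = -(S.kappa u v * ((S.kappa u v)⁻¹ - 2)) := by
    field_simp
    ring
  rw [h4, abs_neg, abs_of_nonneg (mul_nonneg hkpos.le (by linarith))]
  have h5 : S.kappa u v * ((S.kappa u v)⁻¹ - 2) ≤ 1 * ((S.kappa u v)⁻¹ - 2) :=
    mul_le_mul_of_nonneg_right hk1 (by linarith)
  linarith

/-- The outgoing part of the `H¹_AdS` norm. -/
theorem integral_outgoing (hS : IsDevelopment l a M u₀ u₁ v₀ phiBar S)
    (hA : Admissible M l a c r₀ δ e η) (hP : PastBounds S l M δ U V) {D : ℝ}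
    (hD : DataBound S u₀ v₀ D U) {u v : ℝ} (h : (u, v) ∈ S.dom) (hu : u ≤ U) (hv : v ≤ V) :
    ∫⁻ y in Ioo v₀ v, ENNReal.ofReal
      ((S.r u y) ^ 2 * (S.oneSubMu l u y / S.lam u y * (S.dv S.phi u y) ^ 2
        + S.lam u y * (S.phi u y) ^ 2))
      ≤ ENNReal.ofReal (energyConst l a r₀ / (Real.pi * η) * D ^ 2) := by
  have hη := hA.η_pos
  have hpi := Real.pi_pos
  have hsol := hS.solves
  have hv₀ := (hS.u_bounds h).2.2
  have hsub := hS.Icc_subset_outgoing h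
  have hlam := fun y (hy : y ∈ Icc v₀ v) => hP.lam_pos u y (hsub hy) hu
  have hcomp : ContinuousOn (fun y : ℝ => (u, y)) (Icc v₀ v) := by fun_prop
  have hmaps : MapsTo (fun y : ℝ => (u, y)) (Icc v₀ v) S.dom := fun y hy => hsub hy
  have hcont : ContinuousOn (fun y => (S.r u y) ^ 2 * (S.oneSubMu l u y / S.lam u y
      * (S.dv S.phi u y) ^ 2 + S.lam u y * (S.phi u y) ^ 2)) (Icc v₀ v) := by
    have c1 := hsol.r_C1.cont.comp hcomp hmaps
    have c2 := (Config.continuousOn_oneSubMu hsol).comp hcomp hmaps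
    have c3 := (Config.continuousOn_lam hsol).comp hcomp hmaps
    have c4 := hsol.phi_C1.cont_dv.comp hcomp hmaps
    have c5 := hsol.phi_C1.cont.comp hcomp hmaps
    exact (c1.pow 2).mul (((c2.div c3 fun y hy => (hlam y hy).ne').mul (c4.pow 2)).add
      (c3.mul (c5.pow 2)))
  have hle := lintegral_Ioc_le_of_le_deriv hv₀ hsub
    (fun y hy => (Config.hasDerivWithinAt_mt_v hsol hA.c_pos (hsub hy)).const_mul
      (1 / (Real.pi * η))) hcont
    (fun y hy => by
      have := hlam y hy
      have := Config.oneSubMu_pos hsol (hsub hy) (hS.nu_neg (hsub hy)) this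
      positivity)
    (fun y hy => by
      have := hS.mtV_ge hA hP (hsub hy) hu (hy.2.trans hv)
      rw [one_div_mul_eq_div, le_div_iff₀ (by positivity)]
      linarith)
  refine (lintegral_mono_set Ioo_subset_Ioc_self).trans (hle.trans ?_)
  refine ENNReal.ofReal_le_ofReal ?_
  have h1 := hS.mt_le hA hP h hu hv
  have h2 := hS.mt_ge hA hP hD (hsub ⟨le_rfl, hv₀⟩) hu (hv₀.trans hv)
  have h3 : S.mt l c u v - S.mt l c u v₀ ≤ energyConst l a r₀ * D ^ 2 := by linarith
  have h4 := mul_le_mul_of_nonneg_left h3 (by positivity : 0 ≤ 1 / (Real.pi * η))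
  refine le_trans (le_of_eq (by ring)) (h4.trans (le_of_eq (by ring)))

/-- The ingoing part of the `H¹_AdS` norm. -/
theorem integral_ingoing (hS : IsDevelopment l a M u₀ u₁ v₀ phiBar S)
    (hA : Admissible M l a c r₀ δ e η) (hP : PastBounds S l M δ U V) {D : ℝ}
    (hD : DataBound S u₀ v₀ D U) {u v : ℝ} (h : (u, v) ∈ S.dom) (hu : u ≤ U) (hv : v ≤ V) :
    ∫⁻ x in Ioo (S.uI v) u, ENNReal.ofReal
      ((S.r x v) ^ 2 * ((S.r x v) ^ 2 / (-S.nu x v) * (S.du S.phi x v) ^ 2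
        - S.nu x v * (S.phi x v) ^ 2))
      ≤ ENNReal.ofReal (((l ^ 2 + 1) * energyConst l a r₀ / (Real.pi * η)
        + 3 * M * zetaConst l a r₀ η / r₀) * D ^ 2) := by
  have hl := hA.l_pos
  have hr₀ := hA.r₀_pos
  have hη := hA.η_pos
  have hM := hA.M_pos
  have hpi := Real.pi_pos
  have hsol := hS.solves
  have hz := zetaConst_nonneg hA
  have hsub := hS.Ioc_subset_ingoing h
  set Z := zetaConst l a r₀ η * D ^ 2 with hZdef
  have hZ0 : 0 ≤ Z := by positivity
  -- The primitive is a multiple of minus the modified mass plus `3MZ/r`. In `l² + 1` the `l²` pays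
  -- for the `φ_u` term at large `r` and the `1` for the `φ` term.
  have hle := lintegral_Ioo_le_of_le_deriv (L := -((l ^ 2 + 1) / (Real.pi * η)) * M) hsub
    (fun x hx => ((Config.hasDerivWithinAt_mt_u hsol hA.c_pos (hsub hx)).const_mul
      (-((l ^ 2 + 1) / (Real.pi * η)))).add
      ((hS.hasDerivWithinAt_r_inv_pow (hsub hx) 1).const_mul (3 * M * Z)))
    (hS.continuousOn_ingoing hS.continuousOn_energy_u h)
    (fun x hx => by
      have hn : 0 < -S.nu x v := neg_pos.2 (hS.nu_neg (hsub hx))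
      simp only
      rw [sub_eq_add_neg, ← neg_mul]
      positivity)
    (fun x hx => by
      have hd := hsub hx
      have hxU := hx.2.trans hu
      have hr := hsol.r_pos x v hd
      have hν := hS.nu_neg hd
      have hn : 0 < -S.nu x v := neg_pos.2 hν
      have hm := Config.oneSubMu_pos hsol hd hν (hP.lam_pos x v hd hxU)
      have hw := abs_le.1 (hP.mass x v hd hxU hv)
      have hZ := hS.zeta_bound hA hP hD hd hxU hv
      have h1 := hS.mtU_le hA hP hd hxU hv
      simp only
      have h2 : (S.r x v) ^ 2 * ((S.r x v) ^ 2 / (-S.nu x v) * (S.du S.phi x v) ^ 2)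
          ≤ l ^ 2 * (S.r x v ^ 2 * (S.oneSubMu l x v / (-S.nu x v) * S.du S.phi x v ^ 2))
            + 3 * M * Z * (-S.nu x v) / S.r x v ^ 2 := by
        -- For `r ≥ 3M` one has `1 - μ ≥ r²/l²` and the flux suffices. For `r < 3M` the flux
        -- degenerates, and the pointwise bound for `ζ/ν` is integrated instead.
        rcases le_or_gt (3 * M) (S.r x v) with hR | hR
        · have h3 : S.r x v ^ 2 ≤ l ^ 2 * S.oneSubMu l x v := by
            have h4 : 2 * S.varpi l x v / S.r x v ≤ 1 := by
              rw [div_le_one hr]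
              linarith [hA.δ_mass]
            have h5 : S.r x v ^ 2 / l ^ 2 ≤ S.oneSubMu l x v := by
              unfold Config.oneSubMu
              linarith
            rw [div_le_iff₀ (by positivity)] at h5
            linarith
          have h6 : (S.r x v) ^ 2 * ((S.r x v) ^ 2 / (-S.nu x v) * (S.du S.phi x v) ^ 2)
              ≤ S.r x v ^ 2 * (l ^ 2 * S.oneSubMu l x v / (-S.nu x v) * S.du S.phi x v ^ 2) := by
            gcongr
          have h7 : 0 ≤ 3 * M * Z * (-S.nu x v) / S.r x v ^ 2 := by positivity
          refine h6.trans ?_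
          refine le_of_sub_nonneg (h7.trans (le_of_eq ?_))
          ring
        · set ζ := S.zeta x v / S.nu x v with hζ
          have h5 : S.du S.phi x v = ζ * S.nu x v / S.r x v := by
            rw [hζ, Config.zeta]; have := hν.ne; field_simp
          have h6 : (S.r x v) ^ 2 * ((S.r x v) ^ 2 / (-S.nu x v) * (S.du S.phi x v) ^ 2)
              = S.r x v ^ 3 * ζ ^ 2 * (-S.nu x v) / S.r x v := by
            rw [h5]; have := hν.ne; field_simp
          have h7 : S.r x v ^ 3 * ζ ^ 2 * (-S.nu x v) / S.r x v
              ≤ 3 * M * Z * (-S.nu x v) / S.r x v ^ 2 := by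
            rw [div_le_div_iff₀ hr (by positivity)]
            have h8 : S.r x v ^ 3 * ζ ^ 2 * S.r x v ≤ Z * (3 * M) := by gcongr
            have h9 := mul_le_mul_of_nonneg_left h8
              (by positivity : 0 ≤ (-S.nu x v) * S.r x v)
            linarith
          rw [h6]
          have h8 : 0 ≤ l ^ 2 * (S.r x v ^ 2 *
              (S.oneSubMu l x v / (-S.nu x v) * S.du S.phi x v ^ 2)) := by positivity
          linarith
      have h3 := mul_le_mul_of_nonneg_left (neg_le_neg h1)
        (by positivity : 0 ≤ (l ^ 2 + 1) / (Real.pi * η))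
      have h4 : (l ^ 2 + 1) / (Real.pi * η) * -(-(Real.pi * η * (S.r x v ^ 2 *
          (S.oneSubMu l x v / (-S.nu x v) * S.du S.phi x v ^ 2 - S.nu x v * S.phi x v ^ 2))))
          = (l ^ 2 + 1) * (S.r x v ^ 2 * (S.oneSubMu l x v / (-S.nu x v) * S.du S.phi x v ^ 2))
            + (l ^ 2 + 1) * (S.r x v ^ 2 * (-S.nu x v * S.phi x v ^ 2)) := by
        field_simp; ring
      have h5 : 0 ≤ S.r x v ^ 2 * (S.oneSubMu l x v / (-S.nu x v) * S.du S.phi x v ^ 2) := by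
        positivity
      have h6 : 0 ≤ l ^ 2 * (S.r x v ^ 2 * (-S.nu x v * S.phi x v ^ 2)) := by positivity
      rw [h4] at h3
      have h7 : 3 * M * Z * -((1 : ℕ) * S.nu x v / S.r x v ^ (1 + 1))
          = 3 * M * Z * (-S.nu x v) / S.r x v ^ 2 := by push_cast; ring
      rw [h7]
      linarith)
    (fun x hx => by
      have hd := hsub hx
      have hr := hsol.r_pos x v hd
      have h1 := mul_le_mul_of_nonneg_left (hS.mt_le hA hP hd (hx.2.trans hu) hv)
        (by positivity : 0 ≤ (l ^ 2 + 1) / (Real.pi * η))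
      have h2 : 0 ≤ 3 * M * Z * (S.r x v ^ 1)⁻¹ := by positivity
      simp only [Pi.add_apply]
      linarith)
  refine hle.trans (ENNReal.ofReal_le_ofReal ?_)
  have h1 := hS.mt_ge hA hP hD h hu hv
  have h2 := hS.r_lower hA hP h hu hv
  have h3 := mul_le_mul_of_nonneg_left h1 (by positivity : 0 ≤ (l ^ 2 + 1) / (Real.pi * η))
  have h4 : 3 * M * Z * (S.r u v ^ 1)⁻¹ ≤ 3 * M * Z * r₀⁻¹ := by
    rw [pow_one]; gcongr
  have h5 : ((l ^ 2 + 1) * energyConst l a r₀ / (Real.pi * η)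
        + 3 * M * zetaConst l a r₀ η / r₀) * D ^ 2
      = (l ^ 2 + 1) / (Real.pi * η) * (energyConst l a r₀ * D ^ 2) + 3 * M * Z * r₀⁻¹ := by
    rw [hZdef]; ring
  rw [h5]
  simp only [Pi.add_apply]
  linarith

end IsDevelopment

/-- The estimates of the proposition at `(u, v)`, squared, with `D` for the data norm. -/
structure Estimates (S : Config) (l M v₀ C D u v : ℝ) : Prop where
  mass : |S.varpi l u v - M| ≤ C * D ^ 2
  kappa : |2 * S.kappa u v - 1| ≤ C * D ^ 2
  field : S.r u v ^ 3 * S.phi u v ^ 2 ≤ C * D ^ 2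
  zeta : S.r u v ^ 3 * (S.zeta u v / S.nu u v) ^ 2 ≤ C * D ^ 2
  ingoing : ∫⁻ x in Ioo (S.uI v) u, ENNReal.ofReal
      ((S.r x v) ^ 2 * ((S.r x v) ^ 2 / (-S.nu x v) * (S.du S.phi x v) ^ 2
        - S.nu x v * (S.phi x v) ^ 2)) ≤ ENNReal.ofReal (C * D ^ 2)
  outgoing : ∫⁻ y in Ioo v₀ v, ENNReal.ofReal
      ((S.r u y) ^ 2 * (S.oneSubMu l u y / S.lam u y * (S.dv S.phi u y) ^ 2
        + S.lam u y * (S.phi u y) ^ 2)) ≤ ENNReal.ofReal (C * D ^ 2)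

/-- The estimates hold under the bootstrap assumptions, with a constant that depends only on the
admissible constants. -/
theorem exists_estimates {l a M c r₀ δ e η : ℝ} (hA : Admissible M l a c r₀ δ e η) :
    ∃ C > 0, ∀ (u₀ u₁ v₀ : ℝ) (phiBar : ℝ → ℝ) (S : Config),
      IsDevelopment l a M u₀ u₁ v₀ phiBar S → ∀ U V D : ℝ, PastBounds S l M δ U V →
      DataBound S u₀ v₀ D U → ∀ u v : ℝ, (u, v) ∈ S.dom → u ≤ U → v ≤ V →
      Estimates S l M v₀ C D u v := by
  -- An upper bound of this finite set serves as the common constant; the element `1` makes it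
  -- positive.
  have hbd : BddAbove ({IsDevelopment.massConst l a r₀ η,
      16 * Real.pi / 3 * IsDevelopment.zetaConst l a r₀ η * (r₀ ^ 3)⁻¹,
      IsDevelopment.fieldConst l a r₀ η, IsDevelopment.zetaConst l a r₀ η,
      (l ^ 2 + 1) * IsDevelopment.energyConst l a r₀ / (Real.pi * η)
        + 3 * M * IsDevelopment.zetaConst l a r₀ η / r₀,
      IsDevelopment.energyConst l a r₀ / (Real.pi * η), 1} : Set ℝ) := (Set.toFinite _).bddAbove
  obtain ⟨C, hC⟩ := hbd
  have hC1 : 1 ≤ C := hC (by simp)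
  refine ⟨C, by linarith, fun u₀ u₁ v₀ phiBar S hS U V D hP hD u v h hu hv => ⟨?_, ?_, ?_, ?_, ?_, ?_⟩⟩
  · exact (hS.mass_bound hA hP hD h hu hv).trans
      (mul_le_mul_of_nonneg_right (hC (by simp)) (sq_nonneg D))
  · exact (hS.kappa_bound hA hP hD h hu hv).trans
      (mul_le_mul_of_nonneg_right (hC (by simp)) (sq_nonneg D))
  · exact (hS.field_bound hA hP hD h hu hv).trans
      (mul_le_mul_of_nonneg_right (hC (by simp)) (sq_nonneg D))
  · exact (hS.zeta_bound hA hP hD h hu hv).trans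
      (mul_le_mul_of_nonneg_right (hC (by simp)) (sq_nonneg D))
  · exact (hS.integral_ingoing hA hP hD h hu hv).trans (ENNReal.ofReal_le_ofReal
      (mul_le_mul_of_nonneg_right (hC (by simp)) (sq_nonneg D)))
  · exact (hS.integral_outgoing hA hP hD h hu hv).trans (ENNReal.ofReal_le_ofReal
      (mul_le_mul_of_nonneg_right (hC (by simp)) (sq_nonneg D)))

/-! ### Closing the bootstrap -/

namespace IsDevelopment

variable {S : Config} {l a M u₀ u₁ v₀ c r₀ δ e η U V : ℝ} {phiBar : ℝ → ℝ}

/-- The quantity on which the continuity argument is run. -/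
noncomputable def bootstrapSize (S : Config) (l M : ℝ) (p : ℝ × ℝ) : ℝ :=
  max (max |S.varpi l p.1 p.2 - M| |2 * S.kappa p.1 p.2 - 1|)
    (S.r p.1 p.2 ^ 3 * S.phi p.1 p.2 ^ 2)

theorem continuousOn_bootstrapSize (hS : IsDevelopment l a M u₀ u₁ v₀ phiBar S) :
    ContinuousOn (bootstrapSize S l M) S.dom := by
  have h1 := Config.continuousOn_varpi hS.solves
  have h2 := Config.continuousOn_kappa hS.solves fun u v h => hS.nu_neg h
  exact (((h1.sub continuousOn_const).abs).sup
    ((h2.const_smul (2 : ℝ)).sub continuousOn_const).abs).sup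
    ((hS.solves.r_C1.cont.pow 3).mul (hS.solves.phi_C1.cont.pow 2))

theorem tendsto_bootstrapSize (hS : IsDevelopment l a M u₀ u₁ v₀ phiBar S) {v : ℝ}
    (h : (S.ingoing v).Nonempty) :
    Tendsto (bootstrapSize S l M) (𝓝[S.dom] (S.uI v, v)) (𝓝 0) := by
  have h1 := ((hS.varpi_infty v h).sub_const M).abs
  have h2 := (((hS.kappa_infty v h).const_mul 2).sub_const 1).abs
  have h3 : Tendsto (fun p : ℝ × ℝ => S.r p.1 p.2 ^ 3 * S.phi p.1 p.2 ^ 2)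
      (𝓝[S.dom] (S.uI v, v)) (𝓝 0) := by
    have h4 := (hS.phi_infty v h).pow 2
    rw [zero_pow two_ne_zero] at h4
    refine h4.congr' ?_
    filter_upwards [self_mem_nhdsWithin] with p hp
    exact rpow_three_halves_mul_sq (hS.solves.r_pos p.1 p.2 hp).le _
  have := (h1.max h2).max h3
  norm_num at this
  exact this

/-- The continuity argument. -/
theorem pastBounds_of_improve (hS : IsDevelopment l a M u₀ u₁ v₀ phiBar S) (hδ : 0 < δ)
    (hUV : (U, V) ∈ S.dom) (hlam : ∀ u v, (u, v) ∈ S.dom → u ≤ U → 0 < S.lam u v)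
    (himp : ∀ u v, (u, v) ∈ S.dom → u ≤ U → v ≤ V → PastBounds S l M δ u v →
      bootstrapSize S l M (u, v) < δ) : PastBounds S l M δ U V := by
  have of_size : ∀ {u v : ℝ}, u ≤ U → (∀ p ∈ S.dom, p.1 ≤ u → p.2 ≤ v →
      bootstrapSize S l M p ≤ δ) → PastBounds S l M δ u v := by
    intro u v hu h
    refine ⟨fun u' v' h' hu' => hlam u' v' h' (hu'.trans hu), ?_, ?_, ?_⟩
    · intro u' v' h' hu' hv'
      exact ((le_max_left _ _).trans (le_max_left _ _)).trans (h (u', v') h' hu' hv')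
    · intro u' v' h' hu' hv'
      exact ((le_max_right _ _).trans (le_max_left _ _)).trans (h (u', v') h' hu' hv')
    · intro u' v' h' hu' hv'
      exact (le_max_right _ _).trans (h (u', v') h' hu' hv')
  have hcont := hS.continuousOn_bootstrapSize
  set B : Set (ℝ × ℝ) := {p | p ∈ S.dom ∧ p.1 ≤ U ∧ p.2 ≤ V ∧ δ ≤ bootstrapSize S l M p} with hB
  rcases B.eq_empty_or_nonempty with hemp | hne
  · refine of_size le_rfl fun p hp hu hv => ?_
    by_contra hlt
    have : p ∈ B := ⟨hp, hu, hv, (not_le.1 hlt).le⟩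
    rw [hemp] at this
    exact this
  exfalso
  have hsub := hS.subset_nonempty_ingoing hUV
  set K : Set (ℝ × ℝ) := {p | p ∈ Icc u₀ U ×ˢ Icc v₀ V ∧ S.uI p.2 ≤ p.1} with hK
  have hKclosed : IsClosed K := by
    refine IsClosed.isClosed_le (isClosed_Icc.prod isClosed_Icc) ?_ continuousOn_fst
    exact (hS.uI_cont.mono hsub).comp continuousOn_snd fun p hp => hp.2
  have hBK : B ⊆ K := fun p hp => by
    have hb := hS.u_bounds (u := p.1) (v := p.2) hp.1
    exact ⟨⟨⟨hb.1.le, hp.2.1⟩, ⟨hb.2.2, hp.2.2.1⟩⟩, (hS.uI_lt (u := p.1) (v := p.2) hp.1).le⟩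
  -- The only points where closedness could fail lie on null infinity, and there `bootstrapSize`
  -- tends to `0`, so the bad set stays away.
  have hBclosed : IsClosed B := by
    refine isClosed_of_closure_subset fun q hq => ?_
    have hqK : q ∈ K := closure_minimal hBK hKclosed hq
    have hne : (𝓝[B] q).NeBot := mem_closure_iff_nhdsWithin_neBot.1 hq
    have hle : 𝓝[B] q ≤ 𝓝[S.dom] q := nhdsWithin_mono q fun p hp => hp.1
    rcases eq_or_lt_of_le hqK.2 with heq | hlt
    · exfalso
      have hlim := hS.tendsto_bootstrapSize (hsub hqK.1.2)
      rw [heq] at hlim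
      obtain ⟨p, hp1, hp2⟩ := (((hlim.mono_left hle).eventually_lt_const hδ).and
        self_mem_nhdsWithin).exists
      exact absurd hp2.2.2.2 (not_le.2 hp1)
    · have hqd : q ∈ S.dom := hS.past_ingoing U q.2
        (hS.Icc_subset_outgoing hUV hqK.1.2) q.1 ⟨hlt, hqK.1.1.2⟩
      refine ⟨hqd, hqK.1.1.2, hqK.1.2.2, ?_⟩
      refine ge_of_tendsto ((hcont q hqd).mono_left hle) ?_
      filter_upwards [self_mem_nhdsWithin] with p hp
      exact hp.2.2.2
  have hBcompact : IsCompact B := (isCompact_Icc.prod isCompact_Icc).of_isClosed_subset hBclosed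
    fun p hp => (hBK hp).1
  -- A bad point minimizing `u + v` has no other bad point in its causal past.
  obtain ⟨p, hp, hmin⟩ := hBcompact.exists_isMinOn hne
    (f := fun p : ℝ × ℝ => p.1 + p.2) (by fun_prop)
  obtain ⟨u, v⟩ := p
  have hbefore : ∀ q ∈ S.dom, q.1 ≤ u → q.2 ≤ v → q.1 + q.2 < u + v →
      bootstrapSize S l M q < δ := by
    intro q hq hqu hqv hlt
    by_contra hge
    have := hmin (show q ∈ B from ⟨hq, hqu.trans hp.2.1, hqv.trans hp.2.2.1, not_lt.1 hge⟩)
    simp only [mem_ofPred_eq] at this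
    linarith
  have hpast : PastBounds S l M δ u v := by
    refine of_size hp.2.1 fun q hq hqu hqv => ?_
    rcases lt_or_ge (q.1 + q.2) (u + v) with hlt | hge
    · exact (hbefore q hq hqu hqv hlt).le
    · obtain rfl : q = (u, v) := Prod.ext (by simp only; linarith) (by simp only; linarith)
      -- At the minimal point itself the bound `≤ δ` follows by continuity from the left along the
      -- ingoing line.
      have hline : Tendsto (fun x : ℝ => (x, v)) (𝓝[<] u) (𝓝[S.dom] (u, v)) := by
        refine tendsto_nhdsWithin_iff.2 ⟨?_, ?_⟩
        · have hc : Continuous fun x : ℝ => (x, v) := by fun_prop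
          exact (hc.tendsto _).mono_left nhdsWithin_le_nhds
        · filter_upwards [Ioo_mem_nhdsLT (hS.uI_lt hq)] with x hx
          exact hS.Ioc_subset_ingoing hq ⟨hx.1, hx.2.le⟩
      refine le_of_tendsto ((hcont (u, v) hq).tendsto.comp hline) ?_
      filter_upwards [(tendsto_nhdsWithin_iff.1 hline).2, self_mem_nhdsWithin] with x hx hxu
      exact (hbefore (x, v) hx (le_of_lt hxu) le_rfl (by
        have : x < u := hxu
        simp only; linarith)).le
  exact absurd hp.2.2.2 (not_le.2 (himp u v hp.1 hp.2.1 hp.2.2.1 hpast))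

end IsDevelopment

/-! ### The data -/

theorem decayExp_pos {a : ℝ} (ha : -(9 / 8) < a) : 0 < decayExp a :=
  lt_min (Real.sqrt_pos.2 (by linarith)) two_pos

theorem hasDerivAt_rBar {l u₀ u₁ x : ℝ} (hl : 0 < l) (h1 : u₁ < u₀ + Real.pi * l)
    (hx : x ∈ Ioc u₀ u₁) : HasDerivAt (rBar l u₀) (rBarU l u₀ x) x := by
  have hs : 0 < Real.sin ((x - u₀) / (2 * l)) := by
    refine Real.sin_pos_of_pos_of_lt_pi (div_pos (by linarith [hx.1]) (by linarith)) ?_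
    rw [div_lt_iff₀ (by linarith)]
    have := Real.pi_pos
    nlinarith [hx.2]
  have hd : HasDerivAt (fun y : ℝ => (y - u₀) / (2 * l)) (1 / (2 * l)) x :=
    ((hasDerivAt_id x).sub_const u₀).div_const (2 * l)
  have hc := (((Real.hasDerivAt_cos _).div (Real.hasDerivAt_sin _) hs.ne').comp x hd).const_mul l
  refine (hc.congr_deriv ?_).congr_of_eventuallyEq (Eventually.of_forall fun y => ?_)
  · unfold rBarU rBar
    rw [Real.cot_eq_cos_div_sin]
    generalize (x - u₀) / (2 * l) = t at *
    have := Real.sin_sq_add_cos_sq t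
    field_simp
    linarith
  · simp only [rBar, Real.cot_eq_cos_div_sin, Function.comp_apply, Pi.div_apply]

namespace IsDevelopment

variable {S : Config} {l a M u₀ u₁ v₀ c r₀ δ e η U V ε : ℝ} {phiBar : ℝ → ℝ}

theorem nu_initial (hS : IsDevelopment l a M u₀ u₁ v₀ phiBar S) (hl : 0 < l)
    (h1 : u₁ < u₀ + Real.pi * l) {x : ℝ} (hx : x ∈ Ioc u₀ u₁) : S.nu x v₀ = rBarU l u₀ x := by
  unfold Config.nu Config.du
  rw [hS.ingoing_initial, derivWithin_congr (f := rBar l u₀) (fun y hy => hS.r_data y hy)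
    (hS.r_data x hx)]
  exact (hasDerivAt_rBar hl h1 hx).hasDerivWithinAt.derivWithin (uniqueDiffOn_Ioc u₀ u₁ x hx)

theorem phiU_initial (hS : IsDevelopment l a M u₀ u₁ v₀ phiBar S) {x : ℝ} (hx : x ∈ Ioc u₀ u₁) :
    S.du S.phi x v₀ = phiBarU u₀ u₁ phiBar x := by
  unfold Config.du phiBarU
  rw [hS.ingoing_initial]
  exact derivWithin_congr (fun y hy => hS.phi_data y hy) (hS.phi_data x hx)

/-- The pointwise decay of the data, in terms of the development. -/
theorem data_decay (hS : IsDevelopment l a M u₀ u₁ v₀ phiBar S) (hl : 0 < l)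
    (hd : IsPerturbedData l a u₀ u₁ ε phiBar) {x : ℝ} (hx : x ∈ Ioc u₀ u₁) :
    S.r x v₀ ^ (3 + decayExp a : ℝ) * S.phi x v₀ ^ 2 ≤ ε ^ 2 ∧
    S.r x v₀ ^ (3 + decayExp a : ℝ) * (S.zeta x v₀ / S.nu x v₀) ^ 2 ≤ ε ^ 2 := by
  have hr := hS.solves.r_pos x v₀ (hS.data_mem x hx)
  have hp := hd.pointwise x hx
  rw [← hS.r_data x hx, ← hS.phi_data x hx, ← hS.phiU_initial hx,
    ← hS.nu_initial hl hd.lt_center hx, ← mul_div_assoc] at hp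
  change _ * (_ + |S.zeta x v₀ / S.nu x v₀|) + _ ≤ _ at hp
  have hexp : S.r x v₀ ^ (3 + decayExp a : ℝ)
      = (S.r x v₀ ^ (3 / 2 + decayExp a / 2 : ℝ)) ^ 2 := by
    rw [← Real.rpow_natCast, ← Real.rpow_mul hr.le]
    congr 1
    push_cast
    ring
  have hR : 0 < S.r x v₀ ^ (3 / 2 + decayExp a / 2 : ℝ) := Real.rpow_pos_of_pos hr _
  rw [hexp]
  generalize S.r x v₀ ^ (3 / 2 + decayExp a / 2 : ℝ) = R at *
  have h0 := abs_nonneg (S.r x v₀ ^ (7 / 2 : ℝ) * (phiBarUU l u₀ u₁ phiBar x / S.nu x v₀))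
  have h1 : 0 ≤ R * |S.phi x v₀| := by positivity
  have h2 : 0 ≤ R * |S.zeta x v₀ / S.nu x v₀| := by positivity
  have key : ∀ y : ℝ, R * |y| ≤ ε → R ^ 2 * y ^ 2 ≤ ε ^ 2 := by
    intro y hy
    rw [← sq_abs y, ← mul_pow]
    exact pow_le_pow_left₀ (by positivity) hy 2
  exact ⟨key _ (by linarith), key _ (by linarith)⟩

/-- The data norm is small where `r` is bounded below. -/
theorem dataBound_of_perturbed (hS : IsDevelopment l a M u₀ u₁ v₀ phiBar S) (hl : 0 < l)
    (ha : -(9 / 8) < a) (hr₀ : 0 < r₀) (hd : IsPerturbedData l a u₀ u₁ ε phiBar) {u : ℝ}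
    (hu : u ∈ Ioc u₀ u₁) (hr : ∀ x ∈ Ioc u₀ u, r₀ ≤ S.r x v₀) {D : ℝ}
    (hD : ε ^ 2 * (r₀ ^ (-decayExp a) * (1 + 2 / decayExp a)) ≤ D ^ 2) :
    DataBound S u₀ v₀ D u := by
  have hs := decayExp_pos ha
  set s := decayExp a with hsdef
  have hr₀s : 0 < r₀ ^ (-s) := Real.rpow_pos_of_pos hr₀ _
  have hsub : Ioc u₀ u ⊆ Ioc u₀ u₁ := Ioc_subset_Ioc_right hu.2
  have hrs : ∀ x ∈ Ioc u₀ u, S.r x v₀ ^ (-s) ≤ r₀ ^ (-s) := fun x hx =>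
    Real.rpow_le_rpow_of_nonpos hr₀ (hr x hx) (by linarith)
  have hdec : ∀ x ∈ Ioc u₀ u, ∀ y : ℝ, S.r x v₀ ^ (3 + s : ℝ) * y ^ 2 ≤ ε ^ 2 →
      S.r x v₀ ^ 3 * y ^ 2 ≤ ε ^ 2 * S.r x v₀ ^ (-s) := by
    intro x hx y hy
    have hrx : 0 < S.r x v₀ := hr₀.trans_le (hr x hx)
    have h1 : S.r x v₀ ^ (3 + s : ℝ) * S.r x v₀ ^ (-s) = S.r x v₀ ^ 3 := by
      rw [← Real.rpow_add hrx, ← Real.rpow_natCast]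
      congr 1
      push_cast
      ring
    have := mul_le_mul_of_nonneg_right hy (Real.rpow_pos_of_pos hrx (-s)).le
    rw [← h1]
    linarith
  have hε : 0 ≤ ε ^ 2 * (r₀ ^ (-s) * (2 / s)) := by positivity
  refine ⟨?_, fun x hx => ?_⟩
  · have hle := lintegral_Ioo_le_of_le_deriv (a := u₀) (b := u) (L := 0) (s := S.ingoing v₀)
      (hS.ingoing_initial ▸ hsub)
      (f := fun x => (S.r x v₀) ^ 2 * ((S.r x v₀) ^ 2 / (-S.nu x v₀) * (S.du S.phi x v₀) ^ 2
        - S.nu x v₀ * (S.phi x v₀) ^ 2))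
      -- The pointwise decay bounds the integrand by `2 ε² (-ν) r^{-s-1}`, whose primitive is `(2
      -- ε²/s) r^{-s}`; this needs `s > 0`.
      (F := fun x => 2 * ε ^ 2 / s * S.r x v₀ ^ (-s))
      (fun x hx => ((hS.solves.r_C1.hasDerivWithinAt_u (hS.data_mem x (hsub hx))).rpow_const
        (p := -s) (Or.inl (hr₀.trans_le (hr x hx)).ne')).const_mul (2 * ε ^ 2 / s))
      ?_ ?_ ?_ ?_
    · refine hle.trans (ENNReal.ofReal_le_ofReal (le_trans ?_ hD))
      have h1 := mul_le_mul_of_nonneg_left (hrs u ⟨hu.1, le_rfl⟩)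
        (by positivity : 0 ≤ 2 * ε ^ 2 / s)
      have h2 : 0 ≤ ε ^ 2 * r₀ ^ (-s) := by positivity
      have h3 : ε ^ 2 * (r₀ ^ (-s) * (1 + 2 / s)) = ε ^ 2 * r₀ ^ (-s)
        + 2 * ε ^ 2 / s * r₀ ^ (-s) := by ring
      linarith
    · have := hS.continuousOn_ingoing hS.continuousOn_energy_u (hS.data_mem u hu)
      rwa [hS.uI_initial (hu.1.trans_le hu.2)] at this
    · intro x hx
      have hn : 0 < -S.nu x v₀ := neg_pos.2 (hS.nu_neg (hS.data_mem x (hsub hx)))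
      rw [sub_eq_add_neg, ← neg_mul]
      positivity
    · intro x hx
      have hrx : 0 < S.r x v₀ := hr₀.trans_le (hr x hx)
      have hν := hS.nu_neg (hS.data_mem x (hsub hx))
      have hn : 0 < -S.nu x v₀ := neg_pos.2 hν
      obtain ⟨h1, h2⟩ := hS.data_decay hl hd (hsub hx)
      have h1' := hdec x hx _ h1
      have h2' := hdec x hx _ h2
      set ζ := S.zeta x v₀ / S.nu x v₀ with hζ
      have h5 : S.du S.phi x v₀ = ζ * S.nu x v₀ / S.r x v₀ := by
        rw [hζ, Config.zeta]; have := hν.ne; field_simp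
      have h6 : (S.r x v₀) ^ 2 * ((S.r x v₀) ^ 2 / (-S.nu x v₀) * (S.du S.phi x v₀) ^ 2
          - S.nu x v₀ * (S.phi x v₀) ^ 2) = (-S.nu x v₀) / S.r x v₀ *
          (S.r x v₀ ^ 3 * ζ ^ 2 + S.r x v₀ ^ 3 * S.phi x v₀ ^ 2) := by
        rw [h5]
        have := hν.ne
        field_simp
        ring
      have h7 : S.r x v₀ ^ (-s - 1) = S.r x v₀ ^ (-s) / S.r x v₀ := by
        rw [Real.rpow_sub hrx, Real.rpow_one]
      rw [h6, h7]
      have h8 : (-S.nu x v₀) / S.r x v₀ *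
          (S.r x v₀ ^ 3 * ζ ^ 2 + S.r x v₀ ^ 3 * S.phi x v₀ ^ 2)
          ≤ (-S.nu x v₀) / S.r x v₀ * (2 * (ε ^ 2 * S.r x v₀ ^ (-s))) := by
        refine mul_le_mul_of_nonneg_left (by linarith) (by positivity)
      refine h8.trans (le_of_eq ?_)
      change _ = 2 * ε ^ 2 / s * (S.nu x v₀ * -s * _)
      field_simp
    · intro x hx
      have hrx : 0 < S.r x v₀ := hr₀.trans_le (hr x hx)
      have := Real.rpow_pos_of_pos hrx (-s)
      positivity
  · have h1 := hdec x hx _ (hS.data_decay hl hd (hsub hx)).2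
    have h2 := mul_le_mul_of_nonneg_left (hrs x hx) (sq_nonneg ε)
    linarith

end IsDevelopment

/-! ### Choice of `ε` and passage to the norms of the proposition. -/

/-- For small data the bootstrap assumptions hold everywhere in the exterior. -/
theorem exists_pastBounds {M l a c r₀ δ e η : ℝ} (ha : -(9 / 8) < a)
    (hA : Admissible M l a c r₀ δ e η) :
    ∃ ε > (0 : ℝ), ∀ (u₀ u₁ v₀ : ℝ) (phiBar : ℝ → ℝ) (S : Config),
      IsPerturbedData l a u₀ u₁ ε phiBar → IsDevelopment l a M u₀ u₁ v₀ phiBar S →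
      ∀ u v : ℝ, (u, v) ∈ S.dom → u < S.uH u₀ → PastBounds S l M δ u v := by
  obtain ⟨C, hC, hest⟩ := exists_estimates hA
  have hδ := hA.δ_pos
  have hs := decayExp_pos ha
  set A := r₀ ^ (-decayExp a) * (1 + 2 / decayExp a) with hAdef
  have hA0 : 0 < A := by
    have := Real.rpow_pos_of_pos hA.r₀_pos (-decayExp a)
    positivity
  -- With this `ε` the data norm satisfies `D² = δ/(2C)`, so the estimates give `C D² = δ/2 < δ`.
  refine ⟨√(δ / (2 * C * A)), Real.sqrt_pos.2 (by positivity), ?_⟩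
  intro u₀ u₁ v₀ phiBar S hd hS U V hUV hUH
  have hε : √(δ / (2 * C * A)) ^ 2 = δ / (2 * C * A) := Real.sq_sqrt (by positivity)
  refine hS.pastBounds_of_improve hδ hUV
    (fun u v h hu => hS.lam_pos hA.l_pos h (hu.trans_lt hUH)) fun u v h hu hv hP => ?_
  have hb := hS.u_bounds h
  have hD : DataBound S u₀ v₀ √(δ / (2 * C)) u := by
    refine hS.dataBound_of_perturbed hA.l_pos ha hA.r₀_pos hd ⟨hb.1, hb.2.1⟩ (fun x hx =>
      hS.r_lower hA hP (hS.data_mem x ⟨hx.1, hx.2.trans hb.2.1⟩) hx.2 hb.2.2) ?_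
    rw [hε, Real.sq_sqrt (by positivity), ← hAdef]
    exact le_of_eq (by field_simp)
  have hE := hest u₀ u₁ v₀ phiBar S hS u v _ hP hD u v h le_rfl le_rfl
  have hCD : C * √(δ / (2 * C)) ^ 2 < δ := by
    rw [Real.sq_sqrt (by positivity)]
    have : C * (δ / (2 * C)) = δ / 2 := by field_simp
    linarith
  exact max_lt (max_lt (hE.mass.trans_lt hCD) (hE.kappa.trans_lt hCD)) (hE.field.trans_lt hCD)

/-- The right-hand side of the proposition bounds the data norm. -/
theorem dataBound_of_norm {S : Config} {l a M u₀ u₁ v₀ u D : ℝ} {phiBar : ℝ → ℝ}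
    (hS : IsDevelopment l a M u₀ u₁ v₀ phiBar S) (hD0 : 0 ≤ D) (hu : u ∈ Ioc u₀ u₁)
    (huH : u < S.uH u₀)
    (hD : S.H1AdS l v₀ S.phi (S.uH u₀) v₀
      + ⨆ x ∈ Set.Ioo u₀ (S.uH u₀), ENNReal.ofReal (S.zetaWeighted x v₀) ≤ ENNReal.ofReal D) :
    DataBound S u₀ v₀ D u := by
  refine ⟨?_, fun x hx => ?_⟩
  · have h1 : S.H1AdS l v₀ S.phi (S.uH u₀) v₀ ≤ ENNReal.ofReal D := le_self_add.trans hD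
    unfold Config.H1AdS at h1
    have h2 := ENNReal.rpow_le_rpow h1 zero_le_two
    rw [← ENNReal.rpow_mul, hS.uI_initial (hu.1.trans_le hu.2)] at h2
    norm_num at h2
    refine (lintegral_mono_set (Ioo_subset_Ioo_right huH.le)).trans (h2.trans (le_of_eq ?_))
    rw [ENNReal.ofReal_pow hD0]
  · have hr := hS.solves.r_pos x v₀ (hS.data_mem x ⟨hx.1, hx.2.trans hu.2⟩)
    have h1 : ENNReal.ofReal (S.zetaWeighted x v₀) ≤ ENNReal.ofReal D :=
      (le_iSup₂ (f := fun x (_ : x ∈ Ioo u₀ (S.uH u₀)) => ENNReal.ofReal (S.zetaWeighted x v₀))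
        x ⟨hx.1, hx.2.trans_lt huH⟩).trans (le_add_self.trans hD)
    have h2 := (ENNReal.ofReal_le_ofReal_iff hD0).1 h1
    rw [← rpow_three_halves_mul_sq hr.le, ← sq_abs]
    exact pow_le_pow_left₀ (abs_nonneg _) h2 2

/-- The squared estimates imply the estimate of the proposition. -/
theorem Estimates.sum_le {S : Config} {l M v₀ C D u v : ℝ} (h : Estimates S l M v₀ C D u v)
    (hC : 0 < C) (hD : 0 ≤ D) (hr : 0 < S.r u v) :
    ENNReal.ofReal
        (|S.varpi l u v - M| ^ (1 / 2 : ℝ) + |2 * S.kappa u v - 1| ^ (1 / 2 : ℝ)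
          + |(S.r u v) ^ (3 / 2 : ℝ) * S.phi u v| + S.zetaWeighted u v)
      + S.H1AdS l v₀ S.phi u v ≤ ENNReal.ofReal (5 * √(2 * C) * D) := by
  -- The `2` accounts for the two integrals in the `H¹_AdS` norm, and the factor `5` in the claim
  -- for the five terms on the left.
  set K := √(2 * C) with hK
  have hK0 : 0 ≤ K := Real.sqrt_nonneg _
  have hKD : (K * D) ^ 2 = 2 * (C * D ^ 2) := by
    rw [mul_pow, hK, Real.sq_sqrt (by positivity)]; ring
  have hKD0 : 0 ≤ K * D := by positivity
  have hCD : 0 ≤ C * D ^ 2 := by positivity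
  have hsqrt : ∀ x : ℝ, x ≤ C * D ^ 2 → x ^ (1 / 2 : ℝ) ≤ K * D := fun x hx => by
    rw [← Real.sqrt_eq_rpow]
    exact Real.sqrt_le_iff.2 ⟨hKD0, by rw [hKD]; linarith⟩
  have habs : ∀ x : ℝ, S.r u v ^ 3 * x ^ 2 ≤ C * D ^ 2 →
      |S.r u v ^ (3 / 2 : ℝ) * x| ≤ K * D := fun x hx => by
    refine abs_le_of_sq_le_sq ?_ hKD0
    rw [rpow_three_halves_mul_sq hr.le, hKD]
    linarith
  have h1 := hsqrt _ h.mass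
  have h2 := hsqrt _ h.kappa
  have h3 := habs _ h.field
  have h4 : S.zetaWeighted u v ≤ K * D := habs _ h.zeta
  have h5 : S.H1AdS l v₀ S.phi u v ≤ ENNReal.ofReal (K * D) := by
    unfold Config.H1AdS
    have h6 := add_le_add h.ingoing h.outgoing
    rw [← ENNReal.ofReal_add hCD hCD, ← two_mul, ← hKD] at h6
    refine (ENNReal.rpow_le_rpow h6 (by norm_num)).trans (le_of_eq ?_)
    rw [ENNReal.ofReal_rpow_of_nonneg (sq_nonneg _) (by norm_num), ← Real.sqrt_eq_rpow,
      Real.sqrt_sq hKD0]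
  calc _ ≤ ENNReal.ofReal (4 * (K * D)) + ENNReal.ofReal (K * D) :=
        add_le_add (ENNReal.ofReal_le_ofReal (by linarith)) h5
    _ = _ := by
        rw [← ENNReal.ofReal_add (by positivity) hKD0]
        congr 1
        ring

end EKG

theorem proposition3p1 (M l a : ℝ) (hM : 0 < M) (hl : 0 < l) (ha : -(9 / 8) < a) :
    ∃ ε > (0 : ℝ), ∃ B > (0 : ℝ),
      ∀ (u₀ u₁ v₀ : ℝ) (phiBar : ℝ → ℝ) (S : EKG.Config),
        EKG.IsPerturbedData l a u₀ u₁ ε phiBar →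
        EKG.IsDevelopment l a M u₀ u₁ v₀ phiBar S →
        ∀ u v : ℝ, (u, v) ∈ S.exterior u₀ →
          ENNReal.ofReal
              (|S.varpi l u v - M| ^ (1 / 2 : ℝ) + |2 * S.kappa u v - 1| ^ (1 / 2 : ℝ)
                + |(S.r u v) ^ (3 / 2 : ℝ) * S.phi u v| + S.zetaWeighted u v)
            + S.H1AdS l v₀ S.phi u v
          ≤ ENNReal.ofReal B *
              (S.H1AdS l v₀ S.phi (S.uH u₀) v₀
                + ⨆ x ∈ Set.Ioo u₀ (S.uH u₀), ENNReal.ofReal (S.zetaWeighted x v₀)) := by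
  obtain ⟨c, r₀, δ, e, η, hA⟩ := EKG.exists_admissible hM hl ha
  obtain ⟨ε, hε, hpast⟩ := EKG.exists_pastBounds ha hA
  obtain ⟨C, hC, hest⟩ := EKG.exists_estimates hA
  have hB : 0 < 5 * √(2 * C) := by positivity
  refine ⟨ε, hε, 5 * √(2 * C), hB, ?_⟩
  intro u₀ u₁ v₀ phiBar S hd hS u v hex
  have hdom : (u, v) ∈ S.dom := hex.1.1
  have huH : u < S.uH u₀ := hex.2.2
  have hb := hS.u_bounds hdom
  set X := S.H1AdS l v₀ S.phi (S.uH u₀) v₀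
    + ⨆ x ∈ Set.Ioo u₀ (S.uH u₀), ENNReal.ofReal (S.zetaWeighted x v₀) with hX
  rcases eq_or_ne X ⊤ with htop | htop
  · rw [htop, ENNReal.mul_top (ENNReal.ofReal_pos.2 hB).ne']
    exact le_top
  have hXD : X = ENNReal.ofReal X.toReal := (ENNReal.ofReal_toReal htop).symm
  have hP := hpast u₀ u₁ v₀ phiBar S hd hS u v hdom huH
  -- Smallness was needed only for `hP`. The estimates are now used with the actual value of the
  -- right-hand side as `D`.
  have hD := EKG.dataBound_of_norm hS ENNReal.toReal_nonneg ⟨hb.1, hb.2.1⟩ huH hXD.le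
  have hE := hest u₀ u₁ v₀ phiBar S hS u v _ hP hD u v hdom le_rfl le_rfl
  refine (hE.sum_le hC ENNReal.toReal_nonneg (hS.solves.r_pos u v hdom)).trans (le_of_eq ?_)
  rw [ENNReal.ofReal_mul hB.le, ← hXD]
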